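/- Let $d\ge 1$, let $\Omega\subseteq\mathbb R^d$ be open and $T>0$. Let $p=p(\rho,e)$ be an equation of state, continuous on a convex set $\mathcal D\subseteq\{(\rho,e):\rho>0\}$ of admissible pairs ($e$ is the internal energy per unit volume). For a state $U=(\rho,\mathbf m,e)$ with $(\rho,e)\in\mathcal D$ put $\mathbf u=\mathbf m/\rho$, $E=e+\tfrac12\rho|\mathbf u|^2$, $W(U)=(\rho,\mathbf m,E)$ and $$\mathbf f(U)\cdot\nu=\big(\rho\,\mathbf u\cdot\nu,\ \rho(\mathbf u\cdot\nu)\mathbf u+p\,\nu,\ (E+p)\,\mathbf u\cdot\nu\big),\qquad\text{so that the Euler system is}\quad \partial_tW+\operatorname{div}\mathbf f(U)=0. \tag{1}$$ **The schemes.** For $k\in\mathbb N$ let $\mathcal T_k$ be a conforming, locally finite mesh of $\overline\Omega$ by simplices, with the vertices $\sigma$ as degrees of freedom; let $h_K$ be the diameter of $K$ and $|C_\sigma|=\sum_{K\ni\sigma}|K|/(d+1)$ the volume of the median dual cell. For nodal values $V=(V_\sigma)$ let $V_h=(\rho_h,\mathbf m_h,e_h)$ be the continuous piecewise affine interpolant.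 On each mesh let residuals $\Phi^K_{\sigma,\rho}(V)$, $\Phi^K_{\sigma,\mathbf m}(V)$, $\Phi^K_{\sigma,e}(V,V')$ be given for $\sigma\in K$, where $V$ stands for the old and $V'$ for the new nodal values. Write $\underline{\mathbf u}$ and $\overline{\mathbf u}$ for the velocities of $V$ and $V'$, and $(\Phi^K_\rho,\Phi^K_{\mathbf m},\Phi^K_E)=\int_{\partial K}\mathbf f(V_h)\cdot\mathbf n\,d\Gamma$. Assume that for all nodal fields $V,V'$ with admissible values and all elements $K$ $$\sum_{\sigma\in K}\Phi^K_{\sigma,\rho}=\Phi^K_\rho,\qquad \sum_{\sigma\in K}\Phi^K_{\sigma,\mathbf m}=\Phi^K_{\mathbf m},$$ $$\sum_{\sigma\in K}\Phi^K_{\sigma,e}=\Phi^K_E-\sum_{\sigma\in K}\frac{\overline{\mathbf u}_\sigma+\underline{\mathbf u}_\sigma}{2}\cdot\Phi^K_{\sigma,\mathbf m}+\frac12\sum_{\sigma\in K}\overline{\mathbf u}_\sigma\cdot\underline{\mathbf u}_\sigma\,\Phi^K_{\sigma,\rho}.$$ Let time steps $\Delta t_k>0$ and numbers of steps $N_k$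 with $N_k\Delta t_k\ge T$ be given, and let the nodal values $U^{k,j}$ satisfy, for $0\le j<N_k$ and every vertex $\sigma\in\Omega$, $$|C_\sigma|\,(U^{k,j+1}_\sigma-U^{k,j}_\sigma)+\Delta t_k\sum_{K\ni\sigma}\Phi^K_\sigma=0\qquad\text{for } U=(\rho,\mathbf m,e),$$ with residuals evaluated at $V=U^{k,j}$, $V'=U^{k,j+1}$; the treatment of boundary vertices is arbitrary. **Lax–Wendroff hypotheses.** Assume that - $\Delta t_k\to0$ and $\sup_{K\in\mathcal T_k}h_K\to0$, and $|K|\ge c\,h_K^d$ with a constant $c>0$ independent of $K$ and $k$; - for every compact set $Q$ of admissible states there is a constant $C$, independent of $k$, $K$ and $\sigma$, such that $|\Phi^K_{\sigma,\xi}|\le C\,h_K^{d-1}\sum_{\sigma',\sigma''\in K}|V_{\sigma'}-V_{\sigma''}|$ for $\xi=\rho,\mathbf m,e$ whenever all values of $V$ and $V'$ lie in $Q$; - all $U^{k,j}_\sigma$ with $0\le j\le N_k$ lie in one compact set of admissible states; - for some $p\in[1,\infty]$ the functions $U_k(t,x)=(U^{k,j})_h(x)$ for $t\in[j\Delta t_k,(j+1)\Delta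 t_k)$ converge in $L^p_{\rm loc}((0,T)\times\Omega)$ to a measurable function $U=(\rho,\mathbf m,e)$. **Claim.** Define total-energy residuals by $$\Phi^K_{\sigma,E}=\Phi^K_{\sigma,e}+\frac{\overline{\mathbf u}_\sigma+\underline{\mathbf u}_\sigma}{2}\cdot\Phi^K_{\sigma,\mathbf m}-\frac12\,\overline{\mathbf u}_\sigma\cdot\underline{\mathbf u}_\sigma\,\Phi^K_{\sigma,\rho}.$$ 1. For all nodal fields $V,V'$ with admissible values and all $K$, $\sum_{\sigma\in K}\Phi^K_{\sigma,E}=\Phi^K_E$; thus $\Phi^K_\sigma=(\Phi^K_{\sigma,\rho},\Phi^K_{\sigma,\mathbf m},\Phi^K_{\sigma,E})$ satisfies $\sum_{\sigma\in K}\Phi^K_\sigma=\int_{\partial K}\mathbf f(V_h)\cdot\mathbf n\,d\Gamma$. 2. The scheme is locally conservative for $W=(\rho,\mathbf m,E)$. For every step $0\le j<N_k$ and every vertex $\sigma\in\Omega$, $$|C_\sigma|\big(W(U^{k,j+1}_\sigma)-W(U^{k,j}_\sigma)\big)+\Delta t_k\sum_{K\ni\sigma}\Phi^K_\sigma=0,$$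 and in each step there are numerical fluxes $\hat f^K_{\sigma\sigma'}=-\hat f^K_{\sigma'\sigma}$ ($\sigma,\sigma'\in K$) such that $\Phi^K_\sigma=\sum_{\sigma'\in K}\hat f^K_{\sigma\sigma'}+\int_{\partial K}\lambda_\sigma\,\mathbf f(U^{k,j}_h)\cdot\mathbf n\,d\Gamma$, where $\lambda_\sigma$ is the barycentric coordinate of $\sigma$; $\hat f^K_{\sigma\sigma'}=\mathbf f(c)\cdot\nu^K_{\sigma\sigma'}$ if $U^{k,j}$ equals a constant $c$ at the vertices of $K$, where $\nu^K_{\sigma\sigma'}$ is the area vector, pointing from $\sigma$ to $\sigma'$, of the part in $K$ of the interface between the median dual cells of $\sigma$ and $\sigma'$; and $$|C_\sigma|\big(W(U^{k,j+1}_\sigma)-W(U^{k,j}_\sigma)\big)+\Delta t_k\sum_{K\ni\sigma}\sum_{\sigma'\in K}\hat f^K_{\sigma\sigma'}=0\qquad\text{for every vertex }\sigma\in\Omega.$$ 3. The limit $U$ is a weak solution of (1) in $(0,T)\times\Omega$: it is admissible almost everywhere, $W(U)$ and $\mathbf f(U)$ are locally integrable, and $\int_0^T\!\int_\Omega\big(W(U)\,\partial_t\varphi+\mathbf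 f(U)\cdot\nabla\varphi\big)\,dx\,dt=0$ for all $\varphi\in C_c^\infty((0,T)\times\Omega)$. 4. If moreover $(U^{k,0})_h\to U_0$ in $L^p_{\rm loc}(\Omega)$ with $U_0$ measurable, then $U_0$ is admissible almost everywhere, $W(U_0)$ is locally integrable on $\Omega$, $W(U)$ and $\mathbf f(U)$ are locally integrable on $[0,T)\times\Omega$, and $U$ is a weak solution of (1) with initial data $U_0$: $\int_0^T\!\int_\Omega\big(W(U)\,\partial_t\varphi+\mathbf f(U)\cdot\nabla\varphi\big)\,dx\,dt+\int_\Omega W(U_0)\,\varphi(0,\cdot)\,dx=0$ for all $\varphi\in C_c^\infty((-\infty,T)\times\Omega)$. -/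

import Mathlib

open MeasureTheory Set Filter Topology
open scoped ENNReal ContDiff

noncomputable section

namespace EulerRD

/-! ### States, equation of state, Euler flux -/

/-- Physical space `ℝ^d` with `d = n + 1`, so that `d ≥ 1`. -/
abbrev Pt (n : ℕ) : Type := EuclideanSpace ℝ (Fin (n + 1))

/-- A state `(ρ, m, e)`: density, momentum, internal energy per unit volume. -/
abbrev State (n : ℕ) : Type := ℝ × Pt n × ℝ

/-- A value `(ρ, m, E)` of the conserved variables (or of a residual or flux for them). -/
abbrev Cons (n : ℕ) : Type := ℝ × Pt n × ℝ

/-- An equation of state `p = p(ρ, e)`, continuous on a convex set of admissible pairs `(ρ, e)`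
with `ρ > 0`. -/
structure EquationOfState where
  dom : Set (ℝ × ℝ)
  convex_dom : Convex ℝ dom
  density_pos : ∀ a ∈ dom, 0 < a.1
  p : ℝ → ℝ → ℝ
  continuousOn_p : ContinuousOn (fun a : ℝ × ℝ => p a.1 a.2) dom

variable {n : ℕ}

/-- The set of admissible states `(ρ, m, e)`. -/
def EquationOfState.admissible (eos : EquationOfState) (n : ℕ) : Set (State n) :=
  {U | (U.1, U.2.2) ∈ eos.dom}

/-- The velocity `u = m / ρ`. -/
def velocity (U : State n) : Pt n := (U.1)⁻¹ • U.2.1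

/-- The total energy `E = e + ρ |u|² / 2`. -/
def totalEnergy (U : State n) : ℝ := U.2.2 + 1 / 2 * U.1 * ‖velocity U‖ ^ 2

/-- The conserved variables `(ρ, m, E)` of a state `(ρ, m, e)`. -/
def conserved (U : State n) : Cons n := (U.1, U.2.1, totalEnergy U)

/-- The Euler flux contracted with a vector:
`f(U)·ν = (ρ u·ν, (ρ u ⊗ u + p Id) ν, (E + p) u·ν)`. -/
def eulerFlux (eos : EquationOfState) (U : State n) (ν : Pt n) : Cons n :=
  (U.1 * inner ℝ (velocity U) ν,
    (U.1 * inner ℝ (velocity U) ν) • velocity U + eos.p U.1 U.2.2 • ν,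
    (totalEnergy U + eos.p U.1 U.2.2) * inner ℝ (velocity U) ν)

/-! ### Integrals over the faces of a simplex -/

/-- The reference simplex `{s ∈ ℝ^n : s ≥ 0, ∑ s ≤ 1}`. -/
def refSimplex (n : ℕ) : Set (Fin n → ℝ) := {s | (∀ j, 0 ≤ s j) ∧ ∑ j, s j ≤ 1}

/-- The `j`-th vertex of the face of `S` opposite to its `i`-th vertex. -/
def faceVertex (S : Fin (n + 2) → Pt n) (i : Fin (n + 2)) (j : Fin (n + 1)) : Pt n :=
  S (i.succAbove j)

/-- The affine parametrization, over the reference simplex of `ℝ^(d-1)`, of the face of `S`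
opposite to its `i`-th vertex. -/
def facePoint (S : Fin (n + 2) → Pt n) (i : Fin (n + 2)) (s : Fin n → ℝ) : Pt n :=
  faceVertex S i 0 + ∑ j, s j • (faceVertex S i j.succ - faceVertex S i 0)

/-- The determinant with rows `v` and the tangent vectors `∂_j (facePoint S i)`. -/
def faceDet (S : Fin (n + 2) → Pt n) (i : Fin (n + 2)) (v : Pt n) : ℝ :=
  Matrix.det (Matrix.of fun a b : Fin (n + 1) =>
    (Fin.cons v (fun j : Fin n => faceVertex S i j.succ - faceVertex S i 0) :
      Fin (n + 1) → Pt n) a b)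

/-- The outward normal to the `i`-th face with length equal to the surface element of
`facePoint S i`: the generalized cross product of the tangent vectors (whose inner product with
`v` is `faceDet S i v`), oriented away from the opposite vertex.
Thus `n dΓ = faceNormal S i ds` on that face. -/
def faceNormal (S : Fin (n + 2) → Pt n) (i : Fin (n + 2)) : Pt n :=
  WithLp.toLp 2 fun a =>
    -Real.sign (faceDet S i (S i - faceVertex S i 0)) * faceDet S i (EuclideanSpace.single a 1)

/-- The boundary integral `∫_{∂S} G(x, n) dΓ` of an expression linear in the outward normal. -/
def boundaryIntegral (S : Fin (n + 2) → Pt n) (G : Pt n → Pt n → Cons n) : Cons n :=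
  ∑ i, ∫ s in refSimplex n, G (facePoint S i s) (faceNormal S i)

/-! ### Meshes -/

/-- A conforming simplicial mesh of the closure of `Ω`. -/
structure Mesh (n : ℕ) (Ω : Set (Pt n)) where
  Elem : Type
  simplex : Elem → AffineBasis (Fin (n + 2)) ℝ (Pt n)
  ext_vertices : ∀ K L, range (simplex K) = range (simplex L) → K = L
  conforming : ∀ K L, convexHull ℝ (range (simplex K)) ∩ convexHull ℝ (range (simplex L)) ⊆
    convexHull ℝ (range (simplex K) ∩ range (simplex L))
  cover : ⋃ K, convexHull ℝ (range (simplex K)) = closure Ω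
  locallyFinite : LocallyFinite fun K => convexHull ℝ (range (simplex K))

namespace Mesh

variable {Ω : Set (Pt n)} (M : Mesh n Ω)

/-- The closed simplex `K`. -/
def cell (K : M.Elem) : Set (Pt n) := convexHull ℝ (range (M.simplex K))

/-- The degrees of freedom: the vertices of the elements. -/
def Vertex : Type := {x : Pt n // ∃ K i, M.simplex K i = x}

/-- The `i`-th vertex of the element `K`, as a degree of freedom. -/
def vertex (K : M.Elem) (i : Fin (n + 2)) : M.Vertex := ⟨M.simplex K i, K, i, rfl⟩

/-- Discrete unknowns: a state at every degree of freedom. -/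
abbrev NodalField : Type := M.Vertex → State n

/-- The elements `K ∋ σ`, each with the local number of `σ` in `K`. -/
def star (σ : M.Vertex) : Set (M.Elem × Fin (n + 2)) := {q | M.vertex q.1 q.2 = σ}

/-- The `star` of a vertex is finite, so the sums over it below are ordinary finite sums. -/
theorem star_finite (σ : M.Vertex) : (M.star σ).Finite := by
  have h := M.locallyFinite.point_finite σ.1
  refine (h.prod (finite_univ (α := Fin (n + 2)))).subset ?_
  rintro ⟨K, i⟩ hq
  have hq' : M.vertex K i = σ := hq
  refine ⟨?_, mem_univ _⟩
  subst hq'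
  exact subset_convexHull ℝ _ ⟨i, rfl⟩

/-- The volume `|C_σ|` of the median dual cell of `σ`: every element gives each of its
`d + 1 = n + 2` vertices the same share of its volume. -/
def dualVolume (σ : M.Vertex) : ℝ :=
  ∑ᶠ q ∈ M.star σ, volume.real (M.cell q.1) / (n + 2)

/-- The affine (`P¹`) interpolant on the element `K`. -/
def interp (V : M.NodalField) (K : M.Elem) (x : Pt n) : State n :=
  ∑ i, (M.simplex K).coord i x • V (M.vertex K i)

open Classical in
/-- The continuous piecewise affine function with the given nodal values. -/
def recon (V : M.NodalField) (x : Pt n) : State n :=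
  if h : ∃ K, x ∈ M.cell K then M.interp V h.choose x else 0

theorem interp_vertex (V : M.NodalField) (K : M.Elem) (i : Fin (n + 2)) :
    M.interp V K (M.simplex K i) = V (M.vertex K i) := by
  unfold interp
  rw [Finset.sum_eq_single i]
  · simp
  · intro j _ hj
    simp [AffineBasis.coord_apply_ne _ hj]
  · simp

theorem interp_combo (V : M.NodalField) (K : M.Elem) (x y : Pt n) (a b : ℝ) (hab : a + b = 1) :
    M.interp V K (a • x + b • y) = a • M.interp V K x + b • M.interp V K y := by
  unfold interp
  rw [Finset.smul_sum, Finset.smul_sum, ← Finset.sum_add_distrib]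
  refine Finset.sum_congr rfl fun i _ => ?_
  rw [Convex.combo_affine_apply hab, add_smul, smul_eq_mul, smul_eq_mul, mul_smul, mul_smul]

/-- The piecewise affine function does not depend on the element used to evaluate it. -/
theorem recon_eq_interp (V : M.NodalField) (K : M.Elem) {x : Pt n} (hx : x ∈ M.cell K) :
    M.recon V x = M.interp V K x := by
  have h : ∃ K, x ∈ M.cell K := ⟨K, hx⟩
  unfold recon
  rw [dif_pos h]
  have key : convexHull ℝ (range (M.simplex h.choose) ∩ range (M.simplex K)) ⊆
      {y | M.interp V h.choose y = M.interp V K y} := by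
    refine convexHull_min ?_ ?_
    · rintro y ⟨⟨i, rfl⟩, ⟨j, hj⟩⟩
      have hv : M.vertex h.choose i = M.vertex K j := Subtype.ext hj.symm
      show M.interp V h.choose (M.simplex h.choose i) = M.interp V K (M.simplex h.choose i)
      rw [interp_vertex, ← hj, interp_vertex, hv]
    · intro y hy z hz a b _ _ hab
      change M.interp V h.choose y = M.interp V K y at hy
      change M.interp V h.choose z = M.interp V K z at hz
      change M.interp V h.choose (a • y + b • z) = M.interp V K (a • y + b • z)
      rw [interp_combo _ _ _ _ _ _ _ hab, interp_combo _ _ _ _ _ _ _ hab, hy, hz]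
  exact key (M.conforming _ _ ⟨h.choose_spec, hx⟩)

/-- The approximate solution as a function of `(t, x)`: continuous and piecewise affine in `x`,
constant in `t` on every `[j dt, (j+1) dt)`. -/
def approx (dt : ℝ) (U : ℕ → M.NodalField) (z : ℝ × Pt n) : State n :=
  M.recon (U ⌊z.1 / dt⌋₊) z.2

/-- `∫_{∂K} f(U_h)·n dΓ`, the total residuals of mass, momentum and total energy. -/
def totalFlux (eos : EquationOfState) (V : M.NodalField) (K : M.Elem) : Cons n :=
  boundaryIntegral (M.simplex K) fun x ν => eulerFlux eos (M.interp V K x) ν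

/-- `∫_{∂K} λ_i f(U_h)·n dΓ` with the barycentric coordinate `λ_i`, the `P¹` basis function. -/
def weightedFlux (eos : EquationOfState) (V : M.NodalField) (K : M.Elem) (i : Fin (n + 2)) :
    Cons n :=
  boundaryIntegral (M.simplex K) fun x ν =>
    (M.simplex K).coord i x • eulerFlux eos (M.interp V K x) ν

/-- The area vector, pointing from vertex `i` to vertex `j`, of the part inside `K` of the
interface between the median dual cells of these vertices: `(N_i - N_j) / (d (d+1))`, where
`N_i = faceNormal / (d-1)!` is the outward area vector of the face opposite to vertex `i`. -/
def dualNormal (K : M.Elem) (i j : Fin (n + 2)) : Pt n :=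
  ((Nat.factorial (n + 2) : ℝ))⁻¹ • (faceNormal (M.simplex K) i - faceNormal (M.simplex K) j)

/-- The nodal field takes admissible values. -/
def Admissible (eos : EquationOfState) (V : M.NodalField) : Prop :=
  ∀ σ, V σ ∈ eos.admissible n

end Mesh

/-! ### Residual distribution schemes -/

variable {Ω : Set (Pt n)}

/-- The residuals `Φ_{σ,ρ}^K`, `Φ_{σ,m}^K` (functions of the old nodal values) and `Φ_{σ,e}^K`
(a function of the old nodal values and, through the new velocities, of the new ones). -/
structure Residuals (M : Mesh n Ω) where
  mass : M.NodalField → M.Elem → Fin (n + 2) → ℝ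
  momentum : M.NodalField → M.Elem → Fin (n + 2) → Pt n
  energy : M.NodalField → M.NodalField → M.Elem → Fin (n + 2) → ℝ

namespace Residuals

variable {M : Mesh n Ω} (R : Residuals M)

/-- The residuals of mass and momentum of each element sum to the boundary integral of the
corresponding flux. -/
def MassMomentumConservation (eos : EquationOfState) : Prop :=
  ∀ V : M.NodalField, M.Admissible eos V → ∀ K,
    ∑ i, R.mass V K i = (M.totalFlux eos V K).1 ∧
    ∑ i, R.momentum V K i = (M.totalFlux eos V K).2.1

/-- The discrete conservation relation for the internal energy,
`∑ Φ_{σ,e} = Φ_E - ∑ (ū_σ + u̲_σ)/2 · Φ_{σ,m} + ½ ∑ ū_σ·u̲_σ Φ_{σ,ρ}` on each element, with the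
velocities `u̲` of the old field `V` and `ū` of the new field `V'`. -/
def InternalEnergyRelation (eos : EquationOfState) : Prop :=
  ∀ V V' : M.NodalField, M.Admissible eos V → M.Admissible eos V' → ∀ K,
    ∑ i, R.energy V V' K i =
      (M.totalFlux eos V K).2.2
      - ∑ i, inner ℝ ((1 / 2 : ℝ) • (velocity (V' (M.vertex K i)) + velocity (V (M.vertex K i))))
          (R.momentum V K i)
      + 1 / 2 * ∑ i, inner ℝ (velocity (V' (M.vertex K i))) (velocity (V (M.vertex K i)))
          * R.mass V K i

/-- The total energy residual
`Φ_{σ,E} = Φ_{σ,e} + (ū_σ + u̲_σ)/2 · Φ_{σ,m} - ½ ū_σ·u̲_σ Φ_{σ,ρ}`. -/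
def totalEnergy (V V' : M.NodalField) (K : M.Elem) (i : Fin (n + 2)) : ℝ :=
  R.energy V V' K i
  + inner ℝ ((1 / 2 : ℝ) • (velocity (V' (M.vertex K i)) + velocity (V (M.vertex K i))))
      (R.momentum V K i)
  - 1 / 2 * inner ℝ (velocity (V' (M.vertex K i))) (velocity (V (M.vertex K i))) * R.mass V K i

/-- The residuals `(Φ_{σ,ρ}, Φ_{σ,m}, Φ_{σ,E})` for the conserved variables. -/
def conserved (V V' : M.NodalField) (K : M.Elem) (i : Fin (n + 2)) : Cons n :=
  (R.mass V K i, R.momentum V K i, R.totalEnergy V V' K i)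

/-- `U^0, …, U^N` is computed by the first order scheme
`|C_σ| (U_σ^{j+1} - U_σ^j) + dt ∑_{K ∋ σ} Φ_σ^K = 0` for `(ρ, m, e)` at all degrees of freedom
inside `Ω` (the treatment of those on the boundary is left free). -/
def IsSolution (dt : ℝ) (N : ℕ) (U : ℕ → M.NodalField) : Prop :=
  ∀ j < N, ∀ σ : M.Vertex, σ.1 ∈ Ω →
    M.dualVolume σ * ((U (j + 1) σ).1 - (U j σ).1)
      + dt * ∑ᶠ q ∈ M.star σ, R.mass (U j) q.1 q.2 = 0 ∧
    M.dualVolume σ • ((U (j + 1) σ).2.1 - (U j σ).2.1)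
      + dt • ∑ᶠ q ∈ M.star σ, R.momentum (U j) q.1 q.2 = 0 ∧
    M.dualVolume σ * ((U (j + 1) σ).2.2 - (U j σ).2.2)
      + dt * ∑ᶠ q ∈ M.star σ, R.energy (U j) (U (j + 1)) q.1 q.2 = 0

/-- A time step `V → V'` has a conservative flux form for `(ρ, m, E)`: there are antisymmetric
numerical fluxes between the vertices of each element that differ from the residuals only by the
consistent boundary term, reproduce `f(c)·ν` when the old data on the element equal a constant
`c`, and by which alone the scheme updates the degrees of freedom inside `Ω`. -/
def HasFluxForm (eos : EquationOfState) (dt : ℝ) (V V' : M.NodalField) : Prop :=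
  ∃ F : M.Elem → Fin (n + 2) → Fin (n + 2) → Cons n,
    (∀ K i j, F K i j = -F K j i) ∧
    (∀ K i, R.conserved V V' K i = ∑ j, F K i j + M.weightedFlux eos V K i) ∧
    (∀ K c, (∀ i, V (M.vertex K i) = c) → ∀ i j, F K i j = eulerFlux eos c (M.dualNormal K i j)) ∧
    (∀ σ : M.Vertex, σ.1 ∈ Ω →
      M.dualVolume σ • (EulerRD.conserved (V' σ) - EulerRD.conserved (V σ))
        + dt • ∑ᶠ q ∈ M.star σ, ∑ j, F q.1 q.2 j = 0)

end Residuals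

/-! ### Hypotheses of Lax-Wendroff type on a sequence of meshes and schemes -/

/-- The largest element diameter tends to zero. -/
def MeshSizeTendsToZero (M : ℕ → Mesh n Ω) : Prop :=
  ∀ ε > 0, ∀ᶠ k in atTop, ∀ K : (M k).Elem, Metric.diam ((M k).cell K) ≤ ε

/-- Shape regularity: `|K| ≥ c h_K^d` with `c > 0` independent of the element and the mesh. -/
def ShapeRegular (M : ℕ → Mesh n Ω) : Prop :=
  ∃ c > 0, ∀ k, ∀ K : (M k).Elem,
    c * Metric.diam ((M k).cell K) ^ (n + 1) ≤ volume.real ((M k).cell K)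

/-- For data with values in a compact set of admissible states, every residual is bounded by
`C h_K^{d-1} ∑_{σ,σ' ∈ K} |U_σ - U_σ'|`, where `C` depends only on the compact set and on the
sequence of meshes and schemes. -/
def ResidualBound (eos : EquationOfState) {M : ℕ → Mesh n Ω} (R : ∀ k, Residuals (M k)) : Prop :=
  ∀ Q : Set (State n), IsCompact Q → Q ⊆ eos.admissible n →
    ∃ C : ℝ, ∀ k, ∀ V V' : (M k).NodalField, (∀ σ, V σ ∈ Q) → (∀ σ, V' σ ∈ Q) →
      ∀ K i,
        |(R k).mass V K i| ≤ C * Metric.diam ((M k).cell K) ^ n *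
          ∑ a, ∑ b, ‖V ((M k).vertex K a) - V ((M k).vertex K b)‖ ∧
        ‖(R k).momentum V K i‖ ≤ C * Metric.diam ((M k).cell K) ^ n *
          ∑ a, ∑ b, ‖V ((M k).vertex K a) - V ((M k).vertex K b)‖ ∧
        |(R k).energy V V' K i| ≤ C * Metric.diam ((M k).cell K) ^ n *
          ∑ a, ∑ b, ‖V ((M k).vertex K a) - V ((M k).vertex K b)‖

/-- The computed nodal values stay in one compact set of admissible states. -/
def StaysBounded (eos : EquationOfState) {M : ℕ → Mesh n Ω} (N : ℕ → ℕ)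
    (U : ∀ k, ℕ → (M k).NodalField) : Prop :=
  ∃ Q : Set (State n), IsCompact Q ∧ Q ⊆ eos.admissible n ∧ ∀ k, ∀ j ≤ N k, ∀ σ, U k j σ ∈ Q

/-- Convergence in `L^p` on all compact subsets of `s`. -/
def TendstoInLpLoc {X : Type*} [TopologicalSpace X] [MeasureSpace X] (p : ℝ≥0∞) (s : Set X)
    (f : ℕ → X → State n) (g : X → State n) : Prop :=
  ∀ C : Set X, IsCompact C → C ⊆ s →
    Tendsto (fun k => eLpNorm (f k - g) p (volume.restrict C)) atTop (𝓝 0)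

/-! ### Weak solutions of the conservative Euler system -/

/-- `∫_{(0,T)×Ω} (∂_t φ (ρ, m, E) + f(U)·∇φ) dt dx`. -/
def weakForm (eos : EquationOfState) (Ω : Set (Pt n)) (T : ℝ) (U : ℝ × Pt n → State n)
    (φ : ℝ × Pt n → ℝ) : Cons n :=
  ∫ z in Ioo 0 T ×ˢ Ω,
    (deriv (fun t => φ (t, z.2)) z.1 • conserved (U z)
      + eulerFlux eos (U z) (gradient (fun x => φ (z.1, x)) z.2))

/-- `U = (ρ, m, e)` is a measurable function with admissible values for which `(ρ, m, E)` and
`f(U)` are locally integrable on `s`, a set of times and points. -/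
def IsAdmissibleOn (eos : EquationOfState) (s : Set (ℝ × Pt n)) (U : ℝ × Pt n → State n) :
    Prop :=
  AEStronglyMeasurable U (volume.restrict s) ∧
  (∀ᵐ z ∂volume.restrict s, U z ∈ eos.admissible n) ∧
  LocallyIntegrableOn (fun z => conserved (U z)) s ∧
  ∀ ν : Pt n, LocallyIntegrableOn (fun z => eulerFlux eos (U z) ν) s

/-- `U = (ρ, m, e)` is a weak solution of the conservative Euler system in `(0,T) × Ω`. -/
def IsWeakSolution (eos : EquationOfState) (Ω : Set (Pt n)) (T : ℝ) (U : ℝ × Pt n → State n) :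
    Prop :=
  IsAdmissibleOn eos (Ioo 0 T ×ˢ Ω) U ∧
  ∀ φ : ℝ × Pt n → ℝ, ContDiff ℝ ∞ φ → HasCompactSupport φ → tsupport φ ⊆ Ioo 0 T ×ˢ Ω →
    weakForm eos Ω T U φ = 0

/-- `U = (ρ, m, e)` is a weak solution of the conservative Euler system in `[0,T) × Ω` with initial
state `U₀`. -/
def IsWeakSolutionWithData (eos : EquationOfState) (Ω : Set (Pt n)) (T : ℝ)
    (U : ℝ × Pt n → State n) (U₀ : Pt n → State n) : Prop :=
  IsAdmissibleOn eos (Ico 0 T ×ˢ Ω) U ∧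
  (∀ᵐ x ∂volume.restrict Ω, U₀ x ∈ eos.admissible n) ∧
  LocallyIntegrableOn (fun x => conserved (U₀ x)) Ω ∧
  ∀ φ : ℝ × Pt n → ℝ, ContDiff ℝ ∞ φ → HasCompactSupport φ → tsupport φ ⊆ Iio T ×ˢ Ω →
    weakForm eos Ω T U φ + ∫ x in Ω, φ (0, x) • conserved (U₀ x) = 0

end EulerRD

end

open EulerRD

/-! Energy. With m = ρu the identity E' - E = (e' - e) + (u' + u)/2 · (m' - m) - (u'·u)/2 (ρ' - ρ)
is exact (`totalEnergy_sub_totalEnergy`). Its coefficients are those in the definition of Φ_E and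
depend only on the vertex, so the three nodal updates at a vertex combine to the update of E. The
relation imposed on Φ_e is precisely what makes the Φ_E of an element sum to the boundary flux.

Flux form. Subtract from Φ_σ the boundary integral weighted by λ_σ. The remainders r_σ
(`Residuals.interior`) sum to zero on each element, so r_σ = ∑_σ' (r_σ - r_σ')/(d+1) is an
antisymmetric splitting. Around a vertex in Ω the weighted integrals cancel: λ_σ vanishes on the
face opposite to σ, and every face through σ has exactly one element on its other side, which sees
the same trace and the opposite normal (`finsum_star_weightedFlux`). Hence the r_σ alone drive the
update.

Weak form. Test the update with φ, sum by parts in time and sort by elements (`discrete_weak_form`).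
On an element ∑ φ(σ) r_σ = ∑ (φ(σ) - φ(σ₀)) r_σ. If the data there are close to a state c, then Φ_σ
is negligible by the residual bound, and the weighted integral is close to a multiple of f(c)·N_σ,
where N_σ is the normal of the face opposite to σ. Since the normals are multiples of the gradients
of the barycentric coordinates, the sum is close to -|K| f(c)·∇φ (`sum_inner_smul_faceNormal`).
Divided by the volumes of the space-time cells, the tested scheme is therefore a cellwise constant
function which converges pointwise to the integrand of the weak form (`tendsto_testDensity`). Shape
regularity bounds it uniformly (`norm_testDensity_le`), and dominated convergence applies.

The pointwise limit needs all nodal values around almost every point to converge to U. This follows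
from strong convergence of the interpolants alone, without a bound on their variation: V_σ = 2
V_h((x+σ)/2) - V_h(x), so nodal values are controlled by cell averages; comparison with a continuous
approximation of U and a subsequence do the rest (`exists_subseq_nodal_tendsto`). The limit inherits
the compact set of the nodal values. Passing to subsequences is harmless because the weak form
involves only the limit.

Initial data. The term left at t = 0 is a nodal quadrature of φ(0,·) W. It vanishes for test
functions supported in t > 0, and along a further subsequence it converges to the integral of φ(0,·)
W(U₀). -/

noncomputable section

namespace EulerRD

section

variable {n : ℕ}

/-! ### The reference simplex -/

/-- Barycentric coordinates on the reference simplex. -/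
def bary (s : Fin n → ℝ) : Fin (n + 1) → ℝ := Fin.cons (1 - ∑ j, s j) s

/-- The linear part of `bary`. -/
def baryLin (n : ℕ) : (Fin n → ℝ) →ₗ[ℝ] (Fin (n + 1) → ℝ) where
  toFun s := Fin.cons (-∑ j, s j) s
  map_add' s t := by
    ext j
    refine Fin.cases ?_ (fun j => ?_) j
    · simp [Finset.sum_add_distrib]; ring
    · simp
  map_smul' c s := by
    ext j
    refine Fin.cases ?_ (fun j => ?_) j
    · simp [Finset.mul_sum]
    · simp

theorem sum_bary (s : Fin n → ℝ) : ∑ j, bary s j = 1 := by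
  simp [bary, Fin.sum_univ_succ]

theorem bary_nonneg {s : Fin n → ℝ} (hs : s ∈ refSimplex n) (j : Fin (n + 1)) : 0 ≤ bary s j := by
  refine Fin.cases ?_ (fun j => ?_) j
  · simpa [bary] using hs.2
  · simpa [bary] using hs.1 j

theorem mem_refSimplex_iff {s : Fin n → ℝ} : s ∈ refSimplex n ↔ ∀ j, 0 ≤ bary s j := by
  refine ⟨bary_nonneg, fun h => ⟨fun j => by simpa [bary] using h j.succ, ?_⟩⟩
  simpa [bary] using h 0

theorem bary_le_one {s : Fin n → ℝ} (hs : s ∈ refSimplex n) (j : Fin (n + 1)) : bary s j ≤ 1 := by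
  rw [← sum_bary s]
  exact Finset.single_le_sum (fun j _ => bary_nonneg hs j) (Finset.mem_univ j)

theorem continuous_bary : Continuous (bary : (Fin n → ℝ) → Fin (n + 1) → ℝ) := by
  refine continuous_pi fun j => ?_
  refine Fin.cases ?_ (fun j => ?_) j
  · simp only [bary, Fin.cons_zero]; fun_prop
  · simp only [bary, Fin.cons_succ]; fun_prop

theorem continuous_bary_apply (j : Fin (n + 1)) : Continuous fun s : Fin n → ℝ => bary s j :=
  (continuous_apply j).comp continuous_bary

theorem bary_eq_add (s : Fin n → ℝ) : bary s = baryLin n s + bary 0 := by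
  ext j
  refine Fin.cases ?_ (fun j => ?_) j
  · simp [bary, baryLin]; ring
  · simp [bary, baryLin]

theorem sum_baryLin (s : Fin n → ℝ) : ∑ j, baryLin n s j = 0 := by
  simp [baryLin, Fin.sum_univ_succ]

theorem bary_tail {w : Fin (n + 1) → ℝ} (hw : ∑ j, w j = 1) : bary (Fin.tail w) = w := by
  ext j
  refine Fin.cases ?_ (fun j => ?_) j
  · rw [Fin.sum_univ_succ] at hw
    simp [bary, Fin.tail]; linarith
  · simp [bary, Fin.tail]

theorem baryLin_tail {w : Fin (n + 1) → ℝ} (hw : ∑ j, w j = 0) : baryLin n (Fin.tail w) = w := by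
  ext j
  refine Fin.cases ?_ (fun j => ?_) j
  · rw [Fin.sum_univ_succ] at hw
    simp [baryLin, Fin.tail]; linarith
  · simp [baryLin, Fin.tail]

theorem isCompact_refSimplex (n : ℕ) : IsCompact (refSimplex n) := by
  have hc : IsClosed (refSimplex n) := by
    have : refSimplex n = ⋂ j, {s | 0 ≤ bary s j} := by
      ext s; simp [mem_refSimplex_iff]
    rw [this]
    exact isClosed_iInter fun j =>
      isClosed_le continuous_const ((continuous_apply j).comp continuous_bary)
  refine (isCompact_Icc (a := (0 : Fin n → ℝ)) (b := 1)).of_isClosed_subset hc ?_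
  intro s hs
  refine ⟨fun j => hs.1 j, fun j => ?_⟩
  simpa [bary] using bary_le_one hs j.succ

theorem measurableSet_refSimplex (n : ℕ) : MeasurableSet (refSimplex n) :=
  (isCompact_refSimplex n).isClosed.measurableSet

/-! ### Invariance under permutations of the vertices -/

/-- The linear part of the map permuting the barycentric coordinates. -/
def permLin (π : Equiv.Perm (Fin (n + 1))) : (Fin n → ℝ) →ₗ[ℝ] (Fin n → ℝ) :=
  (LinearMap.funLeft ℝ ℝ fun j : Fin n => π j.succ) ∘ₗ baryLin n

/-- The affine map of the reference simplex permuting the barycentric coordinates. -/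
def permMap (π : Equiv.Perm (Fin (n + 1))) (s : Fin n → ℝ) : Fin n → ℝ :=
  Fin.tail (bary s ∘ π)

theorem baryLin_permLin (π : Equiv.Perm (Fin (n + 1))) (s : Fin n → ℝ) :
    baryLin n (permLin π s) = baryLin n s ∘ π :=
  baryLin_tail (w := baryLin n s ∘ π)
    (by simpa using (Equiv.sum_comp π (baryLin n s)).trans (sum_baryLin s))

theorem bary_permMap (π : Equiv.Perm (Fin (n + 1))) (s : Fin n → ℝ) :
    bary (permMap π s) = bary s ∘ π :=
  bary_tail (by simpa using (Equiv.sum_comp π (bary s)).trans (sum_bary s))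

/-- Precomposition reverses the order of the factors; determinants do not notice this. -/
theorem permLin_mul (π ρ : Equiv.Perm (Fin (n + 1))) :
    permLin (π * ρ) = permLin ρ ∘ₗ permLin π := by
  ext1 j
  ext1
  simp only [LinearMap.comp_apply]
  ext k
  show baryLin n _ _ = baryLin n (permLin π _) _
  rw [baryLin_permLin]
  rfl

theorem permLin_one : permLin (1 : Equiv.Perm (Fin (n + 1))) = LinearMap.id := by
  refine LinearMap.ext fun s => funext fun k => ?_
  show baryLin n s k.succ = s k
  simp [baryLin]

/-- The determinant is a homomorphism from a finite group to ℝ under multiplication, so its values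
are roots of unity. No determinant has to be computed. -/
theorem abs_det_permLin (π : Equiv.Perm (Fin (n + 1))) : |LinearMap.det (permLin π)| = 1 := by
  let f : Equiv.Perm (Fin (n + 1)) →* ℝ :=
    { toFun := fun π => LinearMap.det (permLin π)
      map_one' := by simp [permLin_one]
      map_mul' := fun π ρ => by rw [permLin_mul, LinearMap.det_comp, mul_comm] }
  have h : f π ^ orderOf π = 1 := by rw [← map_pow, pow_orderOf_eq_one, map_one]
  have h2 : |f π| ^ orderOf π = 1 := by rw [← abs_pow, h, abs_one]
  exact (pow_eq_one_iff_of_nonneg (abs_nonneg _) (orderOf_pos π).ne').1 h2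

theorem permMap_eq (π : Equiv.Perm (Fin (n + 1))) (s : Fin n → ℝ) :
    permMap π s = permLin π s + permMap π 0 := by
  ext k
  show bary s (π k.succ) = baryLin n s (π k.succ) + bary 0 (π k.succ)
  rw [bary_eq_add s]; rfl

theorem measurePreserving_permMap (π : Equiv.Perm (Fin (n + 1))) :
    MeasurePreserving (permMap π) volume volume := by
  have hdet : LinearMap.det (permLin π) ≠ 0 := by
    intro h
    have := abs_det_permLin π
    simp [h] at this
  have h1 : MeasurePreserving (permLin π) volume volume := by
    refine ⟨(LinearMap.continuous_on_pi _).measurable, ?_⟩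
    rw [Real.map_linearMap_volume_pi_eq_smul_volume_pi hdet, abs_inv, abs_det_permLin]
    simp
  have h2 := (measurePreserving_add_right (volume : Measure (Fin n → ℝ)) (permMap π 0)).comp h1
  convert! h2 using 1
  exact funext fun s => permMap_eq π s

theorem permMap_injective (π : Equiv.Perm (Fin (n + 1))) : Function.Injective (permMap π) := by
  intro s t h
  have h1 : bary s ∘ π = bary t ∘ π := by rw [← bary_permMap, ← bary_permMap, h]
  have h2 : bary s = bary t := π.surjective.injective_comp_right h1
  have h3 := congrArg Fin.tail h2
  simpa [bary] using h3

theorem continuous_permMap (π : Equiv.Perm (Fin (n + 1))) : Continuous (permMap π) := by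
  refine continuous_pi fun j => ?_
  exact continuous_bary_apply _

/-- Integrals over the reference simplex are invariant under permutations of the barycentric
coordinates. -/
theorem setIntegral_refSimplex_perm {E : Type*} [NormedAddCommGroup E] [NormedSpace ℝ E]
    (π : Equiv.Perm (Fin (n + 1))) (g : (Fin (n + 1) → ℝ) → E) :
    ∫ s in refSimplex n, g (bary s ∘ π) = ∫ s in refSimplex n, g (bary s) := by
  have hpre : permMap π ⁻¹' refSimplex n = refSimplex n := by
    ext s
    simp only [mem_preimage, mem_refSimplex_iff, bary_permMap, Function.comp]
    exact ⟨fun h j => by simpa using h (π.symm j), fun h j => h _⟩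
  have := (measurePreserving_permMap π).setIntegral_preimage_emb
    ((continuous_permMap π).measurableEmbedding (permMap_injective π)) (fun s => g (bary s))
    (refSimplex n)
  rw [hpre] at this
  simpa only [bary_permMap] using this

theorem integrableOn_refSimplex {E : Type*} [NormedAddCommGroup E]
    {f : (Fin n → ℝ) → E} (hf : ContinuousOn f (refSimplex n)) : IntegrableOn f (refSimplex n) :=
  hf.integrableOn_compact (isCompact_refSimplex n)

theorem integral_bary_eq (i : Fin (n + 1)) :
    ∫ s in refSimplex n, bary s i = ∫ s in refSimplex n, bary s 0 := by
  simpa using setIntegral_refSimplex_perm (Equiv.swap 0 i) (fun w => w 0)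

/-- Cavalieri in the first coordinate: the fibre over `s` is the interval from 0 to `bary s 0`. -/
theorem volume_real_refSimplex_succ (n : ℕ) :
    volume.real (refSimplex (n + 1)) = ∫ s in refSimplex n, bary s 0 := by
  have hmp := volume_preserving_piFinSuccAbove (fun _ : Fin (n + 1) => ℝ) 0
  let A : Set (ℝ × (Fin n → ℝ)) := {z | z.2 ∈ refSimplex n ∧ 0 ≤ z.1 ∧ z.1 ≤ bary z.2 0}
  have hA : MeasurableSet A :=
    (measurable_snd (measurableSet_refSimplex n)).inter
      ((measurableSet_le measurable_const measurable_fst).inter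
        (measurableSet_le measurable_fst
          ((continuous_bary_apply 0).measurable.comp measurable_snd)))
  have hpre : refSimplex (n + 1) =
      (MeasurableEquiv.piFinSuccAbove (fun _ : Fin (n + 1) => ℝ) 0) ⁻¹' A := by
    ext s
    simp only [refSimplex, A, mem_preimage, mem_ofPred_eq, MeasurableEquiv.piFinSuccAbove_apply,
      Fin.insertNthEquiv_zero, Fin.consEquiv_symm_apply, Fin.forall_fin_succ, Fin.sum_univ_succ,
      bary, Fin.cons_zero, Fin.tail]
    constructor
    · rintro ⟨⟨h0, h1⟩, h2⟩
      exact ⟨⟨h1, by linarith⟩, h0, by linarith⟩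
    · rintro ⟨⟨h1, _⟩, h0, h2⟩
      exact ⟨⟨h0, h1⟩, by linarith⟩
  rw [Measure.real, hpre, hmp.measure_preimage hA.nullMeasurableSet, Measure.volume_eq_prod,
    Measure.prod_apply_symm hA]
  have hfib : ∀ s : Fin n → ℝ, volume ((fun t : ℝ => (t, s)) ⁻¹' A) =
      (refSimplex n).indicator (fun s => ENNReal.ofReal (bary s 0)) s := by
    intro s
    by_cases hs : s ∈ refSimplex n
    · rw [indicator_of_mem hs]
      have : (fun t : ℝ => (t, s)) ⁻¹' A = Icc 0 (bary s 0) := by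
        ext t; simp [A, hs]
      rw [this, Real.volume_Icc, sub_zero]
    · rw [indicator_of_notMem hs]
      have : (fun t : ℝ => (t, s)) ⁻¹' A = ∅ := by
        ext t; simp [A, hs]
      rw [this, measure_empty]
  simp_rw [hfib]
  rw [lintegral_indicator (measurableSet_refSimplex n),
    integral_eq_lintegral_of_nonneg_ae]
  · exact (ae_restrict_mem (measurableSet_refSimplex n)).mono fun s hs => bary_nonneg hs 0
  · exact (continuous_bary_apply 0).aestronglyMeasurable

/-- The barycentric coordinates sum to one and have equal integrals by symmetry. With the slicing
formula this gives a recursion for the volume. -/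
theorem volume_real_refSimplex_eq (n : ℕ) :
    volume.real (refSimplex n) = (n + 1) * ∫ s in refSimplex n, bary s 0 := by
  have h : ∫ s in refSimplex n, ∑ j, bary s j = ∑ j : Fin (n + 1), ∫ s in refSimplex n, bary s 0 := by
    rw [integral_finsetSum]
    · exact Finset.sum_congr rfl fun i _ => integral_bary_eq i
    · exact fun i _ => integrableOn_refSimplex (continuous_bary_apply i).continuousOn
  simp only [sum_bary] at h
  simpa using h

theorem volume_real_refSimplex (n : ℕ) :
    volume.real (refSimplex n) = ((n.factorial : ℝ))⁻¹ := by
  induction n with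
  | zero =>
    have : refSimplex 0 = univ := by ext s; simp [refSimplex]
    rw [this, volume_pi, Measure.real, Measure.pi_univ]; simp
  | succ n ih =>
    rw [volume_real_refSimplex_succ]
    rw [volume_real_refSimplex_eq] at ih
    rw [Nat.factorial_succ, Nat.cast_mul, mul_inv, ← ih]
    push_cast
    field_simp

theorem integral_bary (i : Fin (n + 1)) :
    ∫ s in refSimplex n, bary s i = (((n + 1).factorial : ℝ))⁻¹ := by
  rw [integral_bary_eq, ← volume_real_refSimplex_succ, volume_real_refSimplex]

end

section

variable {n : ℕ}

/-! ### Simplices: volume, faces and normals -/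

theorem sum_bary_smul {E : Type*} [AddCommGroup E] [Module ℝ E] (s : Fin n → ℝ)
    (G : Fin (n + 1) → E) :
    ∑ k, bary s k • G k = G 0 + ∑ k : Fin n, s k • (G k.succ - G 0) := by
  simp only [bary, Fin.sum_univ_succ, Fin.cons_zero, Fin.cons_succ, smul_sub,
    Finset.sum_sub_distrib, ← Finset.sum_smul, sub_smul, one_smul]
  abel

theorem facePoint_eq (S : Fin (n + 2) → Pt n) (i : Fin (n + 2)) (s : Fin n → ℝ) :
    facePoint S i s = ∑ j, bary s j • faceVertex S i j := by
  rw [sum_bary_smul]; rfl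

theorem convexHull_range_eq_image {E : Type*} [AddCommGroup E] [Module ℝ E]
    (G : Fin (n + 1) → E) :
    convexHull ℝ (range G) = (fun s => ∑ k, bary s k • G k) '' refSimplex n := by
  apply Subset.antisymm
  · refine convexHull_min ?_ ?_
    · rintro _ ⟨k, rfl⟩
      refine ⟨Fin.tail (Pi.single k (1 : ℝ) : Fin (n + 1) → ℝ), ?_, ?_⟩
      · rw [mem_refSimplex_iff, bary_tail (by simp)]
        intro j
        by_cases h : j = k
        · subst h; simp
        · simp [h]
      · simp only [bary_tail (w := Pi.single k (1 : ℝ)) (by simp)]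
        rw [Finset.sum_eq_single k] <;> simp +contextual
    · have h := (convex_stdSimplex ℝ (Fin (n + 1))).linear_image (Fintype.linearCombination ℝ G)
      convert! h using 1
      ext x
      constructor
      · rintro ⟨s, hs, rfl⟩
        exact ⟨bary s, ⟨bary_nonneg hs, sum_bary s⟩, rfl⟩
      · rintro ⟨w, hw, rfl⟩
        refine ⟨Fin.tail w, ?_, ?_⟩
        · rw [mem_refSimplex_iff, bary_tail hw.2]; exact hw.1
        · simp only [bary_tail hw.2]; rfl
  · rintro _ ⟨s, hs, rfl⟩
    exact (convex_convexHull ℝ _).sum_mem (fun k _ => bary_nonneg hs k) (sum_bary s)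
      fun k _ => subset_convexHull ℝ _ ⟨k, rfl⟩

/-- The simplex is a translate of the image of the reference simplex under the matrix of its edges
from vertex 0. -/
theorem volume_real_convexHull_range (G : Fin (n + 2) → Pt n) :
    volume.real (convexHull ℝ (range G)) =
      |Matrix.det (Matrix.of fun a b : Fin (n + 1) => (G a.succ - G 0) b)| /
        (n + 1).factorial := by
  set A : Matrix (Fin (n + 1)) (Fin (n + 1)) ℝ := Matrix.of fun a b => (G a.succ - G 0) b with hA
  have hclosed : IsClosed (convexHull ℝ (range G)) :=
    ((finite_range G).isCompact_convexHull ℝ).isClosed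
  have hpre : (WithLp.toLp 2 : (Fin (n + 1) → ℝ) → Pt n) ⁻¹' convexHull ℝ (range G) =
      (fun x => WithLp.ofLp (G 0) + x) '' (Matrix.toLin' A.transpose '' refSimplex (n + 1)) := by
    rw [convexHull_range_eq_image, image_image]
    ext y
    have key : ∀ s : Fin (n + 1) → ℝ, WithLp.ofLp (∑ k, bary s k • G k) =
        WithLp.ofLp (G 0) + Matrix.toLin' A.transpose s := by
      intro s
      rw [sum_bary_smul]
      ext b
      simp [hA, Matrix.mulVec, dotProduct, mul_comm]
    constructor
    · rintro ⟨s, hs, h⟩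
      exact ⟨s, hs, (key s).symm.trans (congrArg WithLp.ofLp h)⟩
    · rintro ⟨s, hs, h⟩
      refine ⟨s, hs, ?_⟩
      exact (congrArg (WithLp.toLp 2) ((key s).trans h) :)
  rw [Measure.real, ← (PiLp.volume_preserving_toLp (Fin (n + 1))).measure_preimage
    hclosed.measurableSet.nullMeasurableSet, hpre, image_add_left,
    measure_preimage_add, Measure.addHaar_image_linearMap, LinearMap.det_toLin',
    Matrix.det_transpose, ENNReal.toReal_mul, ENNReal.toReal_ofReal (abs_nonneg _), div_eq_mul_inv]
  congr 1
  exact volume_real_refSimplex (n + 1)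

/-- Reorder the vertices so that the base vertex of face `i` comes first and the opposite vertex
second. The convex hull is unchanged and the edge matrix becomes that of `faceDet`. -/
theorem volume_real_convexHull_range_eq_faceDet (S : Fin (n + 2) → Pt n) (i : Fin (n + 2)) :
    volume.real (convexHull ℝ (range S)) =
      |faceDet S i (S i - faceVertex S i 0)| / (n + 1).factorial := by
  let G : Fin (n + 2) → Pt n :=
    Fin.cons (faceVertex S i 0) (Fin.cons (S i) fun j : Fin n => faceVertex S i j.succ)
  have hG : range G = range S := by
    apply Subset.antisymm
    · rintro _ ⟨k, rfl⟩
      refine Fin.cases ⟨_, rfl⟩ (fun k => ?_) k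
      exact Fin.cases ⟨_, rfl⟩ (fun k => ⟨_, rfl⟩) k
    · rintro _ ⟨k, rfl⟩
      rcases Fin.eq_self_or_eq_succAbove i k with rfl | ⟨j, rfl⟩
      · exact ⟨(0 : Fin (n + 1)).succ, rfl⟩
      · refine Fin.cases ⟨0, rfl⟩ (fun j => ?_) j
        exact ⟨j.succ.succ, rfl⟩
  rw [← hG, volume_real_convexHull_range]
  congr 2
  unfold faceDet
  congr 2
  ext a b
  refine Fin.cases rfl (fun a => rfl) a

/-- The vector representing the linear form `faceDet S i`. -/
def faceCross (S : Fin (n + 2) → Pt n) (i : Fin (n + 2)) : Pt n :=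
  WithLp.toLp 2 fun a => faceDet S i (EuclideanSpace.single a 1)

/-- Laplace expansion along the first row shows linearity in `v`. -/
theorem faceDet_eq_inner (S : Fin (n + 2) → Pt n) (i : Fin (n + 2)) (v : Pt n) :
    faceDet S i v = inner ℝ (faceCross S i) v := by
  have h : ∀ w : Pt n, faceDet S i w = ∑ a : Fin (n + 1), w a *
      ((-1) ^ (a : ℕ) * Matrix.det (Matrix.of fun (j : Fin n) (b : Fin n) =>
        (faceVertex S i j.succ - faceVertex S i 0) (a.succAbove b))) := by
    intro w
    unfold faceDet
    rw [Matrix.det_succ_row_zero]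
    refine Finset.sum_congr rfl fun a _ => ?_
    rw [mul_comm ((-1 : ℝ) ^ (a : ℕ)), mul_assoc]
    rfl
  rw [h, PiLp.inner_apply]
  refine Finset.sum_congr rfl fun a _ => ?_
  show _ = inner ℝ (faceDet S i (EuclideanSpace.single a 1)) (v a)
  rw [h]
  simp

theorem faceNormal_eq (S : Fin (n + 2) → Pt n) (i : Fin (n + 2)) :
    faceNormal S i = -Real.sign (faceDet S i (S i - faceVertex S i 0)) • faceCross S i := rfl

theorem faceDet_vertex_sub {S : Fin (n + 2) → Pt n} {i j : Fin (n + 2)} (h : j ≠ i) :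
    faceDet S i (S j - faceVertex S i 0) = 0 := by
  obtain ⟨k, rfl⟩ := Fin.exists_succAbove_eq h
  refine Fin.cases ?_ (fun k => ?_) k
  · show faceDet S i (faceVertex S i 0 - faceVertex S i 0) = 0
    rw [faceDet_eq_inner]; simp
  · unfold faceDet
    refine Matrix.det_zero_of_row_eq (i := 0) (j := k.succ) (Fin.succ_ne_zero k).symm ?_
    ext b
    simp [faceVertex]

/-- The linear part of a barycentric coordinate. -/
abbrev coordLin (b : AffineBasis (Fin (n + 2)) ℝ (Pt n)) (i : Fin (n + 2)) : Pt n →ₗ[ℝ] ℝ :=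
  (b.coord i).linear

theorem sum_coordLin (b : AffineBasis (Fin (n + 2)) ℝ (Pt n)) (v : Pt n) :
    ∑ i, coordLin b i v = 0 := by
  have h : ∀ i, coordLin b i v = b.coord i v - b.coord i 0 := fun i => by
    have := (b.coord i).linearMap_vsub v 0
    simpa using this
  simp_rw [h, Finset.sum_sub_distrib, b.sum_coord_apply_eq_one, sub_self]

theorem sum_coord_smul (b : AffineBasis (Fin (n + 2)) ℝ (Pt n)) (x : Pt n) :
    ∑ i, b.coord i x • b i = x := b.linear_combination_coord_eq_self x

theorem sum_coordLin_smul (b : AffineBasis (Fin (n + 2)) ℝ (Pt n)) (v : Pt n) :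
    ∑ i, coordLin b i v • b i = v := by
  have h : ∀ i, coordLin b i v = b.coord i v - b.coord i 0 := fun i => by
    have := (b.coord i).linearMap_vsub v 0
    simpa using this
  simp_rw [h, sub_smul, Finset.sum_sub_distrib, sum_coord_smul, sub_zero]

theorem sum_coordLin_smul_sub (b : AffineBasis (Fin (n + 2)) ℝ (Pt n)) (v y : Pt n) :
    ∑ i, coordLin b i v • (b i - y) = v := by
  simp_rw [smul_sub, Finset.sum_sub_distrib, sum_coordLin_smul, ← Finset.sum_smul, sum_coordLin,
    zero_smul, sub_zero]

/-- Expand `v` in the edges issuing from a vertex of the face. The determinant kills the edges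
within the face, so it is proportional to the differential of the `i`-th barycentric coordinate. -/
theorem faceDet_eq_coordLin_mul (b : AffineBasis (Fin (n + 2)) ℝ (Pt n)) (i : Fin (n + 2))
    (v : Pt n) :
    faceDet b i v = coordLin b i v * faceDet b i (b i - faceVertex b i 0) := by
  conv_lhs => rw [← sum_coordLin_smul_sub b v (faceVertex b i 0)]
  rw [faceDet_eq_inner, inner_sum, Finset.sum_eq_single i]
  · rw [inner_smul_right, ← faceDet_eq_inner]
  · intro j _ hj
    rw [inner_smul_right, ← faceDet_eq_inner, faceDet_vertex_sub hj, mul_zero]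
  · simp

/-- The outward normal of a face is a negative multiple of the gradient of the barycentric
coordinate of the opposite vertex. -/
theorem inner_faceNormal (b : AffineBasis (Fin (n + 2)) ℝ (Pt n)) (i : Fin (n + 2)) (v : Pt n) :
    inner ℝ (faceNormal b i) v =
      -((n + 1).factorial * volume.real (convexHull ℝ (range b)) * coordLin b i v) := by
  rw [faceNormal_eq, inner_smul_left, ← faceDet_eq_inner, faceDet_eq_coordLin_mul b i v,
    volume_real_convexHull_range_eq_faceDet b i, mul_div_cancel₀ _ (by positivity)]
  generalize faceDet b i (b i - faceVertex b i 0) = d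
  have hd : d.sign * d = |d| := by
    rcases lt_trichotomy d 0 with h | rfl | h
    · rw [Real.sign_of_neg h, abs_of_neg h]; ring
    · simp
    · rw [Real.sign_of_pos h, abs_of_pos h]; ring
  rw [← hd]
  simp; ring

/-- The area vectors of a closed surface add up to zero; here this is the constancy of the sum of
the barycentric coordinates. -/
theorem sum_faceNormal (b : AffineBasis (Fin (n + 2)) ℝ (Pt n)) :
    ∑ i, faceNormal b i = 0 := by
  refine ext_inner_right ℝ fun v => ?_
  rw [sum_inner, inner_zero_left]
  simp_rw [inner_faceNormal, Finset.sum_neg_distrib, ← Finset.mul_sum, sum_coordLin, mul_zero,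
    neg_zero]

theorem norm_faceNormal_le (S : Fin (n + 2) → Pt n) (i : Fin (n + 2)) {h : ℝ} (hh : 0 < h)
    (hS : ∀ j k, dist (S j) (S k) ≤ h) :
    ‖faceNormal S i‖ ≤ (n + 1) * (n + 1).factorial * h ^ n := by
  have hc : ∀ a, |faceDet S i (EuclideanSpace.single a 1)| ≤ (n + 1).factorial * h ^ n := by
    intro a
    -- Scaling the first row by `h` makes every entry of the matrix at most `h`. The Leibniz bound
    -- then gives `(n+1)! h^(n+1)`, and one factor `h` is divided out again.
    have h1 : |faceDet S i (h • EuclideanSpace.single a 1)| ≤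
        Nat.factorial (Fintype.card (Fin (n + 1))) • h ^ (Fintype.card (Fin (n + 1))) := by
      refine Matrix.det_le (A := Matrix.of fun a' b => _) (abv := AbsoluteValue.abs) ?_
      intro j k
      refine Fin.cases ?_ (fun j => ?_) j
      · by_cases hk : k = a
        · subst hk; simp [abs_of_pos hh]
        · simp [hk, hh.le]
      · simp only [Matrix.of_apply, Fin.cons_succ]
        refine (PiLp.norm_apply_le (faceVertex S i j.succ - faceVertex S i 0) k).trans ?_
        rw [← dist_eq_norm]
        exact hS _ _
    rw [faceDet_eq_inner, inner_smul_right, ← faceDet_eq_inner, abs_mul, abs_of_pos hh,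
      Fintype.card_fin, nsmul_eq_mul, pow_succ] at h1
    refine le_of_mul_le_mul_left ?_ hh
    linarith
  have h2 : ‖faceNormal S i‖ ≤ ‖faceCross S i‖ := by
    rw [faceNormal_eq, norm_smul, norm_neg]
    refine mul_le_of_le_one_left (norm_nonneg _) ?_
    rcases Real.sign_apply_eq (faceDet S i (S i - faceVertex S i 0)) with h | h | h <;> simp [h]
  refine h2.trans ?_
  have h3 : faceCross S i = ∑ a, EuclideanSpace.single a (faceCross S i a) := by
    ext b; simp
  rw [h3]
  refine (norm_sum_le _ _).trans ?_
  refine (Finset.sum_le_card_nsmul _ _ ((n + 1).factorial * h ^ n) fun a _ => ?_).trans ?_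
  · rw [PiLp.norm_single]; exact hc a
  · simp [mul_assoc]

end

section

variable {n : ℕ}

/-! ### Neighbouring simplices -/

theorem coord_sub (b : AffineBasis (Fin (n + 2)) ℝ (Pt n)) (i : Fin (n + 2)) (x y : Pt n) :
    coordLin b i (x - y) = b.coord i x - b.coord i y := by
  simpa using (b.coord i).linearMap_vsub x y

theorem coord_succAbove (b : AffineBasis (Fin (n + 2)) ℝ (Pt n)) (l : Fin (n + 2))
    (k : Fin (n + 1)) : b.coord l (b (l.succAbove k)) = 0 :=
  b.coord_apply_ne (Fin.succAbove_ne l k).symm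

section Neighbour

variable {b c : AffineBasis (Fin (n + 2)) ℝ (Pt n)} {l l' : Fin (n + 2)}
  {τ : Equiv.Perm (Fin (n + 1))}

/-- The coordinate of `b` opposite to the shared face vanishes at all vertices of `c` except `l'`,
so it is a multiple of the corresponding coordinate of `c`. -/
theorem coordLin_of_shared_face
    (hτ : ∀ k, c (l'.succAbove k) = b (l.succAbove (τ k))) (v : Pt n) :
    coordLin b l v = b.coord l (c l') * coordLin c l' v := by
  conv_lhs => rw [← sum_coordLin_smul_sub c v (c (l'.succAbove 0))]
  rw [map_sum, Fin.sum_univ_succAbove _ l']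
  simp only [map_smul, coord_sub, hτ, coord_succAbove, smul_eq_mul]
  simp [mul_comm]

theorem coord_of_shared_face
    (hτ : ∀ k, c (l'.succAbove k) = b (l.succAbove (τ k))) (x : Pt n) :
    b.coord l x = b.coord l (c l') * c.coord l' x := by
  have h := coordLin_of_shared_face hτ (x - c (l'.succAbove 0))
  rw [coord_sub, coord_sub, coord_succAbove, hτ, coord_succAbove] at h
  simpa using h

/-- The second simplex is the first with the vertex opposite to the face replaced. Over a common
base the volumes are as the heights, that is, as the absolute values of the coordinate. -/
theorem volume_real_of_shared_face
    (hτ : ∀ k, c (l'.succAbove k) = b (l.succAbove (τ k))) :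
    volume.real (convexHull ℝ (range c)) =
      |b.coord l (c l')| * volume.real (convexHull ℝ (range b)) := by
  let S : Fin (n + 2) → Pt n := Function.update b l (c l')
  have hface : ∀ k, S (l.succAbove k) = b (l.succAbove k) := fun k =>
    Function.update_of_ne (Fin.succAbove_ne l k) _ _
  have hl : S l = c l' := Function.update_self _ _ _
  have hrange : range c = range S := by
    apply Subset.antisymm
    · rintro _ ⟨k, rfl⟩
      rcases Fin.eq_self_or_eq_succAbove l' k with rfl | ⟨j, rfl⟩
      · exact ⟨l, hl⟩
      · exact ⟨_, (hface _).trans (hτ j).symm⟩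
    · rintro _ ⟨k, rfl⟩
      rcases Fin.eq_self_or_eq_succAbove l k with rfl | ⟨j, rfl⟩
      · exact ⟨l', hl.symm⟩
      · exact ⟨_, (hτ (τ.symm j)).trans (by simp [hface])⟩
  have hdet : ∀ v, faceDet S l v = faceDet b l v := by
    intro v; unfold faceDet faceVertex; simp only [hface]
  rw [hrange, volume_real_convexHull_range_eq_faceDet S l,
    volume_real_convexHull_range_eq_faceDet b l, hdet, hl,
    faceDet_eq_coordLin_mul b l, abs_mul, mul_div_assoc]
  congr 2
  · rw [faceVertex, hface, coord_sub, coord_succAbove, sub_zero]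

/-- The outward normals of two simplices on opposite sides of a common face are opposite. -/
theorem faceNormal_of_shared_face
    (hτ : ∀ k, c (l'.succAbove k) = b (l.succAbove (τ k))) (hneg : b.coord l (c l') < 0) :
    faceNormal c l' = -faceNormal b l := by
  refine ext_inner_right ℝ fun v => ?_
  rw [inner_neg_left, inner_faceNormal, inner_faceNormal, volume_real_of_shared_face hτ,
    coordLin_of_shared_face hτ, abs_of_neg hneg]
  ring

end Neighbour

/-! ### Incidence of cells in a conforming mesh. -/

namespace Mesh

variable {Ω : Set (Pt n)} (M : Mesh n Ω)

theorem isCompact_cell (K : M.Elem) : IsCompact (M.cell K) :=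
  (finite_range _).isCompact_convexHull ℝ

theorem mem_cell_iff {K : M.Elem} {x : Pt n} : x ∈ M.cell K ↔ ∀ i, 0 ≤ (M.simplex K).coord i x := by
  rw [cell, (M.simplex K).convexHull_eq_nonneg_coord]; rfl

theorem mem_interior_cell_iff {K : M.Elem} {x : Pt n} :
    x ∈ interior (M.cell K) ↔ ∀ i, 0 < (M.simplex K).coord i x := by
  rw [cell, (M.simplex K).interior_convexHull]; rfl

theorem vertex_mem_cell (K : M.Elem) (i : Fin (n + 2)) : M.simplex K i ∈ M.cell K :=
  subset_convexHull ℝ _ ⟨i, rfl⟩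

theorem cell_subset_closure (K : M.Elem) : M.cell K ⊆ closure Ω := by
  rw [← M.cover]; exact subset_iUnion (fun K => convexHull ℝ (range (M.simplex K))) K

theorem exists_mem_cell {x : Pt n} (hx : x ∈ closure Ω) : ∃ K, x ∈ M.cell K := by
  rw [← M.cover] at hx; exact mem_iUnion.1 hx

/-- By conformity the intersection is spanned by the common vertices. If vertex `j` were not common,
its coordinate would vanish on that span. -/
theorem mem_range_of_coord_pos {K L : M.Elem} {y : Pt n} (hK : y ∈ M.cell K) (hL : y ∈ M.cell L)
    {j : Fin (n + 2)} (hj : 0 < (M.simplex K).coord j y) : M.simplex K j ∈ range (M.simplex L) := by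
  by_contra hne
  have h : convexHull ℝ (range (M.simplex K) ∩ range (M.simplex L)) ⊆
      {x | (M.simplex K).coord j x = 0} := by
    refine convexHull_min ?_ ?_
    · rintro _ ⟨⟨i, rfl⟩, hi⟩
      refine (M.simplex K).coord_apply_ne ?_
      rintro rfl
      exact hne hi
    · intro x hx y hy s t _ _ hst
      change (M.simplex K).coord j (s • x + t • y) = 0
      rw [Convex.combo_affine_apply hst, hx, hy]
      simp
  exact hj.ne' (h (M.conforming _ _ ⟨hK, hL⟩))

theorem eq_of_range_subset {K L : M.Elem} (h : range (M.simplex K) ⊆ range (M.simplex L)) :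
    K = L := by
  refine M.ext_vertices _ _ (eq_of_subset_of_ncard_le h ?_ (finite_range _))
  rw [← image_univ, ← image_univ, ncard_image_of_injective _ (M.simplex K).ind.injective,
    ncard_image_of_injective _ (M.simplex L).ind.injective]

/-- At an interior point all barycentric coordinates are positive, so all vertices of `K` are
vertices of `L`. -/
theorem eq_of_mem_interior {K L : M.Elem} {y : Pt n} (hK : y ∈ interior (M.cell K))
    (hL : y ∈ M.cell L) : K = L := by
  refine M.eq_of_range_subset ?_
  rintro _ ⟨j, rfl⟩
  exact M.mem_range_of_coord_pos (interior_subset hK) hL (M.mem_interior_cell_iff.1 hK j)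

/-- The face of `K` opposite to its vertex `l` is the face of `L` opposite to its vertex `l'`, and
`τ` identifies the vertices; `K` and `L` lie on opposite sides. -/
structure IsNeighbour (K : M.Elem) (l : Fin (n + 2)) (L : M.Elem) (l' : Fin (n + 2))
    (τ : Equiv.Perm (Fin (n + 1))) : Prop where
  face : ∀ k, M.simplex L (l'.succAbove k) = M.simplex K (l.succAbove (τ k))
  neg : (M.simplex K).coord l (M.simplex L l') < 0

variable {M}

theorem IsNeighbour.symm {K L : M.Elem} {l l' : Fin (n + 2)} {τ : Equiv.Perm (Fin (n + 1))}
    (h : M.IsNeighbour K l L l' τ) : M.IsNeighbour L l' K l τ.symm := by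
  refine ⟨fun k => by rw [h.face]; simp, ?_⟩
  -- The two relative coordinates have product 1, hence the same sign.
  have h1 := coord_of_shared_face h.face (M.simplex K l)
  rw [(M.simplex K).coord_apply_eq] at h1
  by_contra hn
  nlinarith [h.neg]

/-- A face belongs to at most one further element. -/
theorem IsNeighbour.unique {K L₁ L₂ : M.Elem} {l l₁ l₂ : Fin (n + 2)}
    {τ₁ τ₂ : Equiv.Perm (Fin (n + 1))}
    (h₁ : M.IsNeighbour K l L₁ l₁ τ₁) (h₂ : M.IsNeighbour K l L₂ l₂ τ₂) : L₁ = L₂ ∧ l₁ = l₂ := by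
  -- `x` is the barycentre of the face, and `y δ` is pushed through the face away from vertex `l`.
  -- For small `δ` it lies in the interior of every neighbour across this face, so two neighbours
  -- coincide.
  let x : Pt n := ∑ k : Fin (n + 1), ((n + 1 : ℝ)⁻¹) • M.simplex K (l.succAbove k)
  let y : ℝ → Pt n := fun δ => AffineMap.lineMap x (M.simplex K l) (-δ)
  have hy : Tendsto y (𝓝[>] 0) (𝓝 x) := by
    have : ContinuousAt y 0 := by
      have : Continuous y := by fun_prop
      exact this.continuousAt
    have h0 : y 0 = x := by simp [y]
    rw [← h0]
    exact this.tendsto.mono_left nhdsWithin_le_nhds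
  have hxw : ∑ k : Fin (n + 1), (n + 1 : ℝ)⁻¹ = 1 := by
    simp; field_simp
  have hcoord : ∀ (b : AffineBasis (Fin (n + 2)) ℝ (Pt n)) i, b.coord i x =
      ∑ k : Fin (n + 1), (n + 1 : ℝ)⁻¹ * b.coord i (M.simplex K (l.succAbove k)) := by
    intro b i
    have e : x - M.simplex K l =
        ∑ k : Fin (n + 1), ((n + 1 : ℝ)⁻¹) • (M.simplex K (l.succAbove k) - M.simplex K l) := by
      simp only [smul_sub, Finset.sum_sub_distrib, ← Finset.sum_smul, hxw, one_smul, x]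
    have e2 := congrArg (coordLin b i) e
    simp only [map_sum, map_smul, coord_sub, smul_eq_mul, mul_sub, Finset.sum_sub_distrib,
      ← Finset.sum_mul, hxw, one_mul] at e2
    linarith
  have hl0 : (M.simplex K).coord l x = 0 := by
    rw [hcoord]; simp
  have key : ∀ {L : M.Elem} {m : Fin (n + 2)} {τ : Equiv.Perm (Fin (n + 1))},
      M.IsNeighbour K l L m τ → ∀ᶠ δ in 𝓝[>] (0 : ℝ), y δ ∈ interior (M.cell L) := by
    intro L m τ h
    simp only [mem_interior_cell_iff]
    refine eventually_all.2 fun i => ?_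
    rcases Fin.eq_self_or_eq_succAbove m i with rfl | ⟨j, rfl⟩
    · filter_upwards [self_mem_nhdsWithin] with δ hδ
      have h1 := coord_of_shared_face h.face (y δ)
      have h2 : (M.simplex K).coord l (y δ) = -δ := by
        simp only [y]
        rw [AffineMap.apply_lineMap, hl0, (M.simplex K).coord_apply_eq]
        simp [AffineMap.lineMap_apply]
      rw [h2] at h1
      have hδ' : (0 : ℝ) < δ := hδ
      by_contra hn
      nlinarith [h.neg]
    · have hpos : 0 < (M.simplex L).coord (m.succAbove j) x := by
        rw [hcoord]
        have hK : ∀ k, M.simplex K (l.succAbove k) = M.simplex L (m.succAbove (τ.symm k)) :=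
          fun k => by rw [h.face]; simp
        simp only [hK]
        refine Finset.sum_pos' (fun k _ => ?_) ⟨τ j, Finset.mem_univ _, ?_⟩
        · rw [AffineBasis.coord_apply]
          split_ifs <;> positivity
        · simp; positivity
      have hc : Continuous ((M.simplex L).coord (m.succAbove j)) :=
        AffineMap.continuous_of_finiteDimensional _
      exact ((hc.tendsto x).comp hy).eventually (lt_mem_nhds hpos)
  obtain ⟨δ, hδ₁, hδ₂⟩ := ((key h₁).and (key h₂)).exists
  obtain rfl := M.eq_of_mem_interior hδ₁ (interior_subset hδ₂)
  refine ⟨rfl, ?_⟩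
  -- Otherwise vertex `l₂` would belong to the shared face, where the coordinate is 0 and not
  -- negative.
  by_contra hne
  obtain ⟨j, hj⟩ := Fin.exists_succAbove_eq (Ne.symm hne)
  have h3 := h₂.neg
  rw [← hj, h₁.face, coord_succAbove] at h3
  exact lt_irrefl _ h3

/-- A face with a relatively interior point in `Ω` belongs to a further element. -/
theorem exists_neighbour_of_point (hΩ : IsOpen Ω) {K : M.Elem} {l : Fin (n + 2)} {x : Pt n}
    (hx : x ∈ Ω) (hl : (M.simplex K).coord l x = 0)
    (hpos : ∀ j, j ≠ l → 0 < (M.simplex K).coord j x) :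
    ∃ L l' τ, M.IsNeighbour K l L l' τ := by
  let y : ℝ → Pt n := fun δ => AffineMap.lineMap x (M.simplex K l) (-δ)
  have hy : Tendsto y (𝓝[>] 0) (𝓝 x) := by
    have : ContinuousAt y 0 := by
      have : Continuous y := by fun_prop
      exact this.continuousAt
    have h0 : y 0 = x := by simp [y]
    rw [← h0]
    exact this.tendsto.mono_left nhdsWithin_le_nhds
  -- By local finiteness a cell containing a point close to `x` contains `x` itself.
  have hsub := M.locallyFinite.eventually_subset (fun K => (M.isCompact_cell K).isClosed) x
  obtain ⟨δ, ⟨hδΩ, hδs⟩, hδ⟩ := ((hy.eventually ((hΩ.mem_nhds hx) : ∀ᶠ z in 𝓝 x, z ∈ Ω)).and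
    (hy.eventually hsub) |>.and self_mem_nhdsWithin).exists
  have hδ' : (0 : ℝ) < δ := hδ
  have hyl : (M.simplex K).coord l (y δ) = -δ := by
    simp only [y]
    rw [AffineMap.apply_lineMap, hl, (M.simplex K).coord_apply_eq]
    simp [AffineMap.lineMap_apply]
  obtain ⟨L, hyL⟩ := M.exists_mem_cell (subset_closure hδΩ)
  have hxL : x ∈ M.cell L := hδs hyL
  have hxK : x ∈ M.cell K := by
    rw [mem_cell_iff]
    intro i
    by_cases h : i = l
    · rw [h, hl]
    · exact (hpos i h).le
  -- All vertices of the face have positive weight at `x`, a point of both cells, so conformity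
  -- makes them vertices of `L`. One vertex `l'` of `L` is left over.
  have hmem : ∀ k, ∃ i, M.simplex L i = M.simplex K (l.succAbove k) := fun k =>
    M.mem_range_of_coord_pos hxK hxL (hpos _ (Fin.succAbove_ne l k))
  choose e he using hmem
  have hinj : Function.Injective e := by
    intro k k' h
    have := (he k).symm.trans ((congrArg _ h).trans (he k'))
    exact Fin.succAbove_right_injective ((M.simplex K).ind.injective this)
  obtain ⟨l', hl'⟩ : ∃ l', ∀ k, e k ≠ l' := by
    by_contra hc
    push Not at hc
    have hs : Function.Surjective e := hc
    have := Fintype.card_le_of_surjective e hs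
    simp at this
  choose e' he' using fun k => Fin.exists_succAbove_eq (hl' k)
  have hinj' : Function.Injective e' := by
    intro k k' h
    exact hinj (by rw [← he', ← he', h])
  let ρ : Equiv.Perm (Fin (n + 1)) := Equiv.ofBijective e' (Finite.injective_iff_bijective.1 hinj')
  have hface : ∀ k, M.simplex L (l'.succAbove k) = M.simplex K (l.succAbove (ρ.symm k)) := by
    intro k
    rw [← he (ρ.symm k), ← he']
    congr 2
    exact (ρ.apply_symm_apply k).symm
  refine ⟨L, l', ρ.symm, hface, ?_⟩
  -- At `y δ` the coordinate of `K` is `-δ`, and that of `L` is nonnegative because `y δ` is in `L`.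
  -- Their ratio, the coordinate of the vertex `l'`, is thus negative.
  have h1 := coord_of_shared_face hface (y δ)
  rw [hyl] at h1
  have h2 := M.mem_cell_iff.1 hyL l'
  by_contra hn
  nlinarith

/-- Every face through a vertex in `Ω` belongs to a further element. -/
theorem exists_neighbour (hΩ : IsOpen Ω) {K : M.Elem} {i l : Fin (n + 2)} (hil : i ≠ l)
    (hi : M.simplex K i ∈ Ω) : ∃ L l' τ, M.IsNeighbour K l L l' τ := by
  let x : Pt n := ∑ k : Fin (n + 1), ((n + 1 : ℝ)⁻¹) • M.simplex K (l.succAbove k)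
  have hxw : ∑ k : Fin (n + 1), (n + 1 : ℝ)⁻¹ = 1 := by
    simp; field_simp
  have hcoord : ∀ j, (M.simplex K).coord j x =
      ∑ k : Fin (n + 1), (n + 1 : ℝ)⁻¹ * (M.simplex K).coord j (M.simplex K (l.succAbove k)) := by
    intro j
    have e : x - M.simplex K l =
        ∑ k : Fin (n + 1), ((n + 1 : ℝ)⁻¹) • (M.simplex K (l.succAbove k) - M.simplex K l) := by
      simp only [smul_sub, Finset.sum_sub_distrib, ← Finset.sum_smul, hxw, one_smul, x]
    have e2 := congrArg (coordLin (M.simplex K) j) e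
    simp only [map_sum, map_smul, coord_sub, smul_eq_mul, mul_sub, Finset.sum_sub_distrib,
      ← Finset.sum_mul, hxw, one_mul] at e2
    linarith
  -- Moving slightly from the vertex towards the barycentre of the face gives a relatively interior
  -- point of the face that is still in Ω.
  let z : ℝ → Pt n := fun ε => AffineMap.lineMap (M.simplex K i) x ε
  have hz : Tendsto z (𝓝[>] 0) (𝓝 (M.simplex K i)) := by
    have : ContinuousAt z 0 := by
      have : Continuous z := by fun_prop
      exact this.continuousAt
    have h0 : z 0 = M.simplex K i := by simp [z]
    rw [← h0]
    exact this.tendsto.mono_left nhdsWithin_le_nhds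
  obtain ⟨ε, ⟨hεΩ, hε1⟩, hε0⟩ := ((hz.eventually (hΩ.mem_nhds hi)).and
    (nhdsWithin_le_nhds (gt_mem_nhds (zero_lt_one (α := ℝ)))) |>.and self_mem_nhdsWithin).exists
  have hε0' : (0 : ℝ) < ε := hε0
  have hε1' : ε < 1 := hε1
  have hzc : ∀ j, (M.simplex K).coord j (z ε) =
      (1 - ε) * (M.simplex K).coord j (M.simplex K i) + ε * (M.simplex K).coord j x := by
    intro j
    simp only [z]
    rw [AffineMap.apply_lineMap]
    simp [AffineMap.lineMap_apply]; ring
  refine exists_neighbour_of_point hΩ (x := z ε) hεΩ ?_ ?_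
  · rw [hzc, hcoord]
    simp [(M.simplex K).coord_apply_ne hil.symm]
  · intro j hj
    have h1 : 0 ≤ (M.simplex K).coord j (M.simplex K i) := by
      rw [AffineBasis.coord_apply]; split_ifs <;> norm_num
    have h2 : 0 < (M.simplex K).coord j x := by
      obtain ⟨k, rfl⟩ := Fin.exists_succAbove_eq hj
      rw [hcoord]
      refine Finset.sum_pos' (fun k _ => ?_) ⟨k, Finset.mem_univ _, ?_⟩
      · rw [AffineBasis.coord_apply]
        split_ifs <;> positivity
      · simp; positivity
    rw [hzc]
    have := mul_nonneg (sub_nonneg.2 hε1'.le) h1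
    have := mul_pos hε0' h2
    linarith

end Mesh

end

section

variable {n : ℕ}

/-! ### The Euler flux -/

/-- The Euler flux as a linear map of the direction. -/
def eulerFluxLin (eos : EquationOfState) (U : State n) : Pt n →ₗ[ℝ] Cons n where
  toFun := eulerFlux eos U
  map_add' ν ν' := by
    simp only [eulerFlux, inner_add_right, mul_add, add_smul, smul_add, Prod.mk_add_mk,
      Prod.mk.injEq, true_and, and_true]
    abel
  map_smul' a ν := by
    simp only [eulerFlux, inner_smul_right, Prod.smul_mk, smul_eq_mul, RingHom.id_apply,
      Prod.mk.injEq, smul_add, smul_smul]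
    refine ⟨by ring, ?_, by ring⟩
    congr 2 <;> ring

theorem eulerFluxLin_apply (eos : EquationOfState) (U : State n) (ν : Pt n) :
    eulerFluxLin eos U ν = eulerFlux eos U ν := rfl

theorem eulerFlux_neg (eos : EquationOfState) (U : State n) (ν : Pt n) :
    eulerFlux eos U (-ν) = -eulerFlux eos U ν := map_neg (eulerFluxLin eos U) ν

/-- A distance between the flux tensors of two states. -/
def fluxDist (eos : EquationOfState) (U c : State n) : ℝ :=
  ∑ a, ‖eulerFlux eos U (EuclideanSpace.single a 1) - eulerFlux eos c (EuclideanSpace.single a 1)‖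

theorem fluxDist_nonneg (eos : EquationOfState) (U c : State n) : 0 ≤ fluxDist eos U c :=
  Finset.sum_nonneg fun _ _ => norm_nonneg _

theorem sum_smul_single (ν : Pt n) : ∑ a, ν a • EuclideanSpace.single a (1 : ℝ) = ν := by
  ext b
  simp [Pi.single_apply]

theorem norm_eulerFlux_sub_le (eos : EquationOfState) (U c : State n) (ν : Pt n) :
    ‖eulerFlux eos U ν - eulerFlux eos c ν‖ ≤ fluxDist eos U c * ‖ν‖ := by
  have h : ∀ U : State n, eulerFlux eos U ν =
      ∑ a, ν a • eulerFlux eos U (EuclideanSpace.single a 1) := by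
    intro U
    conv_lhs => rw [← sum_smul_single ν]
    rw [← eulerFluxLin_apply, map_sum]
    simp only [map_smul, eulerFluxLin_apply]
  rw [h U, h c, ← Finset.sum_sub_distrib, fluxDist, Finset.sum_mul]
  refine (norm_sum_le _ _).trans (Finset.sum_le_sum fun a _ => ?_)
  rw [← smul_sub, norm_smul, mul_comm]
  gcongr
  exact PiLp.norm_apply_le ν a

theorem EquationOfState.convex_admissible (eos : EquationOfState) (n : ℕ) :
    Convex ℝ (eos.admissible n) := by
  intro U hU V hV a b ha hb hab
  exact eos.convex_dom hU hV ha hb hab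

theorem EquationOfState.density_ne_zero (eos : EquationOfState) {U : State n}
    (hU : U ∈ eos.admissible n) : U.1 ≠ 0 := (eos.density_pos _ hU).ne'

theorem continuousOn_velocity (eos : EquationOfState) :
    ContinuousOn (velocity : State n → Pt n) (eos.admissible n) :=
  ContinuousOn.smul (continuousOn_fst.inv₀ fun _ hU => eos.density_ne_zero hU)
    (by fun_prop)

theorem continuousOn_totalEnergy (eos : EquationOfState) :
    ContinuousOn (totalEnergy : State n → ℝ) (eos.admissible n) := by
  have := continuousOn_velocity (n := n) eos
  unfold totalEnergy
  fun_prop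

theorem continuousOn_conserved (eos : EquationOfState) :
    ContinuousOn (conserved : State n → Cons n) (eos.admissible n) :=
  continuousOn_fst.prodMk ((by fun_prop : ContinuousOn (fun U : State n => U.2.1) _).prodMk
    (continuousOn_totalEnergy eos))

theorem continuousOn_pressure (eos : EquationOfState) :
    ContinuousOn (fun U : State n => eos.p U.1 U.2.2) (eos.admissible n) :=
  eos.continuousOn_p.comp (f := fun U : State n => (U.1, U.2.2)) (by fun_prop) fun _ hU => hU

theorem continuousOn_eulerFlux (eos : EquationOfState) (ν : Pt n) :
    ContinuousOn (fun U : State n => eulerFlux eos U ν) (eos.admissible n) := by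
  have h1 := continuousOn_velocity (n := n) eos
  have h2 := continuousOn_totalEnergy (n := n) eos
  have h3 := continuousOn_pressure (n := n) eos
  unfold eulerFlux
  fun_prop

theorem continuousOn_fluxDist (eos : EquationOfState) (c : State n) :
    ContinuousOn (fun U : State n => fluxDist eos U c) (eos.admissible n) := by
  unfold fluxDist
  exact continuousOn_finsetSum _ fun a _ =>
    ((continuousOn_eulerFlux eos _).sub continuousOn_const).norm

namespace Mesh

variable {Ω : Set (Pt n)} (M : Mesh n Ω)

/-! ### Traces on faces -/

theorem coord_facePoint (b : AffineBasis (Fin (n + 2)) ℝ (Pt n)) (l : Fin (n + 2))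
    (i : Fin (n + 2)) (s : Fin n → ℝ) :
    b.coord i (facePoint b l s) = ∑ k, bary s k * b.coord i (b (l.succAbove k)) := by
  have e : facePoint b l s - b l = ∑ k, bary s k • (b (l.succAbove k) - b l) := by
    rw [facePoint_eq]
    simp only [smul_sub, Finset.sum_sub_distrib, ← Finset.sum_smul, sum_bary, one_smul, faceVertex]
  have e2 := congrArg (coordLin b i) e
  simp only [map_sum, map_smul, coord_sub, smul_eq_mul, mul_sub, Finset.sum_sub_distrib,
    ← Finset.sum_mul, sum_bary, one_mul] at e2
  linarith

theorem coord_facePoint_self (b : AffineBasis (Fin (n + 2)) ℝ (Pt n)) (l : Fin (n + 2))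
    (s : Fin n → ℝ) : b.coord l (facePoint b l s) = 0 := by
  rw [coord_facePoint]; simp

theorem coord_facePoint_succAbove (b : AffineBasis (Fin (n + 2)) ℝ (Pt n)) (l : Fin (n + 2))
    (m : Fin (n + 1)) (s : Fin n → ℝ) : b.coord (l.succAbove m) (facePoint b l s) = bary s m := by
  rw [coord_facePoint, Finset.sum_eq_single m]
  · simp
  · intro k _ hk
    rw [b.coord_apply_ne (fun h => hk (Fin.succAbove_right_injective h).symm), mul_zero]
  · simp

theorem facePoint_mem_cell (K : M.Elem) (l : Fin (n + 2)) {s : Fin n → ℝ}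
    (hs : s ∈ refSimplex n) : facePoint (M.simplex K) l s ∈ M.cell K := by
  rw [mem_cell_iff]
  intro i
  rcases Fin.eq_self_or_eq_succAbove l i with rfl | ⟨m, rfl⟩
  · rw [coord_facePoint_self]
  · rw [coord_facePoint_succAbove]; exact bary_nonneg hs m

theorem coord_mem_Icc {K : M.Elem} {x : Pt n} (hx : x ∈ M.cell K) (i : Fin (n + 2)) :
    0 ≤ (M.simplex K).coord i x ∧ (M.simplex K).coord i x ≤ 1 := by
  have h := M.mem_cell_iff.1 hx
  refine ⟨h i, ?_⟩
  rw [← (M.simplex K).sum_coord_apply_eq_one x]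
  exact Finset.single_le_sum (fun j _ => h j) (Finset.mem_univ i)

theorem interp_facePoint (V : M.NodalField) (K : M.Elem) (l : Fin (n + 2)) (s : Fin n → ℝ) :
    M.interp V K (facePoint (M.simplex K) l s) =
      ∑ k, bary s k • V (M.vertex K (l.succAbove k)) := by
  rw [interp, Fin.sum_univ_succAbove _ l, coord_facePoint_self, zero_smul, zero_add]
  simp only [coord_facePoint_succAbove]

theorem interp_mem_of_convex {A : Set (State n)} (hA : Convex ℝ A) {V : M.NodalField} {K : M.Elem}
    (hV : ∀ i, V (M.vertex K i) ∈ A) {x : Pt n} (hx : x ∈ M.cell K) : M.interp V K x ∈ A :=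
  hA.sum_mem (fun i _ => (M.coord_mem_Icc hx i).1) ((M.simplex K).sum_coord_apply_eq_one x)
    fun i _ => hV i

theorem continuous_interp (V : M.NodalField) (K : M.Elem) : Continuous (M.interp V K) := by
  unfold interp
  have : ∀ i, Continuous ((M.simplex K).coord i) :=
    fun i => AffineMap.continuous_of_finiteDimensional _
  fun_prop

theorem continuous_facePoint (S : Fin (n + 2) → Pt n) (l : Fin (n + 2)) :
    Continuous (facePoint S l) := by
  unfold facePoint; fun_prop

/-- The contribution of the face `l` to `weightedFlux`. -/
def faceFlux (eos : EquationOfState) (V : M.NodalField) (K : M.Elem) (i l : Fin (n + 2)) :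
    Cons n :=
  ∫ s in refSimplex n, (M.simplex K).coord i (facePoint (M.simplex K) l s) •
    eulerFlux eos (M.interp V K (facePoint (M.simplex K) l s)) (faceNormal (M.simplex K) l)

theorem weightedFlux_eq_sum (eos : EquationOfState) (V : M.NodalField) (K : M.Elem)
    (i : Fin (n + 2)) : M.weightedFlux eos V K i = ∑ l, M.faceFlux eos V K i l := rfl

theorem faceFlux_self (eos : EquationOfState) (V : M.NodalField) (K : M.Elem)
    (i : Fin (n + 2)) : M.faceFlux eos V K i i = 0 := by
  simp [faceFlux, coord_facePoint_self]

/-- Apart from the normal, only data at the vertices of the face enter, so the elements on its two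
sides integrate the same expression up to a permutation of the vertices. -/
theorem faceFlux_eq (eos : EquationOfState) (V : M.NodalField) (K : M.Elem) (l : Fin (n + 2))
    (m : Fin (n + 1)) : M.faceFlux eos V K (l.succAbove m) l =
      ∫ s in refSimplex n, bary s m • eulerFlux eos
        (∑ k, bary s k • V (M.vertex K (l.succAbove k))) (faceNormal (M.simplex K) l) := by
  simp only [faceFlux, coord_facePoint_succAbove, interp_facePoint]

variable {M}

/-- The fluxes through a face from the two sides cancel. -/
theorem IsNeighbour.faceFlux_add {K L : M.Elem} {l l' i i' : Fin (n + 2)}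
    {τ : Equiv.Perm (Fin (n + 1))} (h : M.IsNeighbour K l L l' τ) (hi : i ≠ l)
    (hii : M.simplex L i' = M.simplex K i) (eos : EquationOfState) (V : M.NodalField) :
    M.faceFlux eos V K i l + M.faceFlux eos V L i' l' = 0 := by
  obtain ⟨m, rfl⟩ := Fin.exists_succAbove_eq hi
  obtain rfl : i' = l'.succAbove (τ.symm m) := by
    refine (M.simplex L).ind.injective ?_
    rw [hii, h.face]; simp
  have hv : ∀ k, M.vertex L (l'.succAbove k) = M.vertex K (l.succAbove (τ k)) :=
    fun k => Subtype.ext (h.face k)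
  rw [faceFlux_eq, faceFlux_eq, faceNormal_of_shared_face h.face h.neg]
  simp only [hv, eulerFlux_neg, smul_neg, integral_neg]
  have := setIntegral_refSimplex_perm τ.symm fun w => w m • eulerFlux eos
        (∑ k, w k • V (M.vertex K (l.succAbove k))) (faceNormal (M.simplex K) l)
  rw [← this, add_neg_eq_zero]
  refine setIntegral_congr_fun (measurableSet_refSimplex n) fun s _ => ?_
  simp only [Function.comp]
  congr 2
  rw [← Equiv.sum_comp τ]
  simp

variable (M)

/-- The weighted fluxes of all elements around a vertex in `Ω` cancel. -/
theorem finsum_star_weightedFlux (hΩ : IsOpen Ω) (eos : EquationOfState) (V : M.NodalField)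
    {σ : M.Vertex} (hσ : σ.1 ∈ Ω) :
    ∑ᶠ q ∈ M.star σ, M.weightedFlux eos V q.1 q.2 = 0 := by
  classical
  rw [finsum_mem_eq_finite_toFinset_sum _ (M.star_finite σ)]
  set s := (M.star_finite σ).toFinset with hs
  have hmem : ∀ q ∈ s, M.simplex q.1 q.2 = σ.1 := by
    intro q hq
    rw [hs, Finite.mem_toFinset] at hq
    exact congrArg Subtype.val (hq : M.vertex q.1 q.2 = σ)
  -- A triple consists of an element, the local number of σ in it, and a face. `P` relates the two
  -- triples with the same σ on the two sides of a face; it is symmetric and single-valued and so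
  -- defines an involution.
  let P : (M.Elem × Fin (n + 2)) × Fin (n + 2) → (M.Elem × Fin (n + 2)) × Fin (n + 2) → Prop :=
    fun a b => (∃ τ, M.IsNeighbour a.1.1 a.2 b.1.1 b.2 τ) ∧
      M.simplex b.1.1 b.1.2 = M.simplex a.1.1 a.1.2
  have hsymm : ∀ a b, P a b → P b a := fun a b ⟨⟨τ, h⟩, h'⟩ => ⟨⟨_, h.symm⟩, h'.symm⟩
  have huniq : ∀ a b c, P a b → P a c → b = c := by
    rintro a ⟨⟨L, i⟩, l⟩ ⟨⟨L', i'⟩, l'⟩ ⟨⟨τ, h⟩, h'⟩ ⟨⟨τ₂, h₂⟩, h₂'⟩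
    obtain ⟨h3, h4⟩ := h.unique h₂
    simp only at h3 h4 h' h₂'
    subst h3 h4
    obtain rfl := (M.simplex L).ind.injective (h'.trans h₂'.symm)
    rfl
  -- The face opposite to σ is discarded: λ_σ vanishes there, and it may lie on the boundary and
  -- have no neighbour.
  let t := (s ×ˢ (Finset.univ : Finset (Fin (n + 2)))).filter fun a => a.1.2 ≠ a.2
  have hsum : ∑ q ∈ s, M.weightedFlux eos V q.1 q.2 =
      ∑ a ∈ t, M.faceFlux eos V a.1.1 a.1.2 a.2 := by
    simp only [weightedFlux_eq_sum]
    rw [← Finset.sum_product', Finset.sum_filter_of_ne]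
    rintro ⟨⟨K, i⟩, l⟩ _ hne (h : i = l)
    subst h
    exact hne (M.faceFlux_self eos V K i)
  rw [hsum]
  have hex : ∀ a ∈ t, ∃ b, P a b := by
    rintro ⟨⟨K, i⟩, l⟩ ha
    obtain ⟨ha, hil⟩ := Finset.mem_filter.1 ha
    change i ≠ l at hil
    have hq : M.simplex K i = σ.1 := hmem _ (Finset.mem_product.1 ha).1
    obtain ⟨L, l', τ, h⟩ := exists_neighbour hΩ hil (by rw [hq]; exact hσ)
    obtain ⟨m, rfl⟩ := Fin.exists_succAbove_eq hil
    exact ⟨⟨⟨L, l'.succAbove (τ.symm m)⟩, l'⟩, ⟨τ, h⟩, by simp [h.face]⟩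
  choose g hg using hex
  have hgmem : ∀ a ha, g a ha ∈ t := by
    intro a ha
    obtain ⟨ha', hil⟩ := Finset.mem_filter.1 ha
    obtain ⟨⟨τ, h⟩, h'⟩ := hg a ha
    have hq := hmem _ (Finset.mem_product.1 ha').1
    refine Finset.mem_filter.2 ⟨Finset.mem_product.2 ⟨?_, Finset.mem_univ _⟩, ?_⟩
    · rw [hs, Finite.mem_toFinset]
      exact Subtype.ext (h'.trans hq)
    -- If σ were the vertex of the neighbour opposite to the common face, its coordinate would be
    -- negative; as a vertex of that face it has coordinate 0.
    · intro he
      rw [he] at h'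
      obtain ⟨m, hm⟩ := Fin.exists_succAbove_eq hil
      have hneg := h.neg
      rw [h', ← hm, coord_succAbove] at hneg
      exact lt_irrefl _ hneg
  refine Finset.sum_involution g ?_ ?_ hgmem ?_
  · intro a ha
    obtain ⟨⟨τ, h⟩, h'⟩ := hg a ha
    exact h.faceFlux_add (Finset.mem_filter.1 ha).2 h' eos V
  · intro a ha _ he
    obtain ⟨⟨τ, h⟩, h'⟩ := hg a ha
    have hneg := h.neg
    rw [he, AffineBasis.coord_apply_eq] at hneg
    linarith
  · intro a ha
    exact huniq _ _ _ (hg (g a ha) (hgmem a ha)) (hsymm _ _ (hg a ha))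

/-! ### Evaluation and estimate of the weighted fluxes -/

theorem integral_coord_facePoint (b : AffineBasis (Fin (n + 2)) ℝ (Pt n)) (i l : Fin (n + 2)) :
    ∫ s in refSimplex n, b.coord i (facePoint b l s) =
      if l = i then 0 else (((n + 1).factorial : ℝ))⁻¹ := by
  rcases Fin.eq_self_or_eq_succAbove l i with rfl | ⟨m, rfl⟩
  · simp [coord_facePoint_self]
  · simp only [coord_facePoint_succAbove, integral_bary]
    rw [if_neg (Fin.succAbove_ne l m).symm]

/-- λ_i has the same integral over every parametrized face except the opposite one, where it
vanishes. As the normals sum to zero, minus the contribution of that face remains. -/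
theorem sum_integral_coord_smul_eulerFlux (eos : EquationOfState) (c : State n)
    (b : AffineBasis (Fin (n + 2)) ℝ (Pt n)) (i : Fin (n + 2)) :
    ∑ l, ∫ s in refSimplex n, b.coord i (facePoint b l s) • eulerFlux eos c (faceNormal b l) =
      -((((n + 1).factorial : ℝ))⁻¹ • eulerFlux eos c (faceNormal b i)) := by
  simp only [integral_smul_const, integral_coord_facePoint]
  have h : ∀ l, (if l = i then (0 : ℝ) else (((n + 1).factorial : ℝ))⁻¹) •
      eulerFlux eos c (faceNormal b l) = (((n + 1).factorial : ℝ))⁻¹ •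
        eulerFlux eos c (faceNormal b l) - if l = i then (((n + 1).factorial : ℝ))⁻¹ •
        eulerFlux eos c (faceNormal b i) else 0 := by
    intro l
    split_ifs with h
    · subst h; simp
    · simp
  simp only [h, Finset.sum_sub_distrib, ← Finset.smul_sum]
  have h0 : ∑ l, eulerFlux eos c (faceNormal b l) = 0 := by
    simp only [← eulerFluxLin_apply, ← map_sum, sum_faceNormal, map_zero]
  simp [h0]

theorem weightedFlux_const (eos : EquationOfState) {V : M.NodalField} {K : M.Elem} {c : State n}
    (hV : ∀ i, V (M.vertex K i) = c) (i : Fin (n + 2)) :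
    M.weightedFlux eos V K i =
      -((((n + 1).factorial : ℝ))⁻¹ • eulerFlux eos c (faceNormal (M.simplex K) i)) := by
  rw [← sum_integral_coord_smul_eulerFlux]
  have : ∀ x, M.interp V K x = c := fun x => by
    simp only [interp, hV, ← Finset.sum_smul, (M.simplex K).sum_coord_apply_eq_one, one_smul]
  simp only [weightedFlux, boundaryIntegral, this]

/-- Convexity of the domain of the equation of state keeps the interpolant admissible on the whole
face, where the flux is therefore continuous. -/
theorem integrable_faceFlux (eos : EquationOfState) {V : M.NodalField} {K : M.Elem}
    (hV : ∀ i, V (M.vertex K i) ∈ eos.admissible n) (i l : Fin (n + 2)) :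
    IntegrableOn (fun s => (M.simplex K).coord i (facePoint (M.simplex K) l s) •
      eulerFlux eos (M.interp V K (facePoint (M.simplex K) l s)) (faceNormal (M.simplex K) l))
      (refSimplex n) := by
  have hc : Continuous ((M.simplex K).coord i) := AffineMap.continuous_of_finiteDimensional _
  have hf := continuous_facePoint (M.simplex K) l
  refine integrableOn_refSimplex ((hc.comp hf).continuousOn.smul ?_)
  refine (continuousOn_eulerFlux eos _).comp
    ((M.continuous_interp V K).comp hf).continuousOn fun s hs => ?_
  exact M.interp_mem_of_convex (eos.convex_admissible n) hV (M.facePoint_mem_cell K l hs)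

theorem sum_weightedFlux (eos : EquationOfState) {V : M.NodalField} {K : M.Elem}
    (hV : ∀ i, V (M.vertex K i) ∈ eos.admissible n) :
    ∑ i, M.weightedFlux eos V K i = M.totalFlux eos V K := by
  simp only [weightedFlux_eq_sum]
  rw [Finset.sum_comm]
  refine Finset.sum_congr rfl fun l _ => ?_
  simp only [faceFlux]
  rw [← integral_finsetSum _ fun i _ => M.integrable_faceFlux eos hV i l]
  simp only [← Finset.sum_smul, (M.simplex K).sum_coord_apply_eq_one, one_smul]

theorem dist_vertex_le_diam (K : M.Elem) (i j : Fin (n + 2)) :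
    dist (M.simplex K i) (M.simplex K j) ≤ Metric.diam (M.cell K) :=
  Metric.dist_le_diam_of_mem (M.isCompact_cell K).isBounded (M.vertex_mem_cell K i)
    (M.vertex_mem_cell K j)

theorem diam_cell_pos (K : M.Elem) : 0 < Metric.diam (M.cell K) := by
  refine lt_of_lt_of_le (dist_pos.2 ?_) (M.dist_vertex_le_diam K 0 (Fin.last _))
  intro h
  exact (Fin.last_pos (n := n)).ne ((M.simplex K).ind.injective h)

theorem norm_normal_le (K : M.Elem) (i : Fin (n + 2)) :
    ‖faceNormal (M.simplex K) i‖ ≤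
      (n + 1) * (n + 1).factorial * Metric.diam (M.cell K) ^ n :=
  norm_faceNormal_le _ i (M.diam_cell_pos K) (M.dist_vertex_le_diam K)

/-- The weighted flux of almost constant data. -/
theorem norm_weightedFlux_add_le (eos : EquationOfState) {V : M.NodalField} {K : M.Elem}
    (hV : ∀ i, V (M.vertex K i) ∈ eos.admissible n) (c : State n) {η : ℝ}
    (hη : ∀ x ∈ M.cell K, fluxDist eos (M.interp V K x) c ≤ η) (i : Fin (n + 2)) :
    ‖M.weightedFlux eos V K i +
        (((n + 1).factorial : ℝ))⁻¹ • eulerFlux eos c (faceNormal (M.simplex K) i)‖ ≤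
      (n + 2) * ((n + 1) * (n + 1).factorial) * Metric.diam (M.cell K) ^ n * η := by
  rw [← sub_neg_eq_add, ← sum_integral_coord_smul_eulerFlux, weightedFlux_eq_sum,
    ← Finset.sum_sub_distrib]
  have hη0 : 0 ≤ η := (fluxDist_nonneg _ _ _).trans (hη _ (M.vertex_mem_cell K 0))
  -- There are `n + 2` faces; on each λ_i is at most 1, the normal has its standard bound, and the
  -- reference simplex has volume at most 1.
  refine (norm_sum_le _ _).trans ((Finset.sum_le_card_nsmul _ _
    (((n + 1) * (n + 1).factorial) * Metric.diam (M.cell K) ^ n * η) fun l _ => ?_).trans ?_)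
  · have hc : Continuous ((M.simplex K).coord i) := AffineMap.continuous_of_finiteDimensional _
    have hf := continuous_facePoint (M.simplex K) l
    have hint : IntegrableOn (fun s => (M.simplex K).coord i (facePoint (M.simplex K) l s) •
        eulerFlux eos c (faceNormal (M.simplex K) l)) (refSimplex n) volume :=
      integrableOn_refSimplex ((hc.comp hf).continuousOn.smul continuousOn_const)
    rw [faceFlux, ← integral_sub (M.integrable_faceFlux eos hV i l)
      hint]
    have hb := norm_setIntegral_le_of_norm_le_const (μ := volume) (s := refSimplex n)
      (f := fun s => (M.simplex K).coord i (facePoint (M.simplex K) l s) •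
        eulerFlux eos (M.interp V K (facePoint (M.simplex K) l s)) (faceNormal (M.simplex K) l) -
        (M.simplex K).coord i (facePoint (M.simplex K) l s) •
        eulerFlux eos c (faceNormal (M.simplex K) l))
      (C := ((n + 1) * (n + 1).factorial) * Metric.diam (M.cell K) ^ n * η)
      (isCompact_refSimplex n).measure_lt_top (fun s hs => ?_)
    · refine hb.trans (mul_le_of_le_one_right (by positivity) ?_)
      rw [volume_real_refSimplex]
      exact inv_le_one_of_one_le₀ (by exact_mod_cast Nat.one_le_iff_ne_zero.2 n.factorial_ne_zero)
    · have hx := M.facePoint_mem_cell K l hs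
      rw [← smul_sub, norm_smul, Real.norm_of_nonneg (M.coord_mem_Icc hx i).1]
      refine (mul_le_of_le_one_left (norm_nonneg _) (M.coord_mem_Icc hx i).2).trans ?_
      refine (norm_eulerFlux_sub_le eos _ c _).trans ?_
      rw [mul_comm]
      exact mul_le_mul (M.norm_normal_le K l) (hη _ hx) (fluxDist_nonneg _ _ _) (by positivity)
  · simp [mul_assoc]

end Mesh

end

section

variable {n : ℕ}

/-! ### Conservation of total energy and the flux form -/

/-- Substitute m = ρu. In (u' + u)/2 · (ρ'u' - ρu) the mixed terms are (u'·u)(ρ' - ρ)/2, and the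
last term removes exactly these, leaving the difference of the kinetic energies. -/
theorem totalEnergy_sub_totalEnergy {U U' : State n} (hU : U.1 ≠ 0) (hU' : U'.1 ≠ 0) :
    totalEnergy U' - totalEnergy U = (U'.2.2 - U.2.2)
      + inner ℝ ((1 / 2 : ℝ) • (velocity U' + velocity U)) (U'.2.1 - U.2.1)
      - 1 / 2 * inner ℝ (velocity U') (velocity U) * (U'.1 - U.1) := by
  have h : ∀ W : State n, W.1 ≠ 0 → W.2.1 = W.1 • velocity W := by
    intro W hW
    rw [velocity, smul_smul, mul_inv_cancel₀ hW, one_smul]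
  rw [h U hU, h U' hU']
  simp only [totalEnergy, inner_smul_left, inner_smul_right, inner_add_left, inner_sub_right,
    real_inner_self_eq_norm_sq, real_inner_comm (velocity U') (velocity U)]
  simp
  ring

namespace Residuals

variable {Ω : Set (Pt n)} {M : Mesh n Ω} {R : Residuals M} {eos : EquationOfState}

theorem sum_totalEnergy (henergy : R.InternalEnergyRelation eos) {V V' : M.NodalField}
    (hV : M.Admissible eos V) (hV' : M.Admissible eos V') (K : M.Elem) :
    ∑ i, R.totalEnergy V V' K i = (M.totalFlux eos V K).2.2 := by
  simp only [totalEnergy, Finset.sum_sub_distrib, Finset.sum_add_distrib, henergy V V' hV hV' K,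
    mul_assoc, ← Finset.mul_sum]
  ring

theorem sum_conserved (hcons : R.MassMomentumConservation eos)
    (henergy : R.InternalEnergyRelation eos) {V V' : M.NodalField}
    (hV : M.Admissible eos V) (hV' : M.Admissible eos V') (K : M.Elem) :
    ∑ i, R.conserved V V' K i = M.totalFlux eos V K := by
  have h := hcons V hV K
  refine Prod.ext ?_ (Prod.ext ?_ ?_)
  · simp only [Prod.fst_sum, conserved, h.1]
  · simp only [Prod.snd_sum, Prod.fst_sum, conserved, h.2]
  · simp only [Prod.snd_sum, conserved, sum_totalEnergy henergy hV hV' K]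

/-- The update of the internal energy implies the update of the total energy. -/
theorem conserved_step {dt : ℝ} {V V' : M.NodalField}
    (hV : M.Admissible eos V) (hV' : M.Admissible eos V') {σ : M.Vertex}
    (h : M.dualVolume σ * ((V' σ).1 - (V σ).1)
        + dt * ∑ᶠ q ∈ M.star σ, R.mass V q.1 q.2 = 0 ∧
      M.dualVolume σ • ((V' σ).2.1 - (V σ).2.1)
        + dt • ∑ᶠ q ∈ M.star σ, R.momentum V q.1 q.2 = 0 ∧
      M.dualVolume σ * ((V' σ).2.2 - (V σ).2.2)
        + dt * ∑ᶠ q ∈ M.star σ, R.energy V V' q.1 q.2 = 0) :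
    M.dualVolume σ • (EulerRD.conserved (V' σ) - EulerRD.conserved (V σ))
      + dt • ∑ᶠ q ∈ M.star σ, R.conserved V V' q.1 q.2 = 0 := by
  classical
  simp only [finsum_mem_eq_finite_toFinset_sum _ (M.star_finite σ)] at h ⊢
  obtain ⟨h1, h2, h3⟩ := h
  have hstar : ∀ q ∈ (M.star_finite σ).toFinset, M.vertex q.1 q.2 = σ := by
    intro q hq
    rw [Finite.mem_toFinset] at hq
    exact hq
  refine Prod.ext ?_ (Prod.ext ?_ ?_)
  · simpa [Prod.fst_sum, conserved, EulerRD.conserved] using h1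
  · simpa [Prod.fst_sum, Prod.snd_sum, conserved, EulerRD.conserved] using h2
  -- The velocities are those at σ for every element of the star, so they come out of the sum.
  · have h4 : ∑ q ∈ (M.star_finite σ).toFinset, R.totalEnergy V V' q.1 q.2 =
        ∑ q ∈ (M.star_finite σ).toFinset, R.energy V V' q.1 q.2
        + inner ℝ ((1 / 2 : ℝ) • (velocity (V' σ) + velocity (V σ)))
          (∑ q ∈ (M.star_finite σ).toFinset, R.momentum V q.1 q.2)
        - 1 / 2 * inner ℝ (velocity (V' σ)) (velocity (V σ)) *
          ∑ q ∈ (M.star_finite σ).toFinset, R.mass V q.1 q.2 := by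
      rw [inner_sum, Finset.mul_sum, ← Finset.sum_add_distrib, ← Finset.sum_sub_distrib]
      refine Finset.sum_congr rfl fun q hq => ?_
      rw [totalEnergy, hstar q hq]
    have h5 : (M.dualVolume σ • (EulerRD.conserved (V' σ) - EulerRD.conserved (V σ))
        + dt • ∑ q ∈ (M.star_finite σ).toFinset, R.conserved V V' q.1 q.2).2.2 =
        M.dualVolume σ * (EulerRD.totalEnergy (V' σ) - EulerRD.totalEnergy (V σ))
        + dt * ∑ q ∈ (M.star_finite σ).toFinset, R.totalEnergy V V' q.1 q.2 := by
      simp [Prod.snd_sum, conserved, EulerRD.conserved]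
    rw [h5, h4, totalEnergy_sub_totalEnergy (eos.density_ne_zero (hV σ))
      (eos.density_ne_zero (hV' σ))]
    have h6 := congrArg (fun w => inner ℝ ((1 / 2 : ℝ) • (velocity (V' σ) + velocity (V σ))) w) h2
    simp only [inner_add_right, inner_smul_right, inner_zero_right] at h6
    show _ = (0 : ℝ)
    linear_combination h3 + h6 - 1 / 2 * inner ℝ (velocity (V' σ)) (velocity (V σ)) * h1

/-- The residual without its consistent boundary part. -/
def interior (R : Residuals M) (eos : EquationOfState) (V V' : M.NodalField) (K : M.Elem)
    (i : Fin (n + 2)) : Cons n :=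
  R.conserved V V' K i - M.weightedFlux eos V K i

theorem sum_interior (hcons : R.MassMomentumConservation eos)
    (henergy : R.InternalEnergyRelation eos) {V V' : M.NodalField}
    (hV : M.Admissible eos V) (hV' : M.Admissible eos V') (K : M.Elem) :
    ∑ i, R.interior eos V V' K i = 0 := by
  simp only [interior, Finset.sum_sub_distrib, sum_conserved hcons henergy hV hV' K,
    M.sum_weightedFlux eos fun i => hV _, sub_self]

theorem interior_step (hΩ : IsOpen Ω) {dt : ℝ} {V V' : M.NodalField} {σ : M.Vertex}
    (hσ : σ.1 ∈ Ω)
    (h : M.dualVolume σ • (EulerRD.conserved (V' σ) - EulerRD.conserved (V σ))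
      + dt • ∑ᶠ q ∈ M.star σ, R.conserved V V' q.1 q.2 = 0) :
    M.dualVolume σ • (EulerRD.conserved (V' σ) - EulerRD.conserved (V σ))
      + dt • ∑ᶠ q ∈ M.star σ, R.interior eos V V' q.1 q.2 = 0 := by
  have h0 := M.finsum_star_weightedFlux hΩ eos V hσ
  simp only [finsum_mem_eq_finite_toFinset_sum _ (M.star_finite σ)] at h h0 ⊢
  simpa only [interior, Finset.sum_sub_distrib, h0, sub_zero] using h

/-- A zero-sum family on the complete graph of the vertices is the divergence of its scaled
differences. For constant data the residual vanishes and the weighted flux is that of the opposite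
face, so the differences give f(c) on the difference of two face normals. -/
theorem hasFluxForm (hΩ : IsOpen Ω) (hcons : R.MassMomentumConservation eos)
    (henergy : R.InternalEnergyRelation eos) {dt : ℝ} {V V' : M.NodalField}
    (hV : M.Admissible eos V) (hV' : M.Admissible eos V')
    (hconst : ∀ K c, (∀ i, V (M.vertex K i) = c) → ∀ i, R.conserved V V' K i = 0)
    (hstep : ∀ σ : M.Vertex, σ.1 ∈ Ω →
      M.dualVolume σ • (EulerRD.conserved (V' σ) - EulerRD.conserved (V σ))
        + dt • ∑ᶠ q ∈ M.star σ, R.conserved V V' q.1 q.2 = 0) :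
    R.HasFluxForm eos dt V V' := by
  have hsum : ∀ K i, ∑ j, ((n + 2 : ℝ)⁻¹) • (R.interior eos V V' K i - R.interior eos V V' K j) =
      R.interior eos V V' K i := by
    intro K i
    rw [← Finset.smul_sum, Finset.sum_sub_distrib, sum_interior hcons henergy hV hV', sub_zero]
    simp only [Finset.sum_const, Finset.card_univ, Fintype.card_fin, ← Nat.cast_smul_eq_nsmul ℝ,
      smul_smul]
    push_cast
    rw [inv_mul_cancel₀ (by positivity), one_smul]
  refine ⟨fun K i j => ((n + 2 : ℝ)⁻¹) • (R.interior eos V V' K i - R.interior eos V V' K j),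
    fun K i j => ?_, fun K i => ?_, fun K c hc i j => ?_, fun σ hσ => ?_⟩
  · rw [← smul_neg, neg_sub]
  · rw [hsum, interior, sub_add_cancel]
  · simp only [interior, hconst K c hc, M.weightedFlux_const eos hc, zero_sub, neg_neg,
      Mesh.dualNormal]
    rw [← smul_sub, smul_smul, ← eulerFluxLin_apply, ← eulerFluxLin_apply, ← map_sub, ← map_smul,
      eulerFluxLin_apply]
    congr 2
    -- The factor 1/(n+2) of the splitting times the vertex weight 1/(n+1)! is the 1/(n+2)! of
    -- `dualNormal`.
    rw [Nat.factorial_succ (n + 1), Nat.cast_mul, mul_inv]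
    push_cast
    ring
  · simp only [hsum]
    exact interior_step hΩ hσ (hstep σ hσ)

end Residuals

/-! ### Bounds for the residuals of the conserved variables -/

/-- The variation of a nodal field on an element. -/
def Mesh.variation {Ω : Set (Pt n)} (M : Mesh n Ω) (V : M.NodalField) (K : M.Elem) : ℝ :=
  ∑ a, ∑ b, ‖V (M.vertex K a) - V (M.vertex K b)‖

theorem Mesh.variation_nonneg {Ω : Set (Pt n)} (M : Mesh n Ω) (V : M.NodalField) (K : M.Elem) :
    0 ≤ M.variation V K :=
  Finset.sum_nonneg fun _ _ => Finset.sum_nonneg fun _ _ => norm_nonneg _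

/-- With velocities bounded by B, the three terms of Φ_E contribute the factors 1, B and B². -/
theorem ResidualBound.conserved {Ω : Set (Pt n)} {eos : EquationOfState} {M : ℕ → Mesh n Ω}
    {R : ∀ k, Residuals (M k)} (h : ResidualBound eos R) {Q : Set (State n)} (hQ : IsCompact Q)
    (hQa : Q ⊆ eos.admissible n) :
    ∃ C : ℝ, 0 ≤ C ∧ ∀ k, ∀ V V' : (M k).NodalField, (∀ σ, V σ ∈ Q) → (∀ σ, V' σ ∈ Q) → ∀ K i,
      ‖(R k).conserved V V' K i‖ ≤
        C * Metric.diam ((M k).cell K) ^ n * (M k).variation V K := by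
  obtain ⟨C, hC⟩ := h Q hQ hQa
  obtain ⟨B, hB⟩ := hQ.exists_bound_of_continuousOn ((continuousOn_velocity eos).mono hQa)
  refine ⟨|C| * (1 + |B| + |B| ^ 2), by positivity, fun k V V' hV hV' K i => ?_⟩
  obtain ⟨h1, h2, h3⟩ := hC k V V' hV hV' K i
  change |_| ≤ C * _ * (M k).variation V K at h1
  change ‖_‖ ≤ C * _ * (M k).variation V K at h2
  change |_| ≤ C * _ * (M k).variation V K at h3
  have hx : 0 ≤ Metric.diam ((M k).cell K) ^ n * (M k).variation V K :=
    mul_nonneg (by positivity) ((M k).variation_nonneg V K)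
  rw [mul_assoc] at h1 h2 h3 ⊢
  set x := Metric.diam ((M k).cell K) ^ n * (M k).variation V K
  have hCx : C * x ≤ |C| * x := mul_le_mul_of_nonneg_right (le_abs_self C) hx
  have hy : 0 ≤ |C| * x := by positivity
  have hbig : |C| * x ≤ |C| * (1 + |B| + |B| ^ 2) * x := by
    have : 0 ≤ |C| * x * (|B| + |B| ^ 2) := by positivity
    linarith
  have hu := (hB _ (hV ((M k).vertex K i))).trans (le_abs_self B)
  have hu' := (hB _ (hV' ((M k).vertex K i))).trans (le_abs_self B)
  set u := velocity (V ((M k).vertex K i))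
  set u' := velocity (V' ((M k).vertex K i))
  refine norm_prod_le_iff.2 ⟨?_, norm_prod_le_iff.2 ⟨?_, ?_⟩⟩
  · exact h1.trans (hCx.trans hbig)
  · exact h2.trans (hCx.trans hbig)
  · have e1 : |inner ℝ ((1 / 2 : ℝ) • (u' + u)) ((R k).momentum V K i)| ≤ |B| * (|C| * x) := by
      refine (abs_real_inner_le_norm _ _).trans
        (mul_le_mul ?_ (h2.trans hCx) (norm_nonneg _) (abs_nonneg _))
      rw [norm_smul]
      have := norm_add_le u' u
      norm_num
      linarith
    have e2 : |1 / 2 * inner ℝ u' u * (R k).mass V K i| ≤ |B| ^ 2 * (|C| * x) := by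
      rw [abs_mul]
      refine mul_le_mul ?_ (h1.trans hCx) (abs_nonneg _) (by positivity)
      rw [abs_mul, sq]
      have := (abs_real_inner_le_norm u' u).trans
        (mul_le_mul hu' hu (norm_nonneg _) (abs_nonneg _))
      have h12 : |(1 / 2 : ℝ)| = 1 / 2 := by norm_num
      rw [h12]
      have h0 := abs_nonneg (inner ℝ u' u : ℝ)
      linarith
    show |(R k).energy V V' K i + inner ℝ ((1 / 2 : ℝ) • (u' + u)) ((R k).momentum V K i)
      - 1 / 2 * inner ℝ u' u * (R k).mass V K i| ≤ _
    refine (abs_sub _ _).trans ?_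
    have := abs_add_le ((R k).energy V V' K i)
      (inner ℝ ((1 / 2 : ℝ) • (u' + u)) ((R k).momentum V K i))
    have h3' := h3.trans hCx
    calc _ ≤ |C| * x + |B| * (|C| * x) + |B| ^ 2 * (|C| * x) := by linarith
      _ = |C| * (1 + |B| + |B| ^ 2) * x := by ring

end

section

variable {n : ℕ}

namespace Mesh

variable {Ω : Set (Pt n)} (M : Mesh n Ω)

/-! ### Measure theory on a mesh -/

theorem countable_elem : Countable M.Elem :=
  countable_univ_iff.1 (M.locallyFinite.countable_univ fun K => ⟨_, M.vertex_mem_cell K 0⟩)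

theorem measurableSet_cell (K : M.Elem) : MeasurableSet (M.cell K) :=
  (M.isCompact_cell K).isClosed.measurableSet

theorem convex_cell (K : M.Elem) : Convex ℝ (M.cell K) := convex_convexHull ℝ _

theorem interior_ae_eq_cell (K : M.Elem) : interior (M.cell K) =ᵐ[volume] M.cell K :=
  interior_ae_eq_of_null_frontier ((M.convex_cell K).addHaar_frontier volume)

theorem ae_mem_interior_cell : ∀ᵐ x : Pt n, x ∈ closure Ω → ∃ K, x ∈ interior (M.cell K) := by
  have := M.countable_elem
  have h : ∀ᵐ x : Pt n, ∀ K, x ∉ frontier (M.cell K) :=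
    ae_all_iff.2 fun K => measure_eq_zero_iff_ae_notMem.1
      ((M.convex_cell K).addHaar_frontier volume)
  filter_upwards [h] with x hx hxΩ
  obtain ⟨K, hK⟩ := M.exists_mem_cell hxΩ
  refine ⟨K, ?_⟩
  by_contra hc
  exact hx K ⟨subset_closure hK, hc⟩

theorem pairwise_disjoint_interior :
    Pairwise (Function.onFun Disjoint fun K : M.Elem => interior (M.cell K)) := by
  intro K L hKL
  refine Set.disjoint_left.2 fun x hK hL => hKL ?_
  exact M.eq_of_mem_interior hK (interior_subset hL)

theorem continuousOn_recon (V : M.NodalField) : ContinuousOn (M.recon V) (closure Ω) := by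
  rw [← M.cover]
  refine M.locallyFinite.continuousOn_iUnion (fun K => (M.isCompact_cell K).isClosed) fun K => ?_
  exact (M.continuous_interp V K).continuousOn.congr fun x hx => M.recon_eq_interp V K hx

theorem measurable_recon (V : M.NodalField) : Measurable (M.recon V) := by
  classical
  have h : M.recon V = (closure Ω).piecewise (M.recon V) 0 := by
    ext1 x
    by_cases hx : x ∈ closure Ω
    · rw [piecewise_eq_of_mem _ _ _ hx]
    · rw [piecewise_eq_of_notMem _ _ _ hx]
      have : ¬ ∃ K, x ∈ M.cell K := fun ⟨K, hK⟩ => hx (M.cell_subset_closure K hK)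
      simp [recon, this]
  rw [h]
  exact (M.continuousOn_recon V).measurable_piecewise continuousOn_const
    isClosed_closure.measurableSet

theorem finite_cells_inter (M : Mesh n Ω) {C : Set (Pt n)} (hC : IsCompact C) :
    {K : M.Elem | (M.cell K ∩ C).Nonempty}.Finite :=
  M.locallyFinite.finite_nonempty_inter_compact hC

/-! ### Nodal values are controlled by cell averages -/

/-- The homothety of ratio `1/2` towards a vertex expresses the nodal value by values of the
interpolant. -/
theorem enorm_vertex_sub_le (V : M.NodalField) (K : M.Elem) (i : Fin (n + 2)) (c : State n)
    (x : Pt n) :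
    ‖V (M.vertex K i) - c‖ₑ ≤
      2 * ‖M.interp V K ((1 / 2 : ℝ) • x + (1 / 2 : ℝ) • M.simplex K i) - c‖ₑ
        + ‖M.interp V K x - c‖ₑ := by
  have h : V (M.vertex K i) - c =
      (2 : ℝ) • (M.interp V K ((1 / 2 : ℝ) • x + (1 / 2 : ℝ) • M.simplex K i) - c)
        - (M.interp V K x - c) := by
    rw [M.interp_combo V K _ _ _ _ (by norm_num), M.interp_vertex]
    module
  rw [h]
  refine (enorm_sub_le).trans ?_
  rw [enorm_smul]
  gcongr
  rw [Real.enorm_eq_ofReal (by norm_num)]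
  norm_num

/-- The homothety maps the convex cell into itself and scales volume by 2^(-d), d = n + 1. -/
theorem lintegral_cell_homothety_le (K : M.Elem) (i : Fin (n + 2)) {f : Pt n → ℝ≥0∞}
    (hf : Measurable f) :
    ∫⁻ x in M.cell K, f ((1 / 2 : ℝ) • x + (1 / 2 : ℝ) • M.simplex K i) ≤
      2 ^ (n + 1) * ∫⁻ x in M.cell K, f x := by
  set y : Pt n → Pt n := fun x => (1 / 2 : ℝ) • x + (1 / 2 : ℝ) • M.simplex K i with hy
  have hym : Measurable y := by fun_prop
  have hmap : Measure.map y volume = (2 : ℝ≥0∞) ^ (n + 1) • (volume : Measure (Pt n)) := by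
    have h1 := Measure.map_addHaar_smul (volume : Measure (Pt n)) (r := 1 / 2) (by norm_num)
    have h2 := (measurePreserving_add_right (volume : Measure (Pt n))
      ((1 / 2 : ℝ) • M.simplex K i))
    have h3 : y = (fun x => x + (1 / 2 : ℝ) • M.simplex K i) ∘ fun x => (1 / 2 : ℝ) • x := rfl
    rw [h3, ← Measure.map_map h2.measurable (measurable_const_smul _), h1, Measure.map_smul,
      h2.map_eq]
    congr 1
    rw [finrank_euclideanSpace_fin, one_div, inv_pow, inv_inv, abs_of_nonneg (by positivity),
      ENNReal.ofReal_pow (by norm_num)]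
    norm_num
  have hsub : M.cell K ⊆ y ⁻¹' M.cell K := by
    intro x hx
    exact M.convex_cell K hx (M.vertex_mem_cell K i) (by norm_num) (by norm_num) (by norm_num)
  calc ∫⁻ x in M.cell K, f (y x) ≤ ∫⁻ x in y ⁻¹' M.cell K, f (y x) :=
        lintegral_mono_set hsub
    _ = ∫⁻ x in M.cell K, f x ∂Measure.map y volume :=
        (setLIntegral_map (M.measurableSet_cell K) hf hym).symm
    _ = _ := by rw [hmap, Measure.restrict_smul, lintegral_smul_measure, smul_eq_mul]

/-- The pointwise bound is integrated over the cell; the constant is 2 · 2^(n+1) + 1. It does not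
depend on the shape of the cell. -/
theorem volume_mul_enorm_vertex_sub_le (V : M.NodalField) (K : M.Elem) (i : Fin (n + 2))
    (c : State n) :
    volume (M.cell K) * ‖V (M.vertex K i) - c‖ₑ ≤
      (2 ^ (n + 2) + 1) * ∫⁻ x in M.cell K, ‖M.interp V K x - c‖ₑ := by
  have hf : Measurable fun x => ‖M.interp V K x - c‖ₑ :=
    ((M.continuous_interp V K).sub continuous_const).enorm.measurable
  calc volume (M.cell K) * ‖V (M.vertex K i) - c‖ₑ
      = ∫⁻ _ in M.cell K, ‖V (M.vertex K i) - c‖ₑ := by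
        rw [setLIntegral_const, mul_comm]
    _ ≤ ∫⁻ x in M.cell K,
          (2 * ‖M.interp V K ((1 / 2 : ℝ) • x + (1 / 2 : ℝ) • M.simplex K i) - c‖ₑ
          + ‖M.interp V K x - c‖ₑ) := lintegral_mono fun x => M.enorm_vertex_sub_le V K i c x
    _ = 2 * (∫⁻ x in M.cell K,
          ‖M.interp V K ((1 / 2 : ℝ) • x + (1 / 2 : ℝ) • M.simplex K i) - c‖ₑ)
          + ∫⁻ x in M.cell K, ‖M.interp V K x - c‖ₑ := by
        rw [lintegral_add_right _ hf, lintegral_const_mul' _ _ (by norm_num)]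
    _ ≤ 2 * (2 ^ (n + 1) * ∫⁻ x in M.cell K, ‖M.interp V K x - c‖ₑ)
          + ∫⁻ x in M.cell K, ‖M.interp V K x - c‖ₑ := by
        gcongr
        exact M.lintegral_cell_homothety_le K i hf
    _ = _ := by ring

/-- The sum of the distances of the nodal values around `x` from `u x`. -/
def nodalError (V : M.NodalField) (u : Pt n → State n) (x : Pt n) : ℝ≥0∞ :=
  ∑' K, (interior (M.cell K)).indicator (fun x => ∑ i, ‖V (M.vertex K i) - u x‖ₑ) x

theorem enorm_sub_le_nodalError (V : M.NodalField) (u : Pt n → State n) {x : Pt n} {K : M.Elem}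
    (hx : x ∈ interior (M.cell K)) (i : Fin (n + 2)) :
    ‖V (M.vertex K i) - u x‖ₑ ≤ M.nodalError V u x := by
  refine le_trans ?_ (ENNReal.le_tsum K)
  rw [indicator_of_mem hx]
  exact Finset.single_le_sum (f := fun i => ‖V (M.vertex K i) - u x‖ₑ) (fun _ _ => zero_le)
    (Finset.mem_univ i)

/-- On one element, the distance of the nodal values from `u` is controlled by that of the
interpolant and by the oscillation of a comparison function. -/
theorem lintegral_cell_nodal_le (V : M.NodalField) (u g : Pt n → State n)
    (K : M.Elem) {ε : ℝ≥0∞} (hg : ∀ x ∈ M.cell K, ∀ y ∈ M.cell K, ‖g x - g y‖ₑ ≤ ε) :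
    ∫⁻ x in M.cell K, ∑ i, ‖V (M.vertex K i) - u x‖ₑ ≤
      (n + 2) * (2 ^ (n + 2) + 2) *
        ∫⁻ x in M.cell K, (‖M.recon V x - u x‖ₑ + ‖u x - g x‖ₑ + ε) := by
  set F : Pt n → ℝ≥0∞ := fun x => ‖M.recon V x - u x‖ₑ + ‖u x - g x‖ₑ + ε with hF
  -- A constant reference state is needed for the nodal estimate; `g` stays within `ε` of it on the
  -- cell. Each of the `n + 2` vertices costs 2^(n+2) + 1 for its distance from `c` and 1 for that
  -- of `u` from `c`.
  set c := g (M.simplex K 0) with hc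
  have hgc : ∀ x ∈ M.cell K, ‖g x - c‖ₑ ≤ ε := fun x hx => hg x hx _ (M.vertex_mem_cell K 0)
  have h1 : ∀ x ∈ M.cell K, ‖M.interp V K x - c‖ₑ ≤ F x := by
    intro x hx
    have e : M.interp V K x - c = (M.recon V x - u x) + (u x - g x) + (g x - c) := by
      rw [M.recon_eq_interp V K hx]; abel
    rw [e]
    exact (enorm_add_le _ _).trans (add_le_add (enorm_add_le _ _) (hgc x hx))
  have h2 : ∀ x ∈ M.cell K, ∀ i,
      ‖V (M.vertex K i) - u x‖ₑ ≤ ‖V (M.vertex K i) - c‖ₑ + F x := by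
    intro x hx i
    have e : V (M.vertex K i) - u x =
        (V (M.vertex K i) - c) - (g x - c) - (u x - g x) := by abel
    rw [e]
    refine (enorm_sub_le).trans ((add_le_add_left enorm_sub_le _).trans ?_)
    rw [add_assoc]
    gcongr
    calc ‖g x - c‖ₑ + ‖u x - g x‖ₑ ≤ ε + ‖u x - g x‖ₑ := add_le_add_left (hgc x hx) _
      _ ≤ F x := by
        simp only [hF]
        rw [add_comm ε]
        exact add_le_add_left le_add_self _
  calc ∫⁻ x in M.cell K, ∑ i, ‖V (M.vertex K i) - u x‖ₑ
      ≤ ∫⁻ x in M.cell K, ((∑ i, ‖V (M.vertex K i) - c‖ₑ) + (n + 2) * F x) := by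
        refine setLIntegral_mono' (M.measurableSet_cell K) fun x hx => ?_
        refine (Finset.sum_le_sum fun i _ => h2 x hx i).trans_eq ?_
        rw [Finset.sum_add_distrib]
        simp
    _ = (∑ i, volume (M.cell K) * ‖V (M.vertex K i) - c‖ₑ)
          + (n + 2) * ∫⁻ x in M.cell K, F x := by
        rw [lintegral_add_left measurable_const, setLIntegral_const, mul_comm, Finset.mul_sum,
          lintegral_const_mul' _ _ (by finiteness)]
    _ ≤ (∑ _i : Fin (n + 2), (2 ^ (n + 2) + 1) * ∫⁻ x in M.cell K, F x)
          + (n + 2) * ∫⁻ x in M.cell K, F x := by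
        refine add_le_add_left (Finset.sum_le_sum fun i _ => ?_) _
        refine (M.volume_mul_enorm_vertex_sub_le V K i c).trans ?_
        exact mul_le_mul' le_rfl (setLIntegral_mono' (M.measurableSet_cell K) h1)
    _ = _ := by
        simp only [Finset.sum_const, Finset.card_univ, Fintype.card_fin, nsmul_eq_mul]
        push_cast
        ring

/-- Only cells meeting `B` contribute, and these lie in `X`. Their interiors are disjoint and of
full measure in the cells, so the bounds on single cells add up to an integral over `X`. -/
theorem lintegral_nodalError_le (V : M.NodalField) {u : Pt n → State n} (hu : Measurable u)
    (g : Pt n → State n) {B X : Set (Pt n)} (hB : MeasurableSet B)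
    (hX : ∀ K, (M.cell K ∩ B).Nonempty → M.cell K ⊆ X) {ε : ℝ≥0∞}
    (hg : ∀ K, ∀ x ∈ M.cell K, ∀ y ∈ M.cell K, ‖g x - g y‖ₑ ≤ ε) :
    ∫⁻ x in B, M.nodalError V u x ≤ (n + 2) * (2 ^ (n + 2) + 2) *
        ∫⁻ x in X, (‖M.recon V x - u x‖ₑ + ‖u x - g x‖ₑ + ε) := by
  classical
  have := M.countable_elem
  unfold nodalError
  set F : Pt n → ℝ≥0∞ := fun x => ‖M.recon V x - u x‖ₑ + ‖u x - g x‖ₑ + ε with hF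
  rw [lintegral_tsum]
  · let I : M.Elem → Set (Pt n) := fun K =>
      if (M.cell K ∩ B).Nonempty then interior (M.cell K) else ∅
    have hI : ⋃ K, I K ⊆ X := by
      refine iUnion_subset fun K => ?_
      by_cases h : (M.cell K ∩ B).Nonempty
      · simp only [I, h, if_true]; exact interior_subset.trans (hX K h)
      · simp [I, h]
    have hIm : ∀ K, MeasurableSet (I K) := by
      intro K
      by_cases h : (M.cell K ∩ B).Nonempty
      · simp only [I, h, if_true]; exact isOpen_interior.measurableSet
      · simp [I, h]
    have hId : Pairwise (Function.onFun Disjoint I) := by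
      intro K L hKL
      refine (M.pairwise_disjoint_interior hKL).mono ?_ ?_
      · simp only [I]; split_ifs <;> simp
      · simp only [I]; split_ifs <;> simp
    calc _ ≤ ∑' K, (n + 2) * (2 ^ (n + 2) + 2) * ∫⁻ x in I K, F x := by
          refine ENNReal.tsum_le_tsum fun K => ?_
          by_cases h : (M.cell K ∩ B).Nonempty
          · simp only [I, h, if_true]
            rw [setLIntegral_congr (M.interior_ae_eq_cell K)]
            refine le_trans ?_ (M.lintegral_cell_nodal_le V u g K (hg K))
            refine (setLIntegral_le_lintegral _ _).trans ?_
            rw [lintegral_indicator isOpen_interior.measurableSet]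
            exact lintegral_mono_set interior_subset
          · refine le_of_eq_of_le ?_ zero_le
            rw [setLIntegral_eq_zero hB]
            intro x hx
            refine indicator_of_notMem (fun hxK => h ⟨x, interior_subset hxK, hx⟩) _
      _ = (n + 2) * (2 ^ (n + 2) + 2) * ∫⁻ x in ⋃ K, I K, F x := by
          rw [ENNReal.tsum_mul_left, lintegral_iUnion hIm hId]
      _ ≤ _ := by gcongr
  · intro K
    refine (Measurable.indicator ?_ isOpen_interior.measurableSet).aemeasurable
    exact Finset.measurable_fun_sum _ fun i _ => (hu.const_sub _).enorm

end Mesh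

/-- Convergence to zero in `L¹` on an increasing sequence of sets implies convergence almost
everywhere on their union along a subsequence. -/
theorem exists_subseq_ae_tendsto_zero {X : Type*} [MeasurableSpace X] {μ : Measure X}
    {e : ℕ → X → ℝ≥0∞} (he : ∀ k, Measurable (e k)) {C : ℕ → Set X} (hC : Monotone C)
    (h : ∀ m, Tendsto (fun k => ∫⁻ x in C m, e k x ∂μ) atTop (𝓝 0)) :
    ∃ ns : ℕ → ℕ, StrictMono ns ∧
      ∀ᵐ x ∂μ.restrict (⋃ m, C m), Tendsto (fun k => e (ns k) x) atTop (𝓝 0) := by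
  -- Choose the integral of the `m`-th function over `C m` to be at most 2^(-m). On a fixed `C m`
  -- all later functions then have summable integrals, so almost everywhere their series converges
  -- and its terms tend to zero.
  obtain ⟨ns, hns, hle⟩ := extraction_forall_of_eventually
    (P := fun m k => ∫⁻ x in C m, e k x ∂μ ≤ (2⁻¹ : ℝ≥0∞) ^ m)
    (fun m => (h m).eventually_le_const (by
      refine pos_iff_ne_zero.2 (pow_ne_zero _ (by simp))))
  refine ⟨ns, hns, ?_⟩
  rw [ae_restrict_iUnion_iff]
  intro m
  have hfin : ∫⁻ x in C m, ∑' k, e (ns (k + m)) x ∂μ ≠ ⊤ := by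
    rw [lintegral_tsum fun k => (he _).aemeasurable]
    refine ne_top_of_le_ne_top ?_ (ENNReal.tsum_le_tsum fun k =>
      (lintegral_mono_set (hC (Nat.le_add_left m k))).trans ((hle (k + m)).trans
        (pow_le_pow_right_of_le_one' (by simp) (Nat.le_add_right k m))))
    rw [ENNReal.tsum_geometric]
    simp
  filter_upwards [ae_lt_top (Measurable.tsum fun k => he _) hfin] with x hx
  exact (tendsto_add_atTop_iff_nat m).1 (ENNReal.tendsto_atTop_zero_of_tsum_ne_top hx.ne)

end

section

variable {n : ℕ}

/-! ### Almost everywhere convergence of the nodal values -/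

namespace Mesh

variable {Ω : Set (Pt n)} (M : Mesh n Ω)

theorem measurable_recon_idx (U : ℕ → M.NodalField) {idx : ℝ → ℕ} (hidx : Measurable idx) :
    Measurable fun z : ℝ × Pt n => M.recon (U (idx z.1)) z.2 := by
  have h : Measurable fun q : ℕ × Pt n => M.recon (U q.1) q.2 :=
    measurable_from_prod_countable_right fun j => M.measurable_recon (U j)
  exact h.comp ((hidx.comp measurable_fst).prodMk measurable_snd)

theorem measurable_nodal_idx (U : ℕ → M.NodalField) {idx : ℝ → ℕ} (hidx : Measurable idx)
    (σ : M.Vertex) : Measurable fun t : ℝ => U (idx t) σ :=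
  (measurable_from_nat (f := fun j => U j σ)).comp hidx

theorem measurable_nodalError_idx (U : ℕ → M.NodalField) {idx : ℝ → ℕ} (hidx : Measurable idx)
    {u : ℝ × Pt n → State n} (hu : Measurable u) :
    Measurable fun z : ℝ × Pt n =>
      M.nodalError (U (idx z.1)) (fun x => u (z.1, x)) z.2 := by
  have := M.countable_elem
  unfold nodalError
  refine Measurable.tsum fun K => ?_
  have h : Measurable ((Prod.snd ⁻¹' interior (M.cell K) : Set (ℝ × Pt n)).indicator
      fun z => ∑ i, ‖U (idx z.1) (M.vertex K i) - u z‖ₑ) := by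
    refine Measurable.indicator ?_ (measurable_snd isOpen_interior.measurableSet)
    exact Finset.measurable_fun_sum _ fun i _ =>
      (((M.measurable_nodal_idx U hidx _).comp measurable_fst).sub hu).enorm
  exact h

theorem norm_recon_le {V : M.NodalField} {r : ℝ} (hr : 0 ≤ r) (hV : ∀ σ, ‖V σ‖ ≤ r) (x : Pt n) :
    ‖M.recon V x‖ ≤ r := by
  by_cases h : ∃ K, x ∈ M.cell K
  · obtain ⟨K, hK⟩ := h
    rw [M.recon_eq_interp V K hK]
    have := M.interp_mem_of_convex (convex_closedBall (0 : State n) r) (V := V) (K := K)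
      (fun i => by simpa using hV _) hK
    simpa using this
  · simpa [recon, h] using hr

end Mesh

theorem mem_cthickening_of_cell {Ω : Set (Pt n)} {M : Mesh n Ω} {K : M.Elem} {B : Set (Pt n)}
    {δ : ℝ} (hδ : Metric.diam (M.cell K) ≤ δ) (hK : (M.cell K ∩ B).Nonempty) :
    M.cell K ⊆ Metric.cthickening δ B := by
  obtain ⟨y, hy, hyB⟩ := hK
  intro x hx
  exact Metric.mem_cthickening_of_dist_le x y δ B hyB
    ((Metric.dist_le_diam_of_mem (M.isCompact_cell K).isBounded hx hy).trans hδ)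

section Convergence

variable {Ω : Set (Pt n)} {M : ℕ → Mesh n Ω} {U : ∀ k, ℕ → (M k).NodalField}
  {idx : ℕ → ℝ → ℕ} {J : Set ℝ} {r : ℝ}

/-- Three errors are made small on a slightly larger compact set: that of the interpolants, that of
a continuous compactly supported `g` approximating `u` in L¹, and the oscillation of `g` on a cell,
small by uniform continuity once the mesh is fine. -/
theorem tendsto_lintegral_nodalError (hΩ : IsOpen Ω) (hsize : MeshSizeTendsToZero M)
    (hidx : ∀ k, Measurable (idx k)) (hr : 0 ≤ r)
    (hbdd : ∀ k, ∀ t ∈ J, ∀ σ, ‖U k (idx k t) σ‖ ≤ r)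
    {u : ℝ × Pt n → State n} (hu : StronglyMeasurable u)
    (hconv : ∀ C : Set (ℝ × Pt n), IsCompact C → C ⊆ J ×ˢ Ω →
      Tendsto (fun k => ∫⁻ z in C, ‖(M k).recon (U k (idx k z.1)) z.2 - u z‖ₑ) atTop (𝓝 0))
    {I : Set ℝ} (hI : IsCompact I) (hIJ : I ⊆ J) {B : Set (Pt n)} (hB : IsCompact B)
    (hBΩ : B ⊆ Ω) :
    Tendsto (fun k => ∫⁻ z in I ×ˢ B,
      (M k).nodalError (U k (idx k z.1)) (fun x => u (z.1, x)) z.2) atTop (𝓝 0) := by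
  obtain ⟨δ, hδ, hδΩ⟩ := hB.exists_cthickening_subset_open hΩ hBΩ
  set X := Metric.cthickening δ B with hXdef
  have hX : IsCompact X := hB.cthickening
  have hIX : IsCompact (I ×ˢ X) := hI.prod hX
  have hIXJ : I ×ˢ X ⊆ J ×ˢ Ω := prod_mono hIJ hδΩ
  have hvol : volume (I ×ˢ X) < ⊤ := hIX.measure_lt_top
  have hlim := hconv _ hIX hIXJ
  have hmeas : ∀ k, Measurable fun z : ℝ × Pt n => (M k).recon (U k (idx k z.1)) z.2 :=
    fun k => (M k).measurable_recon_idx (U k) (hidx k)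
  -- For some index the L¹ distance of `u` from the interpolant is finite, and the interpolant is
  -- bounded by `r`.
  have hint : Integrable u (volume.restrict (I ×ˢ X)) := by
    refine ⟨hu.aestronglyMeasurable, ?_⟩
    obtain ⟨k, hk⟩ := (hlim.eventually_lt_const (ENNReal.zero_lt_top)).exists
    have h1 : ∫⁻ z in I ×ˢ X, ‖u z‖ₑ ≤ ∫⁻ z in I ×ˢ X,
        (‖(M k).recon (U k (idx k z.1)) z.2 - u z‖ₑ + ENNReal.ofReal r) := by
      refine setLIntegral_mono' hIX.isClosed.measurableSet fun z hz => ?_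
      have e : u z = (M k).recon (U k (idx k z.1)) z.2 -
          ((M k).recon (U k (idx k z.1)) z.2 - u z) := by abel
      conv_lhs => rw [e]
      refine enorm_sub_le.trans ?_
      rw [add_comm]
      gcongr
      rw [← ofReal_norm]
      exact ENNReal.ofReal_le_ofReal
        ((M k).norm_recon_le hr (hbdd k _ (hIJ hz.1)) _)
    refine h1.trans_lt ?_
    rw [lintegral_add_right _ measurable_const, setLIntegral_const]
    exact ENNReal.add_lt_top.2 ⟨hk, ENNReal.mul_lt_top ENNReal.ofReal_lt_top hvol⟩
  set A : ℝ≥0∞ := (n + 2) * (2 ^ (n + 2) + 2) with hA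
  set D : ℝ≥0∞ := A * (1 + 1 + volume (I ×ˢ X)) with hD
  have hAtop : A ≠ ⊤ := by finiteness
  have hDtop : D ≠ ⊤ := by finiteness
  have hD0 : D ≠ 0 := by
    simp [hD, hA]
  refine ENNReal.tendsto_nhds_zero.2 fun ε hε => ?_
  obtain ⟨ε', hε'0, hε'⟩ : ∃ ε' : ℝ, 0 < ε' ∧ D * ENNReal.ofReal ε' ≤ ε := by
    rcases eq_or_ne ε ⊤ with rfl | hεt
    · exact ⟨1, one_pos, le_top⟩
    · have hne : ε / D ≠ ⊤ := (ENNReal.div_lt_top hεt hD0).ne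
      refine ⟨(ε / D).toReal, ENNReal.toReal_pos (ENNReal.div_pos hε.ne' hDtop).ne' hne, ?_⟩
      rw [ENNReal.ofReal_toReal hne]
      exact ENNReal.mul_div_le
  have hε'' : ENNReal.ofReal ε' ≠ 0 := (ENNReal.ofReal_pos.2 hε'0).ne'
  obtain ⟨g, hgs, hgle, hgc, -⟩ := hint.exists_hasCompactSupport_lintegral_sub_le hε''
  obtain ⟨δ', hδ', hgu⟩ := Metric.uniformContinuous_iff.1
    (hgs.uniformContinuous_of_continuous hgc) ε' hε'0
  filter_upwards [hsize δ hδ, hsize (δ' / 2) (by positivity),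
    hlim.eventually_le_const (pos_iff_ne_zero.2 hε'')] with k hk1 hk2 hk3
  have hslice : ∀ t, ∫⁻ x in B, (M k).nodalError (U k (idx k t)) (fun x => u (t, x)) x ≤
      A * ∫⁻ x in X, (‖(M k).recon (U k (idx k t)) x - u (t, x)‖ₑ + ‖u (t, x) - g (t, x)‖ₑ
        + ENNReal.ofReal ε') := by
    intro t
    refine (M k).lintegral_nodalError_le (U k (idx k t))
      (hu.measurable.comp (measurable_const.prodMk measurable_id)) (fun x => g (t, x))
      hB.isClosed.measurableSet (fun K hK => mem_cthickening_of_cell (hk1 K) hK) ?_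
    intro K x hx y hy
    rw [← edist_eq_enorm_sub, edist_dist]
    refine ENNReal.ofReal_le_ofReal (hgu ?_).le
    rw [Prod.dist_eq]
    simp only [dist_self]
    rw [max_eq_right dist_nonneg]
    refine lt_of_le_of_lt ((Metric.dist_le_diam_of_mem ((M k).isCompact_cell K).isBounded
      hx hy).trans (hk2 K)) (by linarith)
  have hm1 : Measurable fun z : ℝ × Pt n => ‖(M k).recon (U k (idx k z.1)) z.2 - u z‖ₑ :=
    ((hmeas k).sub hu.measurable).enorm
  have hm2 : Measurable fun z : ℝ × Pt n => ‖u z - g z‖ₑ :=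
    (hu.measurable.sub hgc.measurable).enorm
  have hm3 : Measurable fun z : ℝ × Pt n => ‖(M k).recon (U k (idx k z.1)) z.2 - u z‖ₑ
      + ‖u z - g z‖ₑ + ENNReal.ofReal ε' := (hm1.add hm2).add measurable_const
  have hvolp : ∀ S : Set (Pt n), (volume : Measure (ℝ × Pt n)).restrict (I ×ˢ S) =
      (volume.restrict I).prod (volume.restrict S) := fun S => by
    rw [Measure.prod_restrict]; rfl
  calc ∫⁻ z in I ×ˢ B, (M k).nodalError (U k (idx k z.1)) (fun x => u (z.1, x)) z.2
      = ∫⁻ t in I, ∫⁻ x in B, (M k).nodalError (U k (idx k t)) (fun x => u (t, x)) x := by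
        rw [hvolp, lintegral_prod _
          ((M k).measurable_nodalError_idx (U k) (hidx k) hu.measurable).aemeasurable]
    _ ≤ ∫⁻ t in I, A * ∫⁻ x in X, (‖(M k).recon (U k (idx k t)) x - u (t, x)‖ₑ
          + ‖u (t, x) - g (t, x)‖ₑ + ENNReal.ofReal ε') := lintegral_mono hslice
    _ = A * ∫⁻ z in I ×ˢ X, (‖(M k).recon (U k (idx k z.1)) z.2 - u z‖ₑ
          + ‖u z - g z‖ₑ + ENNReal.ofReal ε') := by
        rw [lintegral_const_mul' _ _ hAtop, hvolp, lintegral_prod _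
          hm3.aemeasurable]
    _ = A * ((∫⁻ z in I ×ˢ X, ‖(M k).recon (U k (idx k z.1)) z.2 - u z‖ₑ)
          + (∫⁻ z in I ×ˢ X, ‖u z - g z‖ₑ) + ENNReal.ofReal ε' * volume (I ×ˢ X)) := by
        rw [lintegral_add_right _ measurable_const, lintegral_add_right _ hm2, setLIntegral_const]
    _ ≤ A * (ENNReal.ofReal ε' + ENNReal.ofReal ε' + ENNReal.ofReal ε' * volume (I ×ˢ X)) := by
        gcongr
    _ = D * ENNReal.ofReal ε' := by rw [hD]; ring
    _ ≤ ε := hε'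

/-- Along a subsequence the nodal values around almost every point converge to the limit. -/
theorem exists_subseq_nodal_tendsto (hΩ : IsOpen Ω) (hJ : IsOpen J)
    (hsize : MeshSizeTendsToZero M)
    (hidx : ∀ k, Measurable (idx k)) (hr : 0 ≤ r)
    (hbdd : ∀ k, ∀ t ∈ J, ∀ σ, ‖U k (idx k t) σ‖ ≤ r)
    {u : ℝ × Pt n → State n} (hu : AEStronglyMeasurable u (volume.restrict (J ×ˢ Ω)))
    (hconv : ∀ C : Set (ℝ × Pt n), IsCompact C → C ⊆ J ×ˢ Ω →
      Tendsto (fun k => ∫⁻ z in C, ‖(M k).recon (U k (idx k z.1)) z.2 - u z‖ₑ) atTop (𝓝 0)) :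
    ∃ ns : ℕ → ℕ, StrictMono ns ∧ ∀ᵐ z ∂(volume : Measure (ℝ × Pt n)).restrict (J ×ˢ Ω),
      ∀ ε > 0, ∀ᶠ k in atTop, ∀ K, z.2 ∈ interior ((M (ns k)).cell K) → ∀ i,
        ‖U (ns k) (idx (ns k) z.1) ((M (ns k)).vertex K i) - u z‖ < ε := by
  obtain ⟨v, hv, huv⟩ := hu
  have hconv' : ∀ C : Set (ℝ × Pt n), IsCompact C → C ⊆ J ×ˢ Ω →
      Tendsto (fun k => ∫⁻ z in C, ‖(M k).recon (U k (idx k z.1)) z.2 - v z‖ₑ) atTop (𝓝 0) := by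
    intro C hC hCJ
    refine (hconv C hC hCJ).congr fun k => ?_
    refine lintegral_congr_ae ?_
    filter_upwards [ae_mono (Measure.restrict_mono hCJ le_rfl) huv] with z hz
    rw [hz]
  have hopen : IsOpen (J ×ˢ Ω) := hJ.prod hΩ
  have : LocallyCompactSpace (J ×ˢ Ω : Set (ℝ × Pt n)) := hopen.locallyCompactSpace
  -- A compact exhaustion of the space-time domain; each member is enclosed in the product of its
  -- two projections, since the estimate is available on products.
  let C : ℕ → Set (ℝ × Pt n) := fun m => Subtype.val '' compactCovering (J ×ˢ Ω : Set _) m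
  have hCc : ∀ m, IsCompact (C m) := fun m => (isCompact_compactCovering _ m).image
    continuous_subtype_val
  have hCs : ∀ m, C m ⊆ J ×ˢ Ω := fun m => by rintro _ ⟨z, _, rfl⟩; exact z.2
  have hCmono : Monotone C := fun m m' h => image_mono (compactCovering_subset _ h)
  have hCU : ⋃ m, C m = J ×ˢ Ω := by
    rw [← image_iUnion, iUnion_compactCovering, image_univ, Subtype.range_coe]
  obtain ⟨ns, hns, hae⟩ := exists_subseq_ae_tendsto_zero
    (μ := (volume : Measure (ℝ × Pt n)))
    (e := fun k z => (M k).nodalError (U k (idx k z.1)) (fun x => v (z.1, x)) z.2)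
    (fun k => (M k).measurable_nodalError_idx (U k) (hidx k) hv.measurable) hCmono
    (fun m => by
      have h := tendsto_lintegral_nodalError hΩ hsize hidx hr hbdd hv hconv'
        ((hCc m).image continuous_fst) (by
          rintro _ ⟨z, hz, rfl⟩; exact (hCs m hz).1)
        ((hCc m).image continuous_snd) (by
          rintro _ ⟨z, hz, rfl⟩; exact (hCs m hz).2)
      refine tendsto_of_tendsto_of_tendsto_of_le_of_le tendsto_const_nhds h
        (fun _ => zero_le) fun k => lintegral_mono_set ?_
      intro z hz
      exact ⟨⟨z, hz, rfl⟩, ⟨z, hz, rfl⟩⟩)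
  rw [hCU] at hae
  refine ⟨ns, hns, ?_⟩
  filter_upwards [hae, huv] with z hz hzv ε hε
  filter_upwards [hz.eventually_lt_const (ENNReal.ofReal_pos.2 hε)] with k hk K hK i
  have h := ((M (ns k)).enorm_sub_le_nodalError (U (ns k) (idx (ns k) z.1))
    (fun x => v (z.1, x)) hK i).trans_lt hk
  rw [← ofReal_norm, ENNReal.ofReal_lt_ofReal_iff hε] at h
  rw [hzv]
  exact h

end Convergence

end

section

variable {n : ℕ}

/-! ### The discrete weak form -/

theorem sum_range_smul_sub {E : Type*} [AddCommGroup E] [Module ℝ E] (a : ℕ → ℝ) (w : ℕ → E)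
    (N : ℕ) : ∑ j ∈ Finset.range N, a (j + 1) • (w (j + 1) - w j) =
      a N • w N - a 0 • w 0 - ∑ j ∈ Finset.range N, (a (j + 1) - a j) • w j := by
  induction N with
  | zero => simp
  | succ N ih =>
    rw [Finset.sum_range_succ, Finset.sum_range_succ, ih]
    module

namespace Mesh

variable {Ω : Set (Pt n)} (M : Mesh n Ω)

/-- Testing the nodal equations at the vertices in `Ω` and sorting by elements. -/
theorem sum_elements_eq_zero {S : Set (Pt n)} (hS : S ⊆ Ω) {F : Finset M.Elem}
    (hF : ∀ K i, M.simplex K i ∈ S → K ∈ F) {ψ : Pt n → ℝ} (hψ : ∀ x ∉ S, ψ x = 0) {dt : ℝ}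
    {w : M.Vertex → Cons n} {r : M.Elem → Fin (n + 2) → Cons n}
    (h : ∀ σ : M.Vertex, σ.1 ∈ Ω →
      M.dualVolume σ • w σ + dt • ∑ᶠ q ∈ M.star σ, r q.1 q.2 = 0) :
    ∑ K ∈ F, ∑ i, ψ (M.simplex K i) •
      ((volume.real (M.cell K) / (n + 2)) • w (M.vertex K i) + dt • r K i) = 0 := by
  classical
  let A : Finset (M.Elem × Fin (n + 2)) :=
    (F ×ˢ Finset.univ).filter fun q => M.simplex q.1 q.2 ∈ S
  have h1 : ∑ K ∈ F, ∑ i, ψ (M.simplex K i) •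
      ((volume.real (M.cell K) / (n + 2)) • w (M.vertex K i) + dt • r K i) =
      ∑ q ∈ A, ψ (M.simplex q.1 q.2) •
      ((volume.real (M.cell q.1) / (n + 2)) • w (M.vertex q.1 q.2) + dt • r q.1 q.2) := by
    rw [← Finset.sum_product' (f := fun K i => ψ (M.simplex K i) •
      ((volume.real (M.cell K) / (n + 2)) • w (M.vertex K i) + dt • r K i))]
    refine (Finset.sum_filter_of_ne fun q _ hne => ?_).symm
    by_contra hc
    exact hne (by rw [hψ _ hc, zero_smul])
  rw [h1, ← Finset.sum_fiberwise_of_maps_to (t := A.image fun q => M.vertex q.1 q.2)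
    (g := fun q => M.vertex q.1 q.2) (fun q hq => Finset.mem_image_of_mem _ hq)]
  refine Finset.sum_eq_zero fun σ hσ => ?_
  obtain ⟨q₀, hq₀, rfl⟩ := Finset.mem_image.1 hσ
  have hσS : M.simplex q₀.1 q₀.2 ∈ S := (Finset.mem_filter.1 hq₀).2
  set σ := M.vertex q₀.1 q₀.2 with hσdef
  -- Every element around a vertex in `S` belongs to `F`, so the fibre over σ is its full star and
  -- the nodal equation applies.
  have hstar : A.filter (fun q => M.vertex q.1 q.2 = σ) = (M.star_finite σ).toFinset := by
    ext q
    rw [Finite.mem_toFinset, Finset.mem_filter]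
    refine ⟨fun hq => hq.2, fun hq => ⟨?_, hq⟩⟩
    have hqS : M.simplex q.1 q.2 ∈ S := by
      have : M.simplex q.1 q.2 = M.simplex q₀.1 q₀.2 :=
        congrArg Subtype.val (hq : M.vertex q.1 q.2 = σ)
      rwa [this]
    exact Finset.mem_filter.2
      ⟨Finset.mem_product.2 ⟨hF _ _ hqS, Finset.mem_univ _⟩, hqS⟩
  rw [hstar]
  have h2 := h σ (hS hσS)
  rw [dualVolume] at h2
  simp only [finsum_mem_eq_finite_toFinset_sum _ (M.star_finite σ)] at h2
  rw [Finset.sum_smul, Finset.smul_sum, ← Finset.sum_add_distrib] at h2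
  have h3 : ∀ q ∈ (M.star_finite σ).toFinset, ψ (M.simplex q.1 q.2) •
      ((volume.real (M.cell q.1) / (n + 2)) • w (M.vertex q.1 q.2) + dt • r q.1 q.2) =
      ψ σ.1 • ((volume.real (M.cell q.1) / (n + 2)) • w σ + dt • r q.1 q.2) := by
    intro q hq
    rw [Finite.mem_toFinset] at hq
    have hq' : M.vertex q.1 q.2 = σ := hq
    have hq'' : M.simplex q.1 q.2 = σ.1 := congrArg Subtype.val hq'
    rw [hq', hq'']
  rw [Finset.sum_congr rfl h3, ← Finset.smul_sum, h2, smul_zero]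

theorem volume_real_cell_pos (K : M.Elem) : 0 < volume.real (M.cell K) := by
  have h : (interior (M.cell K)).Nonempty :=
    ⟨_, (M.simplex K).centroid_mem_interior_convexHull⟩
  refine ENNReal.toReal_pos ?_ (M.isCompact_cell K).measure_lt_top.ne
  exact ((isOpen_interior.measure_pos volume h).trans_le (measure_mono interior_subset)).ne'

end Mesh

namespace Residuals

variable {Ω : Set (Pt n)} {M : Mesh n Ω} (R : Residuals M) (eos : EquationOfState)

/-- The density, on the space-time cell of step `j` and element `K`, of the scheme tested with
`φ`. -/
def testDensity (dt : ℝ) (φ : ℝ × Pt n → ℝ) (U : ℕ → M.NodalField) (j : ℕ) (K : M.Elem) : Cons n :=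
  ((n + 2 : ℝ)⁻¹) • ∑ i, ((φ ((j + 1 : ℕ) * dt, M.simplex K i) - φ (j * dt, M.simplex K i)) / dt) •
      EulerRD.conserved (U j (M.vertex K i))
    - (volume.real (M.cell K))⁻¹ • ∑ i, φ ((j + 1 : ℕ) * dt, M.simplex K i) •
      R.interior eos (U j) (U (j + 1)) K i

/-- The discrete weak form of the scheme. -/
theorem discrete_weak_form {S : Set (Pt n)} (hS : S ⊆ Ω) {F : Finset M.Elem}
    (hF : ∀ K i, M.simplex K i ∈ S → K ∈ F) {φ : ℝ × Pt n → ℝ} (hφ : ∀ t, ∀ x ∉ S, φ (t, x) = 0)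
    {dt : ℝ} (hdt : dt ≠ 0) {N : ℕ} (hφN : ∀ x, φ (N * dt, x) = 0) {U : ℕ → M.NodalField}
    (h : ∀ j < N, ∀ σ : M.Vertex, σ.1 ∈ Ω →
      M.dualVolume σ • (EulerRD.conserved (U (j + 1) σ) - EulerRD.conserved (U j σ))
        + dt • ∑ᶠ q ∈ M.star σ, R.interior eos (U j) (U (j + 1)) q.1 q.2 = 0) :
    ∑ K ∈ F, (volume.real (M.cell K)) • ((n + 2 : ℝ)⁻¹ •
        ∑ i, φ (0, M.simplex K i) • EulerRD.conserved (U 0 (M.vertex K i))) =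
      -∑ q ∈ Finset.range N ×ˢ F, (dt * volume.real (M.cell q.2)) •
        R.testDensity eos dt φ U q.1 q.2 := by
  have h0 : ∑ j ∈ Finset.range N, ∑ K ∈ F, ∑ i, φ ((j + 1 : ℕ) * dt, M.simplex K i) •
      ((volume.real (M.cell K) / (n + 2)) • (EulerRD.conserved (U (j + 1) (M.vertex K i)) -
        EulerRD.conserved (U j (M.vertex K i))) +
        dt • R.interior eos (U j) (U (j + 1)) K i) = 0 := by
    refine Finset.sum_eq_zero fun j hj => ?_
    exact M.sum_elements_eq_zero hS hF (ψ := fun x => φ ((j + 1 : ℕ) * dt, x)) (hφ _)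
      (w := fun σ => EulerRD.conserved (U (j + 1) σ) - EulerRD.conserved (U j σ))
      (h j (Finset.mem_range.1 hj))
  have h1 : ∀ K, ∑ j ∈ Finset.range N, ∑ i, φ ((j + 1 : ℕ) * dt, M.simplex K i) •
      ((volume.real (M.cell K) / (n + 2)) • (EulerRD.conserved (U (j + 1) (M.vertex K i)) -
        EulerRD.conserved (U j (M.vertex K i))) +
        dt • R.interior eos (U j) (U (j + 1)) K i) =
      -(volume.real (M.cell K) • ((n + 2 : ℝ)⁻¹ •
        ∑ i, φ (0, M.simplex K i) • EulerRD.conserved (U 0 (M.vertex K i)))) -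
      ∑ j ∈ Finset.range N, (dt * volume.real (M.cell K)) • R.testDensity eos dt φ U j K := by
    intro K
    have hK := (M.volume_real_cell_pos K).ne'
    -- Summation by parts in time; the term at the final time vanishes by `hφN`, and the initial one
    -- is kept.
    have e1 : ∀ i, ∑ j ∈ Finset.range N, φ ((j + 1 : ℕ) * dt, M.simplex K i) •
        (EulerRD.conserved (U (j + 1) (M.vertex K i)) - EulerRD.conserved (U j (M.vertex K i))) =
        -(φ (0, M.simplex K i) • EulerRD.conserved (U 0 (M.vertex K i))) -
        ∑ j ∈ Finset.range N, (φ ((j + 1 : ℕ) * dt, M.simplex K i) - φ (j * dt, M.simplex K i)) •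
          EulerRD.conserved (U j (M.vertex K i)) := by
      intro i
      have := sum_range_smul_sub (fun j : ℕ => φ (j * dt, M.simplex K i))
        (fun j => EulerRD.conserved (U j (M.vertex K i))) N
      rw [this, hφN]
      simp
    have e2 : ∀ j, (dt * volume.real (M.cell K)) • R.testDensity eos dt φ U j K =
        (volume.real (M.cell K) / (n + 2)) • ∑ i,
          (φ ((j + 1 : ℕ) * dt, M.simplex K i) - φ (j * dt, M.simplex K i)) •
          EulerRD.conserved (U j (M.vertex K i)) -
        dt • ∑ i, φ ((j + 1 : ℕ) * dt, M.simplex K i) •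
          R.interior eos (U j) (U (j + 1)) K i := by
      intro j
      have e : ∀ i, (φ ((j + 1 : ℕ) * dt, M.simplex K i) - φ (j * dt, M.simplex K i)) / dt =
          dt⁻¹ * (φ ((j + 1 : ℕ) * dt, M.simplex K i) - φ (j * dt, M.simplex K i)) :=
        fun i => by rw [div_eq_inv_mul]
      simp only [testDensity, e, mul_smul (dt⁻¹) _ _, ← Finset.smul_sum]
      rw [smul_sub, smul_smul, smul_smul, smul_smul]
      congr 2 <;> field_simp
    have e3 : ∑ j ∈ Finset.range N, ∑ i, φ ((j + 1 : ℕ) * dt, M.simplex K i) •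
        ((volume.real (M.cell K) / (n + 2)) • (EulerRD.conserved (U (j + 1) (M.vertex K i)) -
          EulerRD.conserved (U j (M.vertex K i))) +
          dt • R.interior eos (U j) (U (j + 1)) K i) =
        (volume.real (M.cell K) / (n + 2)) • (∑ i, ∑ j ∈ Finset.range N,
          φ ((j + 1 : ℕ) * dt, M.simplex K i) • (EulerRD.conserved (U (j + 1) (M.vertex K i)) -
          EulerRD.conserved (U j (M.vertex K i)))) +
        dt • ∑ j ∈ Finset.range N, ∑ i, φ ((j + 1 : ℕ) * dt, M.simplex K i) •
          R.interior eos (U j) (U (j + 1)) K i := by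
      rw [Finset.sum_comm (s := Finset.univ)]
      simp only [smul_add, Finset.sum_add_distrib, Finset.smul_sum]
      congr 1
      · exact Finset.sum_congr rfl fun j _ => Finset.sum_congr rfl fun i _ => smul_comm _ _ _
      · exact Finset.sum_congr rfl fun j _ => Finset.sum_congr rfl fun i _ => smul_comm _ _ _
    rw [e3]
    simp only [e1, e2, Finset.sum_sub_distrib, Finset.sum_neg_distrib, ← Finset.smul_sum]
    rw [Finset.sum_comm (s := Finset.univ), div_eq_mul_inv]
    module
  rw [Finset.sum_comm] at h0
  simp only [h1, Finset.sum_sub_distrib, Finset.sum_neg_distrib] at h0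
  rw [Finset.sum_product_right]
  rw [sub_eq_zero] at h0
  rw [← h0, neg_neg]

variable {R eos}

/-- The interior residuals tested on one element, compared with those of constant data. -/
theorem norm_test_interior_sub_le {V V' : M.NodalField} {K : M.Elem}
    (hV : ∀ i, V (M.vertex K i) ∈ eos.admissible n)
    (hsum : ∑ i, R.interior eos V V' K i = 0) {P : ℝ} (hP : ∀ i, ‖R.conserved V V' K i‖ ≤ P)
    (c : State n) {η : ℝ} (hη : ∀ x ∈ M.cell K, fluxDist eos (M.interp V K x) c ≤ η)
    (a : Fin (n + 2) → ℝ) {A : ℝ} (hA : ∀ i, |a i - a 0| ≤ A) :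
    ‖∑ i, a i • R.interior eos V V' K i - (((n + 1).factorial : ℝ))⁻¹ •
        eulerFlux eos c (∑ i, (a i - a 0) • faceNormal (M.simplex K) i)‖ ≤
      (n + 2) * (A * (P +
        (n + 2) * ((n + 1) * (n + 1).factorial) * Metric.diam (M.cell K) ^ n * η)) := by
  have e : ∑ i, a i • R.interior eos V V' K i - (((n + 1).factorial : ℝ))⁻¹ •
        eulerFlux eos c (∑ i, (a i - a 0) • faceNormal (M.simplex K) i) =
      ∑ i, (a i - a 0) • (R.conserved V V' K i - (M.weightedFlux eos V K i +
        (((n + 1).factorial : ℝ))⁻¹ • eulerFlux eos c (faceNormal (M.simplex K) i))) := by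
    -- The interior residuals sum to zero, so `a 0` may be subtracted. This gains the factor `h`
    -- from the smoothness of the test function.
    have e1 : ∑ i, a i • R.interior eos V V' K i =
        ∑ i, (a i - a 0) • R.interior eos V V' K i := by
      simp only [sub_smul, Finset.sum_sub_distrib, ← Finset.smul_sum, hsum, smul_zero, sub_zero]
    rw [e1, ← eulerFluxLin_apply, map_sum, Finset.smul_sum, ← Finset.sum_sub_distrib]
    refine Finset.sum_congr rfl fun i _ => ?_
    rw [map_smul, eulerFluxLin_apply, interior]
    module
  rw [e]
  refine (norm_sum_le _ _).trans ((Finset.sum_le_card_nsmul _ _ (A * (P +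
        (n + 2) * ((n + 1) * (n + 1).factorial) * Metric.diam (M.cell K) ^ n * η))
        fun i _ => ?_).trans ?_)
  · rw [norm_smul, Real.norm_eq_abs]
    refine mul_le_mul (hA i) ?_ (norm_nonneg _) ((abs_nonneg _).trans (hA i))
    exact (norm_sub_le _ _).trans (add_le_add (hP i) (M.norm_weightedFlux_add_le eos hV c hη i))
  · simp

end Residuals

theorem norm_sum_smul_normal_le {Ω : Set (Pt n)} (M : Mesh n Ω) (K : M.Elem)
    (a : Fin (n + 2) → ℝ) {A : ℝ} (hA : ∀ i, |a i| ≤ A) :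
    ‖∑ i, a i • faceNormal (M.simplex K) i‖ ≤
      (n + 2) * (A * ((n + 1) * (n + 1).factorial * Metric.diam (M.cell K) ^ n)) := by
  refine (norm_sum_le _ _).trans ((Finset.sum_le_card_nsmul _ _ (A * ((n + 1) *
    (n + 1).factorial * Metric.diam (M.cell K) ^ n)) fun i _ => ?_).trans (by simp))
  rw [norm_smul, Real.norm_eq_abs]
  exact mul_le_mul (hA i) (M.norm_normal_le K i) (norm_nonneg _) ((abs_nonneg _).trans (hA i))

/-- The normals reproduce the gradient of a linear function from its nodal values. -/
theorem sum_inner_smul_faceNormal {Ω : Set (Pt n)} (M : Mesh n Ω) (K : M.Elem) (w : Pt n) :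
    ∑ i, (inner ℝ w (M.simplex K i - M.simplex K 0)) • faceNormal (M.simplex K) i =
      -(((n + 1).factorial * volume.real (M.cell K)) • w) := by
  refine ext_inner_right ℝ fun v => ?_
  rw [sum_inner, inner_neg_left, inner_smul_left]
  have h := congrArg (fun y => inner ℝ w y)
    (sum_coordLin_smul_sub (M.simplex K) v (M.simplex K 0))
  simp only [inner_sum, inner_smul_right] at h
  rw [← h]
  simp only [inner_smul_left, inner_faceNormal, Finset.mul_sum]
  rw [← Finset.sum_neg_distrib]
  refine Finset.sum_congr rfl fun i _ => ?_
  simp only [Mesh.cell]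
  simp
  ring

end

section

variable {n : ℕ}

/-! ### Bounds and limits of the test densities -/

theorem tendsto_zero_of_eventually_norm_le {E : Type*} [NormedAddCommGroup E] {f : ℕ → E} {C : ℝ}
    (h : ∀ ε > 0, ∀ᶠ m in atTop, ‖f m‖ ≤ C * ε) : Tendsto f atTop (𝓝 0) := by
  refine squeeze_zero_norm' (a := fun m => ‖f m‖) (Eventually.of_forall fun _ => le_rfl) ?_
  refine Metric.tendsto_atTop.2 fun δ hδ => ?_
  have hC : 0 < |C| + 1 := by positivity
  obtain ⟨m₀, hm⟩ := eventually_atTop.1 (h (δ / 2 / (|C| + 1)) (by positivity))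
  refine ⟨m₀, fun m hmm => ?_⟩
  rw [Real.dist_eq, sub_zero, abs_norm]
  refine (hm m hmm).trans_lt ?_
  have : C * (δ / 2 / (|C| + 1)) ≤ (|C| + 1) * (δ / 2 / (|C| + 1)) :=
    mul_le_mul_of_nonneg_right ((le_abs_self C).trans (by linarith)) (by positivity)
  rw [mul_div_cancel₀ _ hC.ne'] at this
  linarith

theorem inv_factorial_le_one (k : ℕ) : ((k.factorial : ℝ))⁻¹ ≤ 1 :=
  inv_le_one_of_one_le₀ (by exact_mod_cast k.factorial_pos)

/-- The norm of the flux tensor. -/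
def fluxNorm (eos : EquationOfState) (U : State n) : ℝ :=
  ∑ a, ‖eulerFlux eos U (EuclideanSpace.single a 1)‖

theorem fluxDist_le (eos : EquationOfState) (U c : State n) :
    fluxDist eos U c ≤ fluxNorm eos U + fluxNorm eos c := by
  rw [fluxNorm, fluxNorm, ← Finset.sum_add_distrib]
  exact Finset.sum_le_sum fun a _ => norm_sub_le _ _

theorem norm_eulerFlux_le (eos : EquationOfState) (U : State n) (ν : Pt n) :
    ‖eulerFlux eos U ν‖ ≤ fluxNorm eos U * ‖ν‖ := by
  conv_lhs => rw [← sum_smul_single ν]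
  rw [← eulerFluxLin_apply, map_sum, fluxNorm, Finset.sum_mul]
  refine (norm_sum_le _ _).trans (Finset.sum_le_sum fun a _ => ?_)
  rw [map_smul, eulerFluxLin_apply, norm_smul, mul_comm]
  gcongr
  exact PiLp.norm_apply_le ν a

/-- The flux is bounded on the interpolants of data in a compact set. -/
theorem exists_fluxNorm_interp_le (eos : EquationOfState) {Q : Set (State n)} (hQ : IsCompact Q)
    (hQa : Q ⊆ eos.admissible n) :
    ∃ B : ℝ, 0 ≤ B ∧ ∀ {Ω : Set (Pt n)} (M : Mesh n Ω) (V : M.NodalField) (K : M.Elem),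
      (∀ i, V (M.vertex K i) ∈ Q) → ∀ x ∈ M.cell K, fluxNorm eos (M.interp V K x) ≤ B := by
  -- Interpolation may leave `Q`, but its values are convex combinations of `n + 2` points of `Q`,
  -- and these form a compact set of admissible states.
  let Φ : (Fin (n + 2) → ℝ) × (Fin (n + 2) → State n) → State n := fun q => ∑ i, q.1 i • q.2 i
  have hΦ : Continuous Φ := by fun_prop
  let A : Set ((Fin (n + 2) → ℝ) × (Fin (n + 2) → State n)) :=
    stdSimplex ℝ (Fin (n + 2)) ×ˢ Set.univ.pi fun _ => Q
  have hA : IsCompact A := (isCompact_stdSimplex ℝ _).prod (isCompact_univ_pi fun _ => hQ)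
  have hmaps : ∀ q ∈ A, Φ q ∈ eos.admissible n := by
    rintro ⟨w, v⟩ ⟨hw, hv⟩
    exact (eos.convex_admissible n).sum_mem (fun i _ => hw.1 i) hw.2
      fun i _ => hQa (hv i (mem_univ i))
  have hcont : ContinuousOn (fun q => fluxNorm eos (Φ q)) A := by
    unfold fluxNorm
    refine continuousOn_finsetSum _ fun a _ => ContinuousOn.norm ?_
    exact (continuousOn_eulerFlux eos _).comp hΦ.continuousOn hmaps
  obtain ⟨B, hB⟩ := hA.exists_bound_of_continuousOn hcont
  refine ⟨|B|, abs_nonneg B, fun M V K hV x hx => ?_⟩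
  have h := hB (fun i => (M.simplex K).coord i x, fun i => V (M.vertex K i))
    ⟨⟨fun i => (M.coord_mem_Icc hx i).1, (M.simplex K).sum_coord_apply_eq_one x⟩, fun i _ => hV i⟩
  exact (le_abs_self _).trans (h.trans (le_abs_self B))

namespace Residuals

variable {Ω : Set (Pt n)} {M : Mesh n Ω} {R : Residuals M} {eos : EquationOfState}

/-- This is the majorant for dominated convergence. Differences of φ on the cell are at most L h and
the residuals and normals are O(h^n); shape regularity absorbs h^(n+1) into the cell volume. The
term 2B bounds the distance of two fluxes of size at most B. -/
theorem norm_testDensity_le {φ : ℝ × Pt n → ℝ} {L : ℝ} (hL0 : 0 ≤ L)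
    (hL : ∀ a b, |φ a - φ b| ≤ L * dist a b) {c₀ : ℝ} (hc₀ : 0 < c₀) {K : M.Elem}
    (hreg : c₀ * Metric.diam (M.cell K) ^ (n + 1) ≤ volume.real (M.cell K))
    {dt : ℝ} (hdt : 0 < dt) {U : ℕ → M.NodalField} {j : ℕ}
    (hV : ∀ i, U j (M.vertex K i) ∈ eos.admissible n)
    (hsum : ∑ i, R.interior eos (U j) (U (j + 1)) K i = 0) {P : ℝ} (hP0 : 0 ≤ P)
    (hP : ∀ i, ‖R.conserved (U j) (U (j + 1)) K i‖ ≤ P * Metric.diam (M.cell K) ^ n)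
    {B : ℝ} (hB0 : 0 ≤ B) (hB : ∀ x ∈ M.cell K, fluxNorm eos (M.interp (U j) K x) ≤ B)
    {BW : ℝ} (hBW : ∀ i, ‖EulerRD.conserved (U j (M.vertex K i))‖ ≤ BW) :
    ‖R.testDensity eos dt φ U j K‖ ≤ L * BW + c₀⁻¹ * ((n + 2) * (L * (P +
        (n + 2) * ((n + 1) * (n + 1).factorial) * (2 * B))) +
        B * ((n + 2) * (L * ((n + 1) * (n + 1).factorial)))) := by
  set h := Metric.diam (M.cell K) with hh
  have hpos : 0 < h := M.diam_cell_pos K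
  have hK := M.volume_real_cell_pos K
  set c := U j (M.vertex K 0) with hc
  have hcB : fluxNorm eos c ≤ B := by
    have := hB _ (M.vertex_mem_cell K 0)
    rwa [M.interp_vertex] at this
  have hA : ∀ i, |φ ((j + 1 : ℕ) * dt, M.simplex K i) - φ ((j + 1 : ℕ) * dt, M.simplex K 0)| ≤
      L * h := by
    intro i
    refine (hL _ _).trans (mul_le_mul_of_nonneg_left ?_ hL0)
    rw [Prod.dist_eq, dist_self, max_eq_right dist_nonneg]
    exact M.dist_vertex_le_diam K i 0
  have h1 := norm_test_interior_sub_le hV hsum hP c (η := 2 * B)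
    (fun x hx => (fluxDist_le eos _ c).trans (by linarith [hB x hx]))
    (fun i => φ ((j + 1 : ℕ) * dt, M.simplex K i)) hA
  have h2 : ‖(((n + 1).factorial : ℝ))⁻¹ • eulerFlux eos c (∑ i,
      (φ ((j + 1 : ℕ) * dt, M.simplex K i) - φ ((j + 1 : ℕ) * dt, M.simplex K 0)) •
        faceNormal (M.simplex K) i)‖ ≤
      B * ((n + 2) * (L * h * ((n + 1) * (n + 1).factorial * h ^ n))) := by
    rw [norm_smul]
    refine (mul_le_of_le_one_left (norm_nonneg _) ?_).trans ((norm_eulerFlux_le eos c _).trans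
      (mul_le_mul hcB (norm_sum_smul_normal_le M K _ hA) (norm_nonneg _) hB0))
    rw [Real.norm_of_nonneg (by positivity)]
    exact inv_factorial_le_one (n + 1)
  have h3 : ‖∑ i, φ ((j + 1 : ℕ) * dt, M.simplex K i) •
      R.interior eos (U j) (U (j + 1)) K i‖ ≤ h ^ (n + 1) * ((n + 2) * (L * (P +
        (n + 2) * ((n + 1) * (n + 1).factorial) * (2 * B))) +
        B * ((n + 2) * (L * ((n + 1) * (n + 1).factorial)))) := by
    refine (norm_le_norm_sub_add _ ((((n + 1).factorial : ℝ))⁻¹ • eulerFlux eos c (∑ i,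
      (φ ((j + 1 : ℕ) * dt, M.simplex K i) - φ ((j + 1 : ℕ) * dt, M.simplex K 0)) •
        faceNormal (M.simplex K) i))).trans ((add_le_add h1 h2).trans (le_of_eq ?_))
    rw [← hh]
    ring
  have hq : (volume.real (M.cell K))⁻¹ * h ^ (n + 1) ≤ c₀⁻¹ := by
    rw [inv_mul_le_iff₀ hK, ← div_eq_mul_inv, le_div_iff₀ hc₀, mul_comm]
    exact hreg
  have h4 : ‖((n + 2 : ℝ)⁻¹) • ∑ i,
      ((φ ((j + 1 : ℕ) * dt, M.simplex K i) - φ (j * dt, M.simplex K i)) / dt) •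
      EulerRD.conserved (U j (M.vertex K i))‖ ≤ L * BW := by
    rw [norm_smul, Real.norm_of_nonneg (by positivity), inv_mul_le_iff₀ (by positivity)]
    refine (norm_sum_le _ _).trans ((Finset.sum_le_card_nsmul _ _ (L * BW) fun i _ => ?_).trans
      (by simp))
    rw [norm_smul]
    refine mul_le_mul ?_ (hBW i) (norm_nonneg _) hL0
    rw [Real.norm_eq_abs, abs_div, abs_of_pos hdt, div_le_iff₀ hdt]
    refine (hL _ _).trans (mul_le_mul_of_nonneg_left ?_ hL0)
    rw [Prod.dist_eq, dist_self, max_eq_left dist_nonneg, Real.dist_eq]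
    push_cast
    rw [show ((j : ℝ) + 1) * dt - j * dt = dt by ring, abs_of_pos hdt]
  rw [testDensity]
  refine (norm_sub_le _ _).trans (add_le_add h4 ?_)
  rw [norm_smul, Real.norm_of_nonneg (by positivity)]
  refine (mul_le_mul_of_nonneg_left h3 (by positivity)).trans ?_
  rw [← mul_assoc]
  exact mul_le_mul_of_nonneg_right hq (by positivity)

end Residuals

theorem deriv_time_eq {φ : ℝ × Pt n → ℝ} {z : ℝ × Pt n} {φ' : ℝ × Pt n →L[ℝ] ℝ}
    (h : HasFDerivAt φ φ' z) : deriv (fun t => φ (t, z.2)) z.1 = φ' (1, 0) := by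
  have h1 : HasDerivAt (fun t : ℝ => (t, z.2)) ((1 : ℝ), (0 : Pt n)) z.1 :=
    (hasDerivAt_id z.1).prodMk (hasDerivAt_const z.1 z.2)
  exact (HasFDerivAt.comp_hasDerivAt z.1 (f := fun t : ℝ => (t, z.2)) h h1).deriv

theorem inner_gradient_space_eq {φ : ℝ × Pt n → ℝ} {z : ℝ × Pt n} {φ' : ℝ × Pt n →L[ℝ] ℝ}
    (h : HasFDerivAt φ φ' z) (v : Pt n) :
    inner ℝ (gradient (fun x => φ (z.1, x)) z.2) v = φ' (0, v) := by
  have h1 : HasFDerivAt (fun x : Pt n => (z.1, x)) (ContinuousLinearMap.inr ℝ ℝ (Pt n)) z.2 :=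
    hasFDerivAt_prodMk_right z.1 z.2
  have h2 := (HasFDerivAt.comp z.2 (f := fun x : Pt n => (z.1, x)) h h1).fderiv
  rw [gradient, InnerProductSpace.toDual_symm_apply]
  change fderiv ℝ (φ ∘ fun x => (z.1, x)) z.2 v = _
  rw [h2]
  rfl

theorem continuous_eulerFluxLin (eos : EquationOfState) (c : State n) :
    Continuous (eulerFlux eos c) := (eulerFluxLin eos c).continuous_of_finiteDimensional

/-- The test densities of almost constant data on shrinking space-time cells converge to the
integrand of the weak form. -/
theorem tendsto_testDensity {Ω : Set (Pt n)} {eos : EquationOfState} {M : ℕ → Mesh n Ω}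
    {R : ∀ m, Residuals (M m)} {φ : ℝ × Pt n → ℝ} (hφ : ContDiff ℝ ∞ φ) {L : ℝ} (hL0 : 0 ≤ L)
    (hL : ∀ a b, |φ a - φ b| ≤ L * dist a b) {c₀ : ℝ} (hc₀ : 0 < c₀) {K : ∀ m, (M m).Elem}
    (hreg : ∀ m, c₀ * Metric.diam ((M m).cell (K m)) ^ (n + 1) ≤ volume.real ((M m).cell (K m)))
    {dt : ℕ → ℝ} (hdt : ∀ m, 0 < dt m) (hdt0 : Tendsto dt atTop (𝓝 0))
    {U : ∀ m, ℕ → (M m).NodalField} {j : ℕ → ℕ}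
    (hV : ∀ m i, U m (j m) ((M m).vertex (K m) i) ∈ eos.admissible n)
    (hsum : ∀ m, ∑ i, (R m).interior eos (U m (j m)) (U m (j m + 1)) (K m) i = 0)
    {P : ℝ} (hP0 : 0 ≤ P)
    (hP : ∀ m i, ‖(R m).conserved (U m (j m)) (U m (j m + 1)) (K m) i‖ ≤
      P * Metric.diam ((M m).cell (K m)) ^ n * (M m).variation (U m (j m)) (K m))
    {z : ℝ × Pt n} (hz : ∀ m, z.2 ∈ (M m).cell (K m))
    (hdiam : Tendsto (fun m => Metric.diam ((M m).cell (K m))) atTop (𝓝 0))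
    (hj : Tendsto (fun m => (j m : ℝ) * dt m) atTop (𝓝 z.1))
    {c : State n} (hc : c ∈ eos.admissible n)
    (hlim : ∀ i, Tendsto (fun m => U m (j m) ((M m).vertex (K m) i)) atTop (𝓝 c)) :
    Tendsto (fun m => (R m).testDensity eos (dt m) φ (U m) (j m) (K m)) atTop
      (𝓝 (deriv (fun t => φ (t, z.2)) z.1 • conserved c
        + eulerFlux eos c (gradient (fun x => φ (z.1, x)) z.2))) := by
  set h : ℕ → ℝ := fun m => Metric.diam ((M m).cell (K m)) with hh
  have hpos : ∀ m, 0 < h m := fun m => (M m).diam_cell_pos (K m)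
  have hK : ∀ m, 0 < volume.real ((M m).cell (K m)) := fun m => (M m).volume_real_cell_pos (K m)
  have hq : ∀ m, (volume.real ((M m).cell (K m)))⁻¹ * h m ^ (n + 1) ≤ c₀⁻¹ := fun m => by
    rw [inv_mul_le_iff₀ (hK m), ← div_eq_mul_inv, le_div_iff₀ hc₀, mul_comm]
    exact hreg m
  -- Both ends of the difference quotients move with `m`, which calls for strict differentiability
  -- at `z`.
  obtain ⟨φ', hφ'⟩ : ∃ φ', HasStrictFDerivAt φ φ' z :=
    ⟨_, hφ.contDiffAt.hasStrictFDerivAt (by simp)⟩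
  have hvert : ∀ i, Tendsto (fun m => (M m).simplex (K m) i) atTop (𝓝 z.2) := fun i =>
    tendsto_iff_dist_tendsto_zero.2 (squeeze_zero (fun _ => dist_nonneg)
      (fun m => Metric.dist_le_diam_of_mem ((M m).isCompact_cell (K m)).isBounded
        ((M m).vertex_mem_cell (K m) i) (hz m)) hdiam)
  have hj1 : Tendsto (fun m => ((j m + 1 : ℕ) : ℝ) * dt m) atTop (𝓝 z.1) := by
    have := hj.add hdt0
    simp only [add_zero] at this
    refine this.congr fun m => ?_
    push_cast; ring
  have hp1 : ∀ i, Tendsto (fun m => (((j m + 1 : ℕ) : ℝ) * dt m, (M m).simplex (K m) i)) atTop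
      (𝓝 z) := fun i => hj1.prodMk_nhds (hvert i)
  have hp0 : ∀ i, Tendsto (fun m => ((j m : ℝ) * dt m, (M m).simplex (K m) i)) atTop
      (𝓝 z) := fun i => hj.prodMk_nhds (hvert i)
  -- the difference quotients in time
  have htime : ∀ i, Tendsto (fun m => (φ (((j m + 1 : ℕ) : ℝ) * dt m, (M m).simplex (K m) i)
      - φ ((j m : ℝ) * dt m, (M m).simplex (K m) i)) / dt m) atTop (𝓝 (φ' (1, 0))) := by
    intro i
    have h1 := hφ'.isLittleO.comp_tendsto ((hp1 i).prodMk_nhds (hp0 i))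
    have hdiff : ∀ m, ((((j m + 1 : ℕ) : ℝ) * dt m, (M m).simplex (K m) i) : ℝ × Pt n)
        - ((j m : ℝ) * dt m, (M m).simplex (K m) i) = dt m • ((1 : ℝ), (0 : Pt n)) := by
      intro m
      ext1
      · simp; ring
      · simp
    have h2 : (fun m => φ (((j m + 1 : ℕ) : ℝ) * dt m, (M m).simplex (K m) i)
        - φ ((j m : ℝ) * dt m, (M m).simplex (K m) i) - dt m * φ' (1, 0)) =o[atTop] dt := by
      refine (h1.congr_left fun m => ?_).trans_isBigO ?_
      · simp only [Function.comp]
        rw [hdiff, map_smul, smul_eq_mul]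
      · refine Asymptotics.IsBigO.of_bound 1 (Eventually.of_forall fun m => ?_)
        simp only [Function.comp]
        rw [hdiff, norm_smul, one_mul]
        refine mul_le_of_le_one_right (norm_nonneg _) ?_
        simp [Prod.norm_def]
    have h3 := h2.tendsto_div_nhds_zero.add_const (φ' (1, 0))
    rw [zero_add] at h3
    refine h3.congr fun m => ?_
    have := (hdt m).ne'
    field_simp
    ring
  have hT : Tendsto (fun m => ((n + 2 : ℝ)⁻¹) • ∑ i,
      ((φ (((j m + 1 : ℕ) : ℝ) * dt m, (M m).simplex (K m) i)
      - φ ((j m : ℝ) * dt m, (M m).simplex (K m) i)) / dt m) •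
      conserved (U m (j m) ((M m).vertex (K m) i))) atTop
      (𝓝 (φ' (1, 0) • conserved c)) := by
    have h1 : ∀ i, Tendsto (fun m => conserved (U m (j m) ((M m).vertex (K m) i))) atTop
        (𝓝 (conserved c)) := fun i =>
      (continuousOn_conserved eos c hc).tendsto.comp
        (tendsto_nhdsWithin_iff.2 ⟨hlim i, Eventually.of_forall fun m => hV m i⟩)
    have h2 := (tendsto_finsetSum (Finset.univ : Finset (Fin (n + 2)))
      fun i _ => (htime i).smul (h1 i)).const_smul ((n + 2 : ℝ)⁻¹)
    convert! h2 using 2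
    simp only [Finset.sum_const, Finset.card_univ, Fintype.card_fin, ← Nat.cast_smul_eq_nsmul ℝ,
      smul_smul]
    congr 1
    push_cast
    field_simp
  -- the flux part
  set a : ∀ m, Fin (n + 2) → ℝ := fun m i =>
    φ (((j m + 1 : ℕ) : ℝ) * dt m, (M m).simplex (K m) i) with ha
  set w := gradient (fun x => φ (z.1, x)) z.2 with hw
  have hAa : ∀ m i, |a m i - a m 0| ≤ L * h m := by
    intro m i
    refine (hL _ _).trans (mul_le_mul_of_nonneg_left ?_ hL0)
    rw [Prod.dist_eq, dist_self, max_eq_right dist_nonneg]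
    exact (M m).dist_vertex_le_diam (K m) i 0
  set κ : ℝ := (((n + 1).factorial : ℝ))⁻¹ with hκ
  set C₁ : ℝ := (n + 1) * (n + 1).factorial with hC₁
  -- For linear nodal values the expression equals the gradient exactly. The Taylor remainder is
  -- o(h), the normals are O(h^n), and division by the volume is harmless by shape regularity.
  have hgrad : Tendsto (fun m => -((κ * (volume.real ((M m).cell (K m)))⁻¹) •
      ∑ i, (a m i - a m 0) • faceNormal ((M m).simplex (K m)) i)) atTop (𝓝 w) := by
    rw [tendsto_iff_norm_sub_tendsto_zero]
    refine tendsto_zero_of_eventually_norm_le (C := (n + 2) * C₁ * c₀⁻¹) fun ε hε => ?_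
    have hsmall : ∀ i, ∀ᶠ m in atTop, |a m i - a m 0 -
        inner ℝ w ((M m).simplex (K m) i - (M m).simplex (K m) 0)| ≤ ε * h m := by
      intro i
      have h1 := (hφ'.isLittleO.comp_tendsto ((hp1 i).prodMk_nhds (hp1 0))).def hε
      filter_upwards [h1] with m hm
      simp only [Function.comp, Prod.mk_sub_mk, sub_self] at hm
      rw [hw, inner_gradient_space_eq hφ'.hasFDerivAt, ← Real.norm_eq_abs]
      refine hm.trans (mul_le_mul_of_nonneg_left ?_ hε.le)
      rw [Prod.norm_def, norm_zero, max_eq_right (norm_nonneg _), ← dist_eq_norm]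
      exact (M m).dist_vertex_le_diam (K m) i 0
    filter_upwards [eventually_all.2 hsmall] with m hm
    have e : -((κ * (volume.real ((M m).cell (K m)))⁻¹) •
        ∑ i, (a m i - a m 0) • faceNormal ((M m).simplex (K m)) i) - w =
        -((κ * (volume.real ((M m).cell (K m)))⁻¹) • ∑ i, (a m i - a m 0 -
          inner ℝ w ((M m).simplex (K m) i - (M m).simplex (K m) 0)) •
          faceNormal ((M m).simplex (K m)) i) := by
      simp only [sub_smul _ (inner ℝ w _ : ℝ), Finset.sum_sub_distrib,
        sum_inner_smul_faceNormal, smul_sub, smul_neg, smul_smul]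
      have : κ * (volume.real ((M m).cell (K m)))⁻¹ *
          ((n + 1).factorial * volume.real ((M m).cell (K m))) = 1 := by
        have := (hK m).ne'
        rw [hκ]
        field_simp
      rw [this]
      module
    rw [e, norm_norm, norm_neg, norm_smul, Real.norm_of_nonneg
      (mul_nonneg (by positivity) (inv_nonneg.2 (hK m).le))]
    have hb := norm_sum_smul_normal_le (M m) (K m) _ hm
    have hκ1 : κ ≤ 1 := inv_factorial_le_one (n + 1)
    have hKi := inv_nonneg.2 (hK m).le
    calc _ ≤ (1 * (volume.real ((M m).cell (K m)))⁻¹) *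
          ((n + 2) * (ε * h m * (C₁ * h m ^ n))) := by
          refine mul_le_mul (mul_le_mul_of_nonneg_right hκ1 hKi) ?_ (norm_nonneg _)
            (by positivity)
          exact hb
      _ = ((volume.real ((M m).cell (K m)))⁻¹ * h m ^ (n + 1)) * ((n + 2) * C₁ * ε) := by ring
      _ ≤ c₀⁻¹ * ((n + 2) * C₁ * ε) :=
          mul_le_mul_of_nonneg_right (hq m) (by positivity)
      _ = _ := by ring
  have hvar : Tendsto (fun m => (M m).variation (U m (j m)) (K m)) atTop (𝓝 0) := by
    have : Tendsto (fun m => (M m).variation (U m (j m)) (K m)) atTop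
        (𝓝 (∑ _a : Fin (n + 2), ∑ _b : Fin (n + 2), ‖c - c‖)) :=
      tendsto_finsetSum _ fun a _ => tendsto_finsetSum _ fun b _ =>
        ((hlim a).sub (hlim b)).norm
    simpa using this
  have hflux : ∀ ε > 0, ∀ᶠ m in atTop, ∀ x ∈ (M m).cell (K m),
      fluxDist eos ((M m).interp (U m (j m)) (K m) x) c ≤ ε := by
    intro ε hε
    have h1 := continuousOn_fluxDist (n := n) eos c c hc
    have h2 : fluxDist eos c c = 0 := by simp [fluxDist]
    obtain ⟨δ, hδ, hδε⟩ := Metric.continuousWithinAt_iff.1 h1 ε hε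
    have h3 : ∀ i, ∀ᶠ m in atTop, U m (j m) ((M m).vertex (K m) i) ∈ Metric.ball c δ := fun i =>
      (hlim i).eventually (Metric.ball_mem_nhds c hδ)
    filter_upwards [eventually_all.2 h3] with m hm x hx
    have h4 := (M m).interp_mem_of_convex (eos.convex_admissible n) (hV m) hx
    have h5 := (M m).interp_mem_of_convex (convex_ball c δ) hm hx
    have h6 := hδε h4 h5
    rw [h2, Real.dist_eq, sub_zero] at h6
    exact (le_abs_self _).trans h6.le
  -- The error of replacing the data by the constant state `c`: the residuals are small with the
  -- variation and the weighted fluxes with the flux distance, both of which tend to zero.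
  have hrest : Tendsto (fun m => (volume.real ((M m).cell (K m)))⁻¹ • (∑ i, a m i •
      (R m).interior eos (U m (j m)) (U m (j m + 1)) (K m) i - κ • eulerFlux eos c
        (∑ i, (a m i - a m 0) • faceNormal ((M m).simplex (K m)) i))) atTop (𝓝 0) := by
    refine tendsto_zero_of_eventually_norm_le
      (C := c₀⁻¹ * ((n + 2) * (L * (P + (n + 2) * C₁)))) fun ε hε => ?_
    filter_upwards [hflux ε hε, hvar.eventually_le_const hε] with m hm1 hm2
    have hb := Residuals.norm_test_interior_sub_le (hV m) (hsum m) (P := P * h m ^ n * ε)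
      (fun i => (hP m i).trans (mul_le_mul_of_nonneg_left hm2
        (mul_nonneg hP0 (pow_nonneg (hpos m).le n)))) c hm1 (a m) (hAa m)
    have hKi := inv_nonneg.2 (hK m).le
    rw [norm_smul, Real.norm_of_nonneg hKi]
    calc _ ≤ (volume.real ((M m).cell (K m)))⁻¹ * ((n + 2) * (L * h m * (P * h m ^ n * ε +
          (n + 2) * C₁ * h m ^ n * ε))) := mul_le_mul_of_nonneg_left hb hKi
      _ = ((volume.real ((M m).cell (K m)))⁻¹ * h m ^ (n + 1)) *
          ((n + 2) * (L * (P + (n + 2) * C₁)) * ε) := by ring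
      _ ≤ c₀⁻¹ * ((n + 2) * (L * (P + (n + 2) * C₁)) * ε) :=
          mul_le_mul_of_nonneg_right (hq m) (by positivity)
      _ = _ := by ring
  have hF := ((continuous_eulerFluxLin eos c).tendsto w).comp hgrad
  have hall := (hT.add hF).sub hrest
  rw [sub_zero] at hall
  rw [deriv_time_eq hφ'.hasFDerivAt]
  refine hall.congr fun m => ?_
  simp only [Function.comp, Residuals.testDensity]
  have e : eulerFlux eos c (-((κ * (volume.real ((M m).cell (K m)))⁻¹) •
      ∑ i, (a m i - a m 0) • faceNormal ((M m).simplex (K m)) i)) =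
      -((volume.real ((M m).cell (K m)))⁻¹ • κ • eulerFlux eos c
        (∑ i, (a m i - a m 0) • faceNormal ((M m).simplex (K m)) i)) := by
    rw [← eulerFluxLin_apply, map_neg, map_smul, eulerFluxLin_apply, smul_smul, mul_comm]
  rw [e]
  module

end

section

variable {n : ℕ}

/-! ### Dominated convergence for cellwise constant functions -/

theorem sum_indicator_of_mem {X ι E : Type*} [AddCommMonoid E] {A : Finset ι} {s : ι → Set X}
    (hd : Pairwise (Function.onFun Disjoint s)) (c : ι → E) {i : ι} (hi : i ∈ A) {x : X}
    (hx : x ∈ s i) : ∑ i ∈ A, (s i).indicator (fun _ => c i) x = c i := by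
  rw [Finset.sum_eq_single i]
  · rw [indicator_of_mem hx]
  · intro j _ hj
    exact indicator_of_notMem (fun hxj => Set.disjoint_left.1 (hd hj) hxj hx) _
  · exact fun h => absurd hi h

/-- The weighted sum is the integral of a step function. Its support lies eventually in the set `B`
of finite measure, on which it is bounded by `C`; since `B` is almost contained in `D`, integrating
over `D` loses nothing. -/
theorem tendsto_sum_cells {X E : Type*} [MeasurableSpace X] {μ : Measure X} [NormedAddCommGroup E]
    [NormedSpace ℝ E] [CompleteSpace E] {ι : ℕ → Type*} {A : ∀ k, Finset (ι k)}
    {s : ∀ k, ι k → Set X} (hs : ∀ k i, MeasurableSet (s k i)) (hfin : ∀ k i, μ (s k i) ≠ ⊤)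
    (hd : ∀ k, Pairwise (Function.onFun Disjoint (s k))) {c : ∀ k, ι k → E} {B D : Set X}
    (hB : MeasurableSet B) (hBfin : μ B ≠ ⊤) (hBD : B ≤ᵐ[μ] D) {C : ℝ}
    (hsub : ∀ᶠ k in atTop, ∀ i ∈ A k, c k i ≠ 0 → s k i ⊆ B ∧ ‖c k i‖ ≤ C) {g : X → E}
    (hlim : ∀ᵐ x ∂μ.restrict D,
      Tendsto (fun k => ∑ i ∈ A k, (s k i).indicator (fun _ => c k i) x) atTop (𝓝 (g x))) :
    Tendsto (fun k => ∑ i ∈ A k, μ.real (s k i) • c k i) atTop (𝓝 (∫ x in D, g x ∂μ)) := by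
  classical
  set G : ∀ _ : ℕ, X → E := fun k x => ∑ i ∈ A k, (s k i).indicator (fun _ => c k i) x with hG
  have hint : ∀ k, ∫ x, G k x ∂μ = ∑ i ∈ A k, μ.real (s k i) • c k i := by
    intro k
    rw [integral_finsetSum _ fun i _ =>
      (integrable_indicator_iff (hs k i)).2 (integrableOn_const (hfin k i))]
    exact Finset.sum_congr rfl fun i _ => integral_indicator_const _ (hs k i)
  have hGm : ∀ k, StronglyMeasurable (G k) := fun k =>
    Finset.stronglyMeasurable_fun_sum _ fun i _ => stronglyMeasurable_const.indicator (hs k i)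
  have hzero : ∀ᶠ k in atTop, ∀ x, (x ∉ B → G k x = 0) ∧ ‖G k x‖ ≤ B.indicator (fun _ => |C|) x := by
    filter_upwards [hsub] with k hk x
    by_cases h : ∃ i ∈ A k, x ∈ s k i ∧ c k i ≠ 0
    · obtain ⟨i, hi, hx, hc⟩ := h
      obtain ⟨h1, h2⟩ := hk i hi hc
      have e : G k x = c k i := sum_indicator_of_mem (hd k) (c k) hi hx
      refine ⟨fun hxB => absurd (h1 hx) hxB, ?_⟩
      rw [e, indicator_of_mem (h1 hx)]
      exact h2.trans (le_abs_self C)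
    · push Not at h
      have e : G k x = 0 := Finset.sum_eq_zero fun i hi => by
        by_cases hx : x ∈ s k i
        · rw [indicator_of_mem hx, h i hi hx]
        · exact indicator_of_notMem hx _
      refine ⟨fun _ => e, ?_⟩
      rw [e, norm_zero]
      exact indicator_nonneg (fun _ _ => abs_nonneg C) x
  have hD : ∀ᶠ k in atTop, ∫ x in D, G k x ∂μ = ∑ i ∈ A k, μ.real (s k i) • c k i := by
    filter_upwards [hzero] with k hk
    rw [← hint k]
    refine setIntegral_eq_integral_of_ae_compl_eq_zero ?_
    filter_upwards [hBD] with x hx hxD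
    exact (hk x).1 fun hxB => hxD (hx hxB)
  refine Tendsto.congr' hD ?_
  refine tendsto_integral_filter_of_dominated_convergence (B.indicator fun _ => |C|)
    (Eventually.of_forall fun k => (hGm k).aestronglyMeasurable)
    (hzero.mono fun k hk => Eventually.of_forall fun x => (hk x).2) ?_ hlim
  exact ((integrable_indicator_iff hB).2 (integrableOn_const hBfin)).restrict

namespace Mesh

variable {Ω : Set (Pt n)} (M : Mesh n Ω)

/-- The elements meeting a compact set. -/
def near {S : Set (Pt n)} (hS : IsCompact S) : Finset M.Elem := (M.finite_cells_inter hS).toFinset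

theorem mem_near {S : Set (Pt n)} (hS : IsCompact S) {K : M.Elem} :
    K ∈ M.near hS ↔ (M.cell K ∩ S).Nonempty := by
  rw [near, Finite.mem_toFinset]; rfl

theorem mem_near_of_vertex {S : Set (Pt n)} (hS : IsCompact S) {K : M.Elem} {i : Fin (n + 2)}
    (h : M.simplex K i ∈ S) : K ∈ M.near hS :=
  (M.mem_near hS).2 ⟨_, M.vertex_mem_cell K i, h⟩

theorem volume_real_interior (K : M.Elem) :
    volume.real (interior (M.cell K)) = volume.real (M.cell K) :=
  measureReal_congr (M.interior_ae_eq_cell K)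

/-- The nodal quadrature of `ψ • conserved V`. -/
def nodalSum {S : Set (Pt n)} (hS : IsCompact S) (ψ : Pt n → ℝ) (V : M.NodalField) : Cons n :=
  ∑ K ∈ M.near hS, (volume.real (M.cell K)) • ((n + 2 : ℝ)⁻¹ •
        ∑ i, ψ (M.simplex K i) • EulerRD.conserved (V (M.vertex K i)))

end Mesh

/-- The nodal quadratures converge if the nodal values do. -/
theorem tendsto_nodalSum {Ω : Set (Pt n)} (hΩ : IsOpen Ω) {eos : EquationOfState}
    {M : ℕ → Mesh n Ω} (hsize : MeshSizeTendsToZero M) {Q : Set (State n)} (hQ : IsCompact Q)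
    (hQa : Q ⊆ eos.admissible n) {V : ∀ k, (M k).NodalField} (hV : ∀ k σ, V k σ ∈ Q)
    {u : Pt n → State n} (hu : ∀ᵐ x ∂volume.restrict Ω, u x ∈ Q)
    (hlim : ∀ᵐ x ∂volume.restrict Ω, ∀ ε > 0, ∀ᶠ k in atTop, ∀ K,
      x ∈ interior ((M k).cell K) → ∀ i, ‖V k ((M k).vertex K i) - u x‖ < ε)
    {S : Set (Pt n)} (hS : IsCompact S) (hSΩ : S ⊆ Ω) {ψ : Pt n → ℝ} (hψ : Continuous ψ)
    (hψS : ∀ x ∉ S, ψ x = 0) :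
    Tendsto (fun k => (M k).nodalSum hS ψ (V k)) atTop
      (𝓝 (∫ x in Ω, ψ x • conserved (u x))) := by
  obtain ⟨δ, hδ, hδΩ⟩ := hS.exists_cthickening_subset_open hΩ hSΩ
  have hX : IsCompact (Metric.cthickening δ S) := hS.cthickening
  obtain ⟨BW, hBW⟩ := hQ.exists_bound_of_continuousOn ((continuousOn_conserved eos).mono hQa)
  obtain ⟨Bψ, hBψ⟩ := hS.exists_bound_of_continuousOn hψ.continuousOn
  have hBψ' : ∀ x, ‖ψ x‖ ≤ |Bψ| := by
    intro x
    by_cases hx : x ∈ S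
    · exact (hBψ x hx).trans (le_abs_self _)
    · rw [hψS x hx, norm_zero]; exact abs_nonneg _
  have key := tendsto_sum_cells (μ := (volume : Measure (Pt n))) (A := fun k => (M k).near hS)
    (s := fun k K => interior ((M k).cell K))
    (c := fun k K => (n + 2 : ℝ)⁻¹ • ∑ i, ψ ((M k).simplex K i) •
      conserved (V k ((M k).vertex K i)))
    (B := Metric.cthickening δ S) (D := Ω) (C := |Bψ| * |BW|) (g := fun x => ψ x • conserved (u x))
    (fun k K => isOpen_interior.measurableSet)
    (fun k K => ((measure_mono interior_subset).trans_lt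
      ((M k).isCompact_cell K).measure_lt_top).ne)
    (fun k => (M k).pairwise_disjoint_interior) hX.isClosed.measurableSet hX.measure_lt_top.ne
    (Eventually.of_forall fun x hx => hδΩ hx) ?_ ?_
  · simpa only [Mesh.volume_real_interior, Mesh.nodalSum] using key
  · filter_upwards [hsize δ hδ] with k hk K hK _
    refine ⟨interior_subset.trans (mem_cthickening_of_cell (hk K) (((M k).mem_near hS).1 hK)), ?_⟩
    rw [norm_smul, Real.norm_of_nonneg (by positivity), inv_mul_le_iff₀ (by positivity)]
    refine (norm_sum_le _ _).trans ((Finset.sum_le_card_nsmul _ _ (|Bψ| * |BW|)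
      fun i _ => ?_).trans (by simp))
    rw [norm_smul]
    exact mul_le_mul (hBψ' _) ((hBW _ (hV k _)).trans (le_abs_self _)) (norm_nonneg _)
      (abs_nonneg _)
  · have hcell : ∀ᵐ x ∂volume.restrict Ω, ∀ k, ∃ K, x ∈ interior ((M k).cell K) := by
      refine ae_all_iff.2 fun k => ?_
      rw [ae_restrict_iff' hΩ.measurableSet]
      filter_upwards [(M k).ae_mem_interior_cell] with x hx hxΩ using hx (subset_closure hxΩ)
    filter_upwards [hu, hlim, hcell] with x hxQ hx hxc
    choose K hK using hxc
    have hdiam : Tendsto (fun k => Metric.diam ((M k).cell (K k))) atTop (𝓝 0) := by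
      refine tendsto_zero_of_eventually_norm_le (C := 1) fun ε hε => ?_
      filter_upwards [hsize ε hε] with k hk
      rw [one_mul, Real.norm_of_nonneg Metric.diam_nonneg]
      exact hk _
    have hvert : ∀ i, Tendsto (fun k => (M k).simplex (K k) i) atTop (𝓝 x) := fun i =>
      tendsto_iff_dist_tendsto_zero.2 (squeeze_zero (fun _ => dist_nonneg)
        (fun k => Metric.dist_le_diam_of_mem ((M k).isCompact_cell (K k)).isBounded
          ((M k).vertex_mem_cell (K k) i) (interior_subset (hK k))) hdiam)
    have hval : ∀ i, Tendsto (fun k => V k ((M k).vertex (K k) i)) atTop (𝓝 (u x)) := fun i => by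
      refine Metric.tendsto_nhds.2 fun ε hε => ?_
      filter_upwards [hx ε hε] with k hk
      rw [dist_eq_norm]
      exact hk _ (hK k) i
    have hW : ∀ i, Tendsto (fun k => conserved (V k ((M k).vertex (K k) i))) atTop
        (𝓝 (conserved (u x))) := fun i =>
      (continuousOn_conserved eos _ (hQa hxQ)).tendsto.comp
        (tendsto_nhdsWithin_iff.2 ⟨hval i, Eventually.of_forall fun k => hQa (hV k _)⟩)
    have h2 := (tendsto_finsetSum (Finset.univ : Finset (Fin (n + 2)))
      fun i _ => (((hψ.tendsto x).comp (hvert i))).smul (hW i)).const_smul ((n + 2 : ℝ)⁻¹)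
    have e : (n + 2 : ℝ)⁻¹ • ∑ _i : Fin (n + 2), ψ x • conserved (u x) = ψ x • conserved (u x) := by
      simp only [Finset.sum_const, Finset.card_univ, Fintype.card_fin, ← Nat.cast_smul_eq_nsmul ℝ,
        smul_smul]
      congr 1
      push_cast
      field_simp
    rw [e] at h2
    refine h2.congr fun k => ?_
    -- If the cell at `x` misses `S`, then ψ vanishes at its vertices, and the step function
    -- vanishes at `x` as well.
    by_cases hKn : K k ∈ (M k).near hS
    · exact (sum_indicator_of_mem (M k).pairwise_disjoint_interior (fun L => (n + 2 : ℝ)⁻¹ •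
        ∑ i, ψ ((M k).simplex L i) • conserved (V k ((M k).vertex L i))) hKn (hK k)).symm
    · have h0 : ∀ i, ψ ((M k).simplex (K k) i) = 0 := fun i =>
        hψS _ fun hi => hKn ((M k).mem_near_of_vertex hS hi)
      simp only [Function.comp, h0, zero_smul, Finset.sum_const_zero, smul_zero]
      refine (Finset.sum_eq_zero fun L hL => indicator_of_notMem (fun hxL => ?_) _).symm
      exact hKn ((M k).eq_of_mem_interior (hK k) (interior_subset hxL) ▸ hL)

end

section

variable {n : ℕ}

/-! ### The limit of the discrete weak form -/

theorem floor_div_eq_iff {t dt : ℝ} (hdt : 0 < dt) (ht : 0 ≤ t) {j : ℕ} :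
    ⌊t / dt⌋₊ = j ↔ t ∈ Ico (j * dt) ((j + 1 : ℕ) * dt) := by
  rw [Nat.floor_eq_iff (div_nonneg ht hdt.le), le_div_iff₀ hdt, div_lt_iff₀ hdt, mem_Ico]
  push_cast
  rfl

theorem floor_div_lt {t T dt : ℝ} (hdt : 0 < dt) (ht : 0 ≤ t) (htT : t < T) {N : ℕ}
    (hN : T ≤ N * dt) : ⌊t / dt⌋₊ < N := by
  rw [Nat.floor_lt (div_nonneg ht hdt.le), div_lt_iff₀ hdt]
  exact htT.trans_le hN

theorem tendsto_floor_div_mul {dt : ℕ → ℝ} (hdt : ∀ k, 0 < dt k) (hdt0 : Tendsto dt atTop (𝓝 0))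
    {t : ℝ} (ht : 0 ≤ t) : Tendsto (fun k => (⌊t / dt k⌋₊ : ℝ) * dt k) atTop (𝓝 t) := by
  refine tendsto_iff_dist_tendsto_zero.2 (squeeze_zero (fun _ => dist_nonneg) (fun k => ?_) hdt0)
  have h := (floor_div_eq_iff (hdt k) ht).1 (rfl : ⌊t / dt k⌋₊ = _)
  rw [Real.dist_eq, abs_le]
  have h2 := h.2
  push_cast at h2
  constructor <;> nlinarith [h.1, hdt k]

theorem pairwise_disjoint_timeCells {Ω : Set (Pt n)} (M : Mesh n Ω) {dt : ℝ} (hdt : 0 < dt) :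
    Pairwise (Function.onFun Disjoint fun q : ℕ × M.Elem =>
      Ico (q.1 * dt) ((q.1 + 1 : ℕ) * dt) ×ˢ interior (M.cell q.2)) := by
  rintro ⟨j, K⟩ ⟨l, L⟩ hne
  refine Set.disjoint_left.2 fun z hz hz' => hne ?_
  have h0 : 0 ≤ z.1 := (mul_nonneg (Nat.cast_nonneg _) hdt.le).trans hz.1.1
  refine Prod.ext ?_ (M.eq_of_mem_interior hz.2 (interior_subset hz'.2))
  exact ((floor_div_eq_iff hdt h0).2 hz.1).symm.trans ((floor_div_eq_iff hdt h0).2 hz'.1)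

/-- Every summand of the density carries a value of φ at a vertex of the space-time cell. This
locates the support of the density. -/
theorem Residuals.exists_ne_zero_of_testDensity_ne_zero {Ω : Set (Pt n)} {M : Mesh n Ω}
    {R : Residuals M} {eos : EquationOfState} {dt : ℝ} {φ : ℝ × Pt n → ℝ} {U : ℕ → M.NodalField}
    {j : ℕ} {K : M.Elem} (h : R.testDensity eos dt φ U j K ≠ 0) :
    ∃ i, φ ((j + 1 : ℕ) * dt, M.simplex K i) ≠ 0 ∨ φ (j * dt, M.simplex K i) ≠ 0 := by
  by_contra! hc
  refine h ?_
  rw [testDensity]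
  simp only [fun i => (hc i).1, fun i => (hc i).2, sub_zero, zero_div, zero_smul,
    Finset.sum_const_zero, smul_zero]

theorem Mesh.exists_variation_le {Q : Set (State n)} (hQ : IsCompact Q) :
    ∃ v : ℝ, 0 ≤ v ∧ ∀ {Ω : Set (Pt n)} (M : Mesh n Ω) (V : M.NodalField) (K : M.Elem),
      (∀ σ, V σ ∈ Q) → M.variation V K ≤ v := by
  refine ⟨∑ _a : Fin (n + 2), ∑ _b : Fin (n + 2), Metric.diam Q,
    Finset.sum_nonneg fun _ _ => Finset.sum_nonneg fun _ _ => Metric.diam_nonneg,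
    fun M V K hV => Finset.sum_le_sum fun a _ => Finset.sum_le_sum fun b _ => ?_⟩
  rw [← dist_eq_norm]
  exact Metric.dist_le_diam_of_mem hQ.isBounded (hV _) (hV _)

/-- If the nodal values of the scheme converge almost everywhere, then the nodal quadratures of
the initial data converge to the weak form. -/
theorem tendsto_nodalSum_weakForm {Ω : Set (Pt n)} (hΩ : IsOpen Ω) {eos : EquationOfState}
    {M : ℕ → Mesh n Ω} (hsize : MeshSizeTendsToZero M) {c₀ : ℝ} (hc₀ : 0 < c₀)
    (hreg : ∀ k, ∀ K : (M k).Elem,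
      c₀ * Metric.diam ((M k).cell K) ^ (n + 1) ≤ volume.real ((M k).cell K))
    {T : ℝ} {dt : ℕ → ℝ} (hdt : ∀ k, 0 < dt k) (hdt0 : Tendsto dt atTop (𝓝 0))
    {N : ℕ → ℕ} (hN : ∀ k, T ≤ N k * dt k) {R : ∀ k, Residuals (M k)}
    {U : ∀ k, ℕ → (M k).NodalField} {Q : Set (State n)} (hQ : IsCompact Q)
    (hQa : Q ⊆ eos.admissible n) (hU : ∀ k, ∀ j ≤ N k, ∀ σ, U k j σ ∈ Q)
    (hsum : ∀ k, ∀ j < N k, ∀ K, ∑ i, (R k).interior eos (U k j) (U k (j + 1)) K i = 0)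
    {P : ℝ} (hP0 : 0 ≤ P) (hP : ∀ k, ∀ j < N k, ∀ K i,
      ‖(R k).conserved (U k j) (U k (j + 1)) K i‖ ≤
        P * Metric.diam ((M k).cell K) ^ n * (M k).variation (U k j) K)
    (hstep : ∀ k, ∀ j < N k, ∀ σ : (M k).Vertex, σ.1 ∈ Ω →
      (M k).dualVolume σ • (conserved (U k (j + 1) σ) - conserved (U k j σ))
        + dt k • ∑ᶠ q ∈ (M k).star σ, (R k).interior eos (U k j) (U k (j + 1)) q.1 q.2 = 0)
    {u : ℝ × Pt n → State n} (hu : ∀ᵐ z ∂volume.restrict (Ioo 0 T ×ˢ Ω), u z ∈ Q)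
    (hlim : ∀ᵐ z ∂volume.restrict (Ioo 0 T ×ˢ Ω), ∀ ε > 0, ∀ᶠ k in atTop, ∀ K,
      z.2 ∈ interior ((M k).cell K) →
        ∀ i, ‖U k ⌊z.1 / dt k⌋₊ ((M k).vertex K i) - u z‖ < ε)
    {φ : ℝ × Pt n → ℝ} (hφ : ContDiff ℝ ∞ φ) (hφc : HasCompactSupport φ)
    (hφs : tsupport φ ⊆ Iio T ×ˢ Ω) :
    Tendsto (fun k => (M k).nodalSum (hφc.isCompact.image continuous_snd) (fun x => φ (0, x))
      (U k 0)) atTop (𝓝 (-weakForm eos Ω T u φ)) := by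
  have hS : IsCompact (Prod.snd '' tsupport φ) := hφc.isCompact.image continuous_snd
  have hI : IsCompact (Prod.fst '' tsupport φ) := hφc.isCompact.image continuous_fst
  have hSΩ : Prod.snd '' tsupport φ ⊆ Ω := by
    rintro _ ⟨z, hz, rfl⟩; exact (hφs hz).2
  have hIT : Prod.fst '' tsupport φ ⊆ Iio T := by
    rintro _ ⟨z, hz, rfl⟩; exact (hφs hz).1
  have hφS : ∀ t, ∀ x ∉ Prod.snd '' tsupport φ, φ (t, x) = 0 := fun t x hx => by
    by_contra h
    exact hx ⟨(t, x), subset_tsupport φ h, rfl⟩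
  have hφI : ∀ t x, φ (t, x) ≠ 0 → t ∈ Prod.fst '' tsupport φ := fun t x h =>
    ⟨(t, x), subset_tsupport φ h, rfl⟩
  obtain ⟨δ, hδ, hδΩ⟩ := hS.exists_cthickening_subset_open hΩ hSΩ
  -- The margin `τ` keeps the time cells that touch the support of φ below `T` once the time step is
  -- at most `τ`; `δ` plays the same role in space.
  obtain ⟨τ, hτ, hτT⟩ := hI.exists_cthickening_subset_open isOpen_Iio hIT
  obtain ⟨L, hL⟩ := hφ.lipschitzWith_of_hasCompactSupport hφc (by simp)
  have hL' : ∀ a b, |φ a - φ b| ≤ (L : ℝ) * dist a b := fun a b => by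
    rw [← Real.dist_eq]; exact hL.dist_le_mul a b
  obtain ⟨B, hB0, hB⟩ := exists_fluxNorm_interp_le eos hQ hQa
  obtain ⟨BW, hBW⟩ := hQ.exists_bound_of_continuousOn ((continuousOn_conserved eos).mono hQa)
  obtain ⟨v, hv0, hv⟩ := Mesh.exists_variation_le hQ
  have hX : IsCompact (Metric.cthickening δ (Prod.snd '' tsupport φ)) := hS.cthickening
  have hvol : ∀ k (q : ℕ × (M k).Elem), volume.real
      (Ico (q.1 * dt k) ((q.1 + 1 : ℕ) * dt k) ×ˢ interior ((M k).cell q.2)) =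
      dt k * volume.real ((M k).cell q.2) := by
    intro k q
    rw [Measure.volume_eq_prod, measureReal_prod_prod, (M k).volume_real_interior,
      Real.volume_real_Ico_of_le (by push_cast; nlinarith [hdt k])]
    push_cast
    ring
  have hBD : (Ico 0 T ×ˢ Metric.cthickening δ (Prod.snd '' tsupport φ) : Set (ℝ × Pt n))
      ≤ᵐ[volume] Ioo 0 T ×ˢ Ω := by
    have h1 : (Ico 0 T ×ˢ Metric.cthickening δ (Prod.snd '' tsupport φ) : Set (ℝ × Pt n))
        =ᵐ[volume] Ioo 0 T ×ˢ Metric.cthickening δ (Prod.snd '' tsupport φ) :=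
      Measure.set_prod_ae_eq Ioo_ae_eq_Ico.symm (ae_eq_refl _)
    exact h1.le.trans (Eventually.of_forall (prod_mono_right hδΩ))
  have key := tendsto_sum_cells (μ := (volume : Measure (ℝ × Pt n)))
    (A := fun k => Finset.range (N k) ×ˢ (M k).near hS)
    (s := fun k q => Ico (q.1 * dt k) ((q.1 + 1 : ℕ) * dt k) ×ˢ interior ((M k).cell q.2))
    (c := fun k q => (R k).testDensity eos (dt k) φ (U k) q.1 q.2)
    (B := Ico 0 T ×ˢ Metric.cthickening δ (Prod.snd '' tsupport φ)) (D := Ioo 0 T ×ˢ Ω)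
    (C := L * BW + c₀⁻¹ * ((n + 2) * (L * (P * v +
        (n + 2) * ((n + 1) * (n + 1).factorial) * (2 * B))) +
        B * ((n + 2) * (L * ((n + 1) * (n + 1).factorial)))))
    (g := fun z => deriv (fun t => φ (t, z.2)) z.1 • conserved (u z)
      + eulerFlux eos (u z) (gradient (fun x => φ (z.1, x)) z.2))
    (fun k q => measurableSet_Ico.prod isOpen_interior.measurableSet) ?_
    (fun k => pairwise_disjoint_timeCells (M k) (hdt k))
    (measurableSet_Ico.prod hX.isClosed.measurableSet) ?_ hBD ?_ ?_
  · have h1 := key.neg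
    refine h1.congr fun k => ?_
    simp only [hvol]
    -- The final time is at least `T`, outside the support of φ, so summation by parts leaves no
    -- term there.
    exact ((R k).discrete_weak_form eos hSΩ (fun K i hi => (M k).mem_near_of_vertex hS hi) hφS
      (hdt k).ne' (fun x => by
        by_contra h
        exact (hIT (hφI _ _ h)).not_ge (hN k)) (hstep k)).symm
  · intro k q
    rw [Measure.volume_eq_prod, Measure.prod_prod]
    exact ENNReal.mul_ne_top measure_Ico_lt_top.ne ((measure_mono interior_subset).trans_lt
      ((M k).isCompact_cell q.2).measure_lt_top).ne
  · rw [Measure.volume_eq_prod, Measure.prod_prod]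
    exact ENNReal.mul_ne_top measure_Ico_lt_top.ne hX.measure_lt_top.ne
  · filter_upwards [hsize δ hδ, hdt0.eventually_le_const hτ] with k hk hkτ q hq hne
    obtain ⟨hq1, hq2⟩ := Finset.mem_product.1 hq
    rw [Finset.mem_range] at hq1
    refine ⟨?_, ?_⟩
    · rintro z ⟨hz1, hz2⟩
      refine ⟨⟨(mul_nonneg (Nat.cast_nonneg _) (hdt k).le).trans hz1.1, ?_⟩,
        mem_cthickening_of_cell (hk q.2) (((M k).mem_near hS).1 hq2) (interior_subset hz2)⟩
      -- One of the two end times of the cell is in the time support of φ, and every time in the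
      -- cell is within one time step of it.
      obtain ⟨i, hi⟩ := Residuals.exists_ne_zero_of_testDensity_ne_zero hne
      have hz12 := hz1.2
      push_cast at hz12
      rcases hi with hi | hi
      · refine hτT (Metric.mem_cthickening_of_dist_le _ _ _ _ (hφI _ _ hi) ?_)
        rw [Real.dist_eq, abs_le]
        push_cast
        constructor <;> nlinarith [hz1.1, hdt k]
      · refine hτT (Metric.mem_cthickening_of_dist_le _ _ _ _ (hφI _ _ hi) ?_)
        rw [Real.dist_eq, abs_le]
        constructor <;> nlinarith [hz1.1, hdt k]
    · refine Residuals.norm_testDensity_le L.coe_nonneg hL' hc₀ (hreg k q.2) (hdt k)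
        (fun i => hQa (hU k _ hq1.le _)) (hsum k _ hq1 _) (mul_nonneg hP0 hv0) (fun i => ?_) hB0
        (hB (M k) _ _ fun i => hU k _ hq1.le _) (fun i => hBW _ (hU k _ hq1.le _))
      refine (hP k _ hq1 _ i).trans ?_
      rw [mul_right_comm]
      exact mul_le_mul_of_nonneg_right (mul_le_mul_of_nonneg_left
        (hv (M k) _ _ (hU k _ hq1.le)) hP0) (pow_nonneg Metric.diam_nonneg n)
  · have hcell : ∀ᵐ z ∂volume.restrict (Ioo 0 T ×ˢ Ω), ∀ k, ∃ K, z.2 ∈ interior ((M k).cell K) := by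
      refine ae_all_iff.2 fun k => ?_
      rw [ae_restrict_iff' (measurableSet_Ioo.prod hΩ.measurableSet)]
      filter_upwards [Measure.quasiMeasurePreserving_snd.ae (M k).ae_mem_interior_cell]
        with z hz hzΩ using hz (subset_closure hzΩ.2)
    filter_upwards [hu, hlim, hcell, ae_restrict_mem (measurableSet_Ioo.prod hΩ.measurableSet)]
      with z hzQ hz hzc hzD
    choose K hK using hzc
    have ht0 : 0 ≤ z.1 := hzD.1.1.le
    have hj : ∀ k, ⌊z.1 / dt k⌋₊ < N k := fun k => floor_div_lt (hdt k) ht0 hzD.1.2 (hN k)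
    have hdiam : Tendsto (fun k => Metric.diam ((M k).cell (K k))) atTop (𝓝 0) := by
      refine tendsto_zero_of_eventually_norm_le (C := 1) fun ε hε => ?_
      filter_upwards [hsize ε hε] with k hk
      rw [one_mul, Real.norm_of_nonneg Metric.diam_nonneg]
      exact hk _
    have hval : ∀ i, Tendsto (fun k => U k ⌊z.1 / dt k⌋₊ ((M k).vertex (K k) i)) atTop
        (𝓝 (u z)) := fun i => by
      refine Metric.tendsto_nhds.2 fun ε hε => ?_
      filter_upwards [hz ε hε] with k hk
      rw [dist_eq_norm]
      exact hk _ (hK k) i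
    have h := tendsto_testDensity (R := R) (j := fun k => ⌊z.1 / dt k⌋₊) hφ L.coe_nonneg hL' hc₀
      (fun k => hreg k (K k)) hdt hdt0 (fun k i => hQa (hU k _ (hj k).le _))
      (fun k => hsum k _ (hj k) _) hP0 (fun k i => hP k _ (hj k) _ i)
      (fun k => interior_subset (hK k)) hdiam (tendsto_floor_div_mul hdt hdt0 ht0) (hQa hzQ) hval
    refine h.congr fun k => ?_
    have hmem : z ∈ Ico ((⌊z.1 / dt k⌋₊ : ℝ) * dt k) ((⌊z.1 / dt k⌋₊ + 1 : ℕ) * dt k) ×ˢ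
        interior ((M k).cell (K k)) :=
      ⟨(floor_div_eq_iff (hdt k) ht0).1 rfl, hK k⟩
    by_cases hKn : K k ∈ (M k).near hS
    · exact (sum_indicator_of_mem (pairwise_disjoint_timeCells (M k) (hdt k))
        (fun q => (R k).testDensity eos (dt k) φ (U k) q.1 q.2) (i := (⌊z.1 / dt k⌋₊, K k))
        (Finset.mem_product.2 ⟨Finset.mem_range.2 (hj k), hKn⟩) hmem).symm
    · have h0 : (R k).testDensity eos (dt k) φ (U k) ⌊z.1 / dt k⌋₊ (K k) = 0 := by
        by_contra hne
        obtain ⟨i, hi⟩ := Residuals.exists_ne_zero_of_testDensity_ne_zero hne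
        refine hKn ((M k).mem_near_of_vertex hS (i := i) ?_)
        by_contra hiS
        rcases hi with hi | hi <;> exact hi (hφS _ _ hiS)
      rw [h0]
      refine (Finset.sum_eq_zero fun q hq => indicator_of_notMem (fun hxL => ?_) _).symm
      exact hKn ((M k).eq_of_mem_interior (hK k) (interior_subset hxL.2) ▸
        (Finset.mem_product.1 hq).2)

end

section

variable {n : ℕ}

/-! ### Local integrability and admissibility of the limits -/

/-- Hölder's inequality on a compact set, which has finite measure; the exponent 1 - 1/p is
nonnegative. -/
theorem TendstoInLpLoc.tendsto_lintegral {X : Type*} [TopologicalSpace X] [MeasureSpace X]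
    [IsFiniteMeasureOnCompacts (volume : Measure X)] {p : ℝ≥0∞} (hp : 1 ≤ p) {s : Set X}
    {f : ℕ → X → State n} {g : X → State n} (h : TendstoInLpLoc p s f g)
    (hf : ∀ k, AEStronglyMeasurable (f k) (volume.restrict s))
    (hg : AEStronglyMeasurable g (volume.restrict s)) {C : Set X} (hC : IsCompact C)
    (hCs : C ⊆ s) : Tendsto (fun k => ∫⁻ z in C, ‖f k z - g z‖ₑ) atTop (𝓝 0) := by
  have hfin : volume C ≠ ⊤ := hC.measure_lt_top.ne
  have h1 := ENNReal.Tendsto.mul_const (h C hC hCs)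
    (b := (volume.restrict C univ) ^ (1 / (1 : ℝ≥0∞).toReal - 1 / p.toReal))
    (Or.inr (ENNReal.rpow_ne_top_of_nonneg (by
      rw [sub_nonneg, ENNReal.toReal_one, one_div_one]
      rcases eq_or_ne p ⊤ with rfl | hpt
      · simp
      · have : 1 ≤ p.toReal := by
          simpa using (ENNReal.toReal_le_toReal ENNReal.one_ne_top hpt).2 hp
        rw [div_le_one (by linarith)]
        exact this) (by rwa [Measure.restrict_apply_univ])))
  rw [zero_mul] at h1
  refine tendsto_of_tendsto_of_tendsto_of_le_of_le tendsto_const_nhds h1 (fun _ => zero_le)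
    fun k => ?_
  have h2 := eLpNorm_le_eLpNorm_mul_rpow_measure_univ hp
    (((hf k).sub hg).mono_measure (Measure.restrict_mono hCs le_rfl))
  rwa [eLpNorm_one_eq_lintegral_enorm] at h2

theorem locallyIntegrableOn_comp_of_mem_compact {X : Type*} [TopologicalSpace X] [MeasureSpace X]
    [OpensMeasurableSpace X] [IsLocallyFiniteMeasure (volume : Measure X)] {s : Set X}
    {u : X → State n} (hu : AEStronglyMeasurable u (volume.restrict s)) {Q : Set (State n)}
    (hQ : IsCompact Q) (huQ : ∀ᵐ x ∂volume.restrict s, u x ∈ Q) {F : State n → Cons n}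
    (hF : ContinuousOn F Q) : LocallyIntegrableOn (fun x => F (u x)) s := by
  classical
  obtain ⟨B, hB⟩ := hQ.exists_bound_of_continuousOn hF
  -- `F` is controlled only on `Q`, so it is replaced by 0 elsewhere to have a measurable function;
  -- almost everywhere this changes nothing.
  have hm : Measurable (Q.piecewise F 0) :=
    hF.measurable_piecewise continuousOn_const hQ.isClosed.measurableSet
  have hFm : AEStronglyMeasurable (fun x => F (u x)) (volume.restrict s) := by
    refine (hm.comp_aemeasurable hu.aemeasurable).aestronglyMeasurable.congr ?_
    filter_upwards [huQ] with x hx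
    exact piecewise_eq_of_mem _ _ _ hx
  intro x _
  obtain ⟨v, hv, hvfin⟩ := (volume : Measure X).finiteAt_nhds x
  refine ⟨s ∩ v, inter_mem_nhdsWithin s hv, ?_⟩
  have hle : volume.restrict (s ∩ v) ≤ volume.restrict s :=
    Measure.restrict_mono inter_subset_left le_rfl
  have : IsFiniteMeasure (volume.restrict (s ∩ v)) :=
    ⟨by rw [Measure.restrict_apply_univ]; exact (measure_mono inter_subset_right).trans_lt hvfin⟩
  refine Integrable.of_bound (hFm.mono_measure hle) B ?_
  filter_upwards [ae_mono hle huQ] with y hy using hB _ hy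

theorem isAdmissibleOn_of_mem_compact {eos : EquationOfState} {s : Set (ℝ × Pt n)}
    {u : ℝ × Pt n → State n} (hu : AEStronglyMeasurable u (volume.restrict s)) {Q : Set (State n)}
    (hQ : IsCompact Q) (hQa : Q ⊆ eos.admissible n) (huQ : ∀ᵐ z ∂volume.restrict s, u z ∈ Q) :
    IsAdmissibleOn eos s u :=
  ⟨hu, huQ.mono fun _ h => hQa h,
    locallyIntegrableOn_comp_of_mem_compact hu hQ huQ ((continuousOn_conserved eos).mono hQa),
    fun ν => locallyIntegrableOn_comp_of_mem_compact hu hQ huQ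
      ((continuousOn_eulerFlux eos ν).mono hQa)⟩

theorem restrict_Ico_prod_eq (T : ℝ) (Ω : Set (Pt n)) :
    (volume : Measure (ℝ × Pt n)).restrict (Ico 0 T ×ˢ Ω) = volume.restrict (Ioo 0 T ×ˢ Ω) :=
  Measure.restrict_congr_set (Measure.set_prod_ae_eq Ioo_ae_eq_Ico.symm (ae_eq_refl _))

variable {Ω : Set (Pt n)} {M : ℕ → Mesh n Ω}

/-- Limits of nodal values stay in a closed set. -/
theorem ae_mem_of_nodal_tendsto (hΩ : IsOpen Ω) {J : Set ℝ} (hJ : IsOpen J)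
    {W : ∀ k, ℝ → (M k).NodalField} {Q : Set (State n)} (hQ : IsClosed Q)
    (hW : ∀ k, ∀ t ∈ J, ∀ σ, W k t σ ∈ Q) {u : ℝ × Pt n → State n}
    (hlim : ∀ᵐ z ∂(volume : Measure (ℝ × Pt n)).restrict (J ×ˢ Ω), ∀ ε > 0, ∀ᶠ k in atTop, ∀ K,
      z.2 ∈ interior ((M k).cell K) → ∀ i, ‖W k z.1 ((M k).vertex K i) - u z‖ < ε) :
    ∀ᵐ z ∂(volume : Measure (ℝ × Pt n)).restrict (J ×ˢ Ω), u z ∈ Q := by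
  have hcell : ∀ᵐ z ∂(volume : Measure (ℝ × Pt n)).restrict (J ×ˢ Ω),
      ∀ k, ∃ K, z.2 ∈ interior ((M k).cell K) := by
    refine ae_all_iff.2 fun k => ?_
    rw [ae_restrict_iff' (hJ.prod hΩ).measurableSet]
    filter_upwards [Measure.quasiMeasurePreserving_snd.ae (M k).ae_mem_interior_cell]
      with z hz hzΩ using hz (subset_closure hzΩ.2)
  filter_upwards [hlim, hcell, ae_restrict_mem (hJ.prod hΩ).measurableSet] with z hz hzc hzD
  choose K hK using hzc
  refine hQ.mem_of_tendsto (f := fun k => W k z.1 ((M k).vertex (K k) 0)) (b := atTop)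
    (Metric.tendsto_nhds.2 fun ε hε => ?_) (Eventually.of_forall fun k => hW k _ hzD.1 _)
  filter_upwards [hz ε hε] with k hk
  rw [dist_eq_norm]
  exact hk _ (hK k) 0

/-- The space-time result is applied to functions constant in a dummy time variable from (0,1); by
Fubini a property that holds almost everywhere in the product holds almost everywhere in space. -/
theorem exists_subseq_initial_tendsto (hΩ : IsOpen Ω) (hsize : MeshSizeTendsToZero M)
    {V : ∀ k, (M k).NodalField} {Q : Set (State n)} (hQ : IsCompact Q)
    (hV : ∀ k σ, V k σ ∈ Q) {u : Pt n → State n}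
    (hu : AEStronglyMeasurable u (volume.restrict Ω))
    (hconv : ∀ C : Set (Pt n), IsCompact C → C ⊆ Ω →
      Tendsto (fun k => ∫⁻ x in C, ‖(M k).recon (V k) x - u x‖ₑ) atTop (𝓝 0)) :
    ∃ ns : ℕ → ℕ, StrictMono ns ∧ (∀ᵐ x ∂volume.restrict Ω, u x ∈ Q) ∧
      ∀ᵐ x ∂volume.restrict Ω, ∀ ε > 0, ∀ᶠ k in atTop, ∀ K,
        x ∈ interior ((M (ns k)).cell K) → ∀ i,
          ‖V (ns k) ((M (ns k)).vertex K i) - u x‖ < ε := by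
  obtain ⟨r, hr0, hr⟩ := hQ.isBounded.exists_pos_norm_le
  have hprod : (volume : Measure (ℝ × Pt n)).restrict (Ioo 0 1 ×ˢ Ω) =
      (volume.restrict (Ioo 0 1)).prod (volume.restrict Ω) :=
    (Measure.prod_restrict _ _).symm
  have hNe : (ae ((volume : Measure ℝ).restrict (Ioo 0 1))).NeBot := by
    rw [ae_restrict_neBot]; simp
  have hdescend : ∀ q : Pt n → Prop, (∀ᵐ z ∂(volume : Measure (ℝ × Pt n)).restrict
      (Ioo 0 1 ×ˢ Ω), q z.2) → ∀ᵐ x ∂volume.restrict Ω, q x := by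
    intro q hq
    rw [hprod] at hq
    obtain ⟨t, ht⟩ := (Measure.ae_ae_of_ae_prod hq).exists
    exact ht
  obtain ⟨ns, hns, h⟩ := exists_subseq_nodal_tendsto (M := M) (U := fun k _ => V k)
    (idx := fun _ _ => 0) (J := Ioo 0 1) (r := r) (u := fun z => u z.2) hΩ isOpen_Ioo hsize
    (fun _ => measurable_const) hr0.le (fun k _ _ σ => hr _ (hV k σ))
    (by rw [hprod]; exact hu.comp_snd) (by
      intro C hC hCJ
      have hC' : IsCompact (Prod.snd '' C) := hC.image continuous_snd
      have hC'Ω : Prod.snd '' C ⊆ Ω := by rintro _ ⟨z, hz, rfl⟩; exact (hCJ hz).2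
      refine tendsto_of_tendsto_of_tendsto_of_le_of_le tendsto_const_nhds
        (hconv _ hC' hC'Ω) (fun _ => zero_le) fun k => ?_
      have hsub : C ⊆ Ioo 0 1 ×ˢ (Prod.snd '' C) := fun z hz => ⟨(hCJ hz).1, z, hz, rfl⟩
      refine (lintegral_mono_set hsub).trans (le_of_eq ?_)
      have hg : AEMeasurable (fun x => ‖(M k).recon (V k) x - u x‖ₑ)
          (volume.restrict (Prod.snd '' C)) :=
        (((M k).measurable_recon (V k)).aestronglyMeasurable.sub
          (hu.mono_measure (Measure.restrict_mono hC'Ω le_rfl))).enorm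
      have hmul := lintegral_prod_mul (μ := (volume : Measure ℝ).restrict (Ioo 0 1))
        (f := fun _ => 1) aemeasurable_const hg
      simp only [one_mul, lintegral_const, Measure.restrict_apply_univ, Real.volume_Ioo, sub_zero,
        ENNReal.ofReal_one] at hmul
      rw [← hmul, Measure.prod_restrict]
      rfl)
  refine ⟨ns, hns, hdescend _ ?_, hdescend _ h⟩
  exact ae_mem_of_nodal_tendsto (M := fun k => M (ns k)) hΩ isOpen_Ioo
    (W := fun k _ => V (ns k)) hQ.isClosed (fun k _ _ σ => hV _ σ) h

end

end EulerRD

end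

/-! ### Assembly of the four claims. -/

open EulerRD
theorem mainTheorem1 (n : ℕ) (Ω : Set (Pt n)) (hΩ : IsOpen Ω) (T : ℝ) (hT : 0 < T)
    (eos : EquationOfState)
    (M : ℕ → Mesh n Ω) (hsize : MeshSizeTendsToZero M) (hreg : ShapeRegular M)
    (dt : ℕ → ℝ) (hdt : ∀ k, 0 < dt k) (hdt_lim : Tendsto dt atTop (𝓝 0))
    (N : ℕ → ℕ) (hN : ∀ k, T ≤ N k * dt k)
    (R : ∀ k, Residuals (M k))
    (hcons : ∀ k, (R k).MassMomentumConservation eos)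
    (henergy : ∀ k, (R k).InternalEnergyRelation eos)
    (hbound : ResidualBound eos R)
    (U : ∀ k, ℕ → (M k).NodalField)
    (hU : ∀ k, (R k).IsSolution (dt k) (N k) (U k))
    (hU_bdd : StaysBounded eos N U)
    (p : ℝ≥0∞) (hp : 1 ≤ p)
    (Ulim : ℝ × Pt n → State n)
    (hUlim : AEStronglyMeasurable Ulim (volume.restrict (Ioo 0 T ×ˢ Ω)))
    (hconv : TendstoInLpLoc p (Ioo 0 T ×ˢ Ω) (fun k => (M k).approx (dt k) (U k)) Ulim) :
    (∀ k, ∀ V V' : (M k).NodalField, (M k).Admissible eos V → (M k).Admissible eos V' →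
      ∀ K, ∑ i, (R k).totalEnergy V V' K i = ((M k).totalFlux eos V K).2.2 ∧
        ∑ i, (R k).conserved V V' K i = (M k).totalFlux eos V K) ∧
    (∀ k, ∀ j < N k,
      (∀ σ : (M k).Vertex, σ.1 ∈ Ω →
        (M k).dualVolume σ • (conserved (U k (j + 1) σ) - conserved (U k j σ))
          + dt k • ∑ᶠ q ∈ (M k).star σ, (R k).conserved (U k j) (U k (j + 1)) q.1 q.2 = 0) ∧
      (R k).HasFluxForm eos (dt k) (U k j) (U k (j + 1))) ∧
    IsWeakSolution eos Ω T Ulim ∧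
    ∀ U₀ : Pt n → State n, AEStronglyMeasurable U₀ (volume.restrict Ω) →
      TendstoInLpLoc p Ω (fun k => (M k).recon (U k 0)) U₀ →
      IsWeakSolutionWithData eos Ω T Ulim U₀ := by
  obtain ⟨Q, hQ, hQa, hUQ⟩ := hU_bdd
  have hadm : ∀ k, ∀ j ≤ N k, (M k).Admissible eos (U k j) := fun k j hj σ => hQa (hUQ k j hj σ)
  have hstep : ∀ k, ∀ j < N k, ∀ σ : (M k).Vertex, σ.1 ∈ Ω →
      (M k).dualVolume σ • (conserved (U k (j + 1) σ) - conserved (U k j σ))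
        + dt k • ∑ᶠ q ∈ (M k).star σ, (R k).conserved (U k j) (U k (j + 1)) q.1 q.2 = 0 :=
    fun k j hj σ hσ => Residuals.conserved_step (hadm k j hj.le) (hadm k _ hj) (hU k j hj σ hσ)
  obtain ⟨P, hP0, hP⟩ := hbound.conserved hQ hQa
  obtain ⟨c₀, hc₀, hreg⟩ := hreg
  obtain ⟨r, hr0, hr⟩ := hQ.isBounded.exists_pos_norm_le
  have hlt : ∀ k, ∀ t ∈ Ioo 0 T, ⌊t / dt k⌋₊ < N k := fun k t ht =>
    floor_div_lt (hdt k) ht.1.le ht.2 (hN k)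
  have hidx : ∀ k, Measurable fun t : ℝ => ⌊t / dt k⌋₊ := fun k =>
    Nat.measurable_floor.comp (measurable_id.div_const _)
  obtain ⟨ns, hns, hnodal⟩ := exists_subseq_nodal_tendsto (U := U) (idx := fun k t => ⌊t / dt k⌋₊)
    hΩ isOpen_Ioo hsize hidx hr0.le (fun k t ht σ => hr _ (hUQ k _ (hlt k t ht).le σ)) hUlim
    fun C hC hCs => hconv.tendsto_lintegral hp
      (fun k => ((M k).measurable_recon_idx (U k) (hidx k)).aestronglyMeasurable) hUlim hC hCs
  have hUlimQ : ∀ᵐ z ∂volume.restrict (Ioo 0 T ×ˢ Ω), Ulim z ∈ Q :=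
    ae_mem_of_nodal_tendsto (M := fun k => M (ns k)) hΩ isOpen_Ioo
      (W := fun k t => U (ns k) ⌊t / dt (ns k)⌋₊) hQ.isClosed
      (fun k t ht σ => hUQ _ _ (hlt _ t ht).le σ) hnodal
  -- Stated for all further subsequences, because convergence of the initial nodal values requires
  -- one more extraction.
  have hweak : ∀ ms : ℕ → ℕ, StrictMono ms → ∀ φ : ℝ × Pt n → ℝ, ContDiff ℝ ∞ φ →
      ∀ hφc : HasCompactSupport φ, tsupport φ ⊆ Iio T ×ˢ Ω →
      Tendsto (fun k => (M (ns (ms k))).nodalSum (hφc.isCompact.image continuous_snd)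
        (fun x => φ (0, x)) (U (ns (ms k)) 0)) atTop (𝓝 (-weakForm eos Ω T Ulim φ)) := by
    intro ms hms φ hφ hφc hφs
    have hsub := (hns.comp hms).tendsto_atTop
    refine tendsto_nodalSum_weakForm (M := fun k => M (ns (ms k))) (R := fun k => R (ns (ms k)))
      (dt := fun k => dt (ns (ms k))) (N := fun k => N (ns (ms k)))
      (U := fun k => U (ns (ms k))) hΩ (fun ε hε => hsub.eventually (hsize ε hε)) hc₀
      (fun k => hreg _) (fun k => hdt _) (hdt_lim.comp hsub) (fun k => hN _) hQ hQa
      (fun k => hUQ _) (fun k j hj K => Residuals.sum_interior (hcons _) (henergy _)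
        (hadm _ j hj.le) (hadm _ _ hj) K) hP0
      (fun k j hj => hP _ _ _ (hUQ _ j hj.le) (hUQ _ _ hj))
      (fun k j hj σ hσ => Residuals.interior_step hΩ hσ (hstep _ j hj σ hσ)) hUlimQ ?_ hφ hφc hφs
    filter_upwards [hnodal] with z hz ε hε using hms.tendsto_atTop.eventually (hz ε hε)
  refine ⟨fun k V V' hV hV' K => ⟨Residuals.sum_totalEnergy (henergy k) hV hV' K,
    Residuals.sum_conserved (hcons k) (henergy k) hV hV' K⟩,
    fun k j hj => ⟨hstep k j hj, Residuals.hasFluxForm hΩ (hcons k) (henergy k)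
      (hadm k j hj.le) (hadm k _ hj) (fun K c hc i => ?_) (hstep k j hj)⟩,
    ⟨isAdmissibleOn_of_mem_compact hUlim hQ hQa hUlimQ, fun φ hφ hφc hφs => ?_⟩,
    fun U₀ hU₀ hconv₀ => ?_⟩
  -- Constant data have zero variation, so the residual bound forces the residuals to vanish.
  · have h := hP k _ _ (hUQ k j hj.le) (hUQ k _ hj) K i
    have hvar : (M k).variation (U k j) K = 0 := by simp [Mesh.variation, hc]
    rw [hvar, mul_zero] at h
    exact norm_le_zero_iff.1 h
  -- The support lies in positive times, so all the initial quadratures are zero, and so is their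
  -- limit.
  · have h0 : ∀ x, φ (0, x) = 0 := fun x => by
      by_contra h
      exact lt_irrefl 0 (hφs (subset_tsupport φ h)).1.1
    have h := hweak id strictMono_id φ hφ hφc
      (hφs.trans (prod_mono_left fun t ht => ht.2))
    simp only [Mesh.nodalSum, h0, zero_smul, Finset.sum_const_zero, smul_zero] at h
    exact neg_eq_zero.1 (tendsto_nhds_unique h tendsto_const_nhds)
  · have hsub := hns.tendsto_atTop
    obtain ⟨ms, hms, hU₀Q, hnodal₀⟩ := exists_subseq_initial_tendsto (M := fun k => M (ns k))
      (V := fun k => U (ns k) 0) hΩ (fun ε hε => hsub.eventually (hsize ε hε)) hQ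
      (fun k => hUQ _ 0 (Nat.zero_le _)) hU₀ fun C hC hCs =>
      (hconv₀.tendsto_lintegral hp (fun k =>
        ((M k).measurable_recon (U k 0)).aestronglyMeasurable) hU₀ hC hCs).comp hsub
    refine ⟨?_, hU₀Q.mono fun _ h => hQa h, locallyIntegrableOn_comp_of_mem_compact hU₀ hQ hU₀Q
      ((continuousOn_conserved eos).mono hQa), fun φ hφ hφc hφs => ?_⟩
    · rw [← restrict_Ico_prod_eq] at hUlim hUlimQ
      exact isAdmissibleOn_of_mem_compact hUlim hQ hQa hUlimQ
    · have h1 := hweak ms hms φ hφ hφc hφs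
      have h2 := tendsto_nodalSum (M := fun k => M (ns (ms k))) hΩ
        (fun ε hε => (hns.comp hms).tendsto_atTop.eventually (hsize ε hε)) hQ hQa
        (V := fun k => U (ns (ms k)) 0) (fun k => hUQ _ 0 (Nat.zero_le _)) hU₀Q hnodal₀
        (hφc.isCompact.image continuous_snd)
        (by rintro _ ⟨z, hz, rfl⟩; exact (hφs hz).2) (ψ := fun x => φ (0, x))
        (hφ.continuous.comp (by fun_prop)) fun x hx => by
          by_contra h
          exact hx ⟨(0, x), subset_tsupport φ h, rfl⟩
      -- The same quadratures converge to minus the weak form and to the initial integral.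
      rw [← tendsto_nhds_unique h1 h2, add_neg_cancel]
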